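/- Let $d\ge 2$, $n\ge 1$, let $\Omega\subset\mathbb R^d$ be a bounded domain and $0<\alpha\le\beta<\infty$. Let $\mathcal M(\alpha,\beta;\Omega)$ be the set of $A\in L^\infty(\Omega;\mathbb R^{d\times d})$ such that, for a.e. $x\in\Omega$ and all $\xi\in\mathbb R^d$, $$A(x)\xi\cdot\xi\ge\alpha|\xi|^2,\qquad A(x)^{-1}\xi\cdot\xi\ge\beta^{-1}|\xi|^2 .$$ A sequence $(A_k)\subset\mathcal M(\alpha,\beta;\Omega)$ *$H$-converges* to $\bar A\in\mathcal M(\alpha',\beta';\Omega)$, for some $0<\alpha'\le\beta'<\infty$, if for every $f\in H^{-1}(\Omega)$ the solutions $u_k\in H^1_0(\Omega)$ of $-\operatorname{div}(A_k\nabla u_k)=f$ and $\bar u\in H_0^1(\Omega)$ of $-\operatorname{div}(\bar A\nabla\bar u)=f$ satisfy $u_k\rightharpoonup\bar u$ weakly in $H^1_0(\Omega)$ and $A_k\nabla u_k\rightharpoonup\bar A\nabla\bar u$ weakly in $L^2(\Omega;\mathbb R^d)$. Let $A=A(x,y_1,\dots,y_n):\mathbb R^d\times(\mathbb R^{d})^n\to\mathbb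 R^{d\times d}$ be such that 1. $A(\cdot,y_1,\dots,y_n)\in\mathcal M(\alpha,\beta;\Omega)$ for all $y_1,\dots,y_n\in\mathbb R^d$; 2. $A(x,y_1+z_1,\dots,y_n+z_n)=A(x,y_1,\dots,y_n)$ for all $x,y_i\in\mathbb R^d$ and $z_i\in\mathbb Z^d$; 3. for some $\gamma\in(0,1]$ and $L>0$, $|A(x,y_1,\dots,y_n)-A(x',y_1',\dots,y_n')|\le L\big(|x-x'|+\sum_{i=1}^n|y_i-y_i'|\big)^\gamma$ for all $x,x',y_i,y_i'\in\mathbb R^d$. Let $(\varepsilon^{(k)}_1,\dots,\varepsilon^{(k)}_n)$, $k=1,2,\dots$, satisfy $\infty>\varepsilon^{(k)}_1\ge\varepsilon^{(k)}_2\ge\dots\ge\varepsilon^{(k)}_n>0$ for every $k$, and $\varepsilon^{(k)}_n\to0$ as $k\to\infty$. Then there exist a subsequence $(k_j)_j$, an integer $m$ with $0\le m\le n-1$ (and with $m\ge1$ if $n\ge2$), a vector $\delta\in(0,\infty)^m$ and a matrix $B=B(x,y_1,\dots,y_m):\mathbb R^d\times(\mathbb R^{d})^m\to\mathbb R^{d\times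 d}$ such that $B(\cdot,y_1,\dots,y_m)\in\mathcal M(\alpha,\beta;\Omega)$ for all $y_1,\dots,y_m$ (with the same $\alpha,\beta$), $B$ is $1$-periodic in each $y_i$ as in 2, $B$ satisfies the Hölder condition 3 with the same exponent $\gamma$ and some constant $L'>0$, and $$A\big(x,x/\varepsilon^{(k_j)}_1,\dots,x/\varepsilon^{(k_j)}_n\big)\quad H\text{-converges to}\quad B\big(x,x/\delta_1,\dots,x/\delta_m\big)\qquad\text{as } j\to\infty .$$ If $m=0$, then $B=B(x)$. -/

import Mathlib

open MeasureTheory Filter Topology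
open scoped ContDiff

noncomputable section

/-- `ℝ^d` with its Euclidean norm. -/
abbrev Eucl (d : ℕ) : Type := EuclideanSpace ℝ (Fin d)

/-- The product `M ξ` of a real `d × d` matrix and a vector of `ℝ^d`. -/
def matVec {d : ℕ} (M : Matrix (Fin d) (Fin d) ℝ) (ξ : Eucl d) : Eucl d :=
  Matrix.toEuclideanCLM (n := Fin d) (𝕜 := ℝ) M ξ

/-- The operator norm of a matrix with respect to the Euclidean norm. -/
def matNorm {d : ℕ} (M : Matrix (Fin d) (Fin d) ℝ) : ℝ :=
  ‖Matrix.toEuclideanCLM (n := Fin d) (𝕜 := ℝ) M‖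

/-- The class `𝓜(α, β; Ω)`: matrix fields `A ∈ L^∞(Ω; ℝ^{d×d})` such that for a.e. `x ∈ Ω`, for
all `ξ`, `A(x) ξ · ξ ≥ α |ξ|²` and `A(x)⁻¹ ξ · ξ ≥ β⁻¹ |ξ|²`. (For `α > 0` the first inequality
makes `A(x)` invertible, so the matrix inverse is the true one.) -/
structure InM {d : ℕ} (α β : ℝ) (Ω : Set (Eucl d))
    (A : Eucl d → Matrix (Fin d) (Fin d) ℝ) : Prop where
  memLp_top : ∀ i j, MemLp (fun x => A x i j) ⊤ (volume.restrict Ω)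
  coercive : ∀ᵐ x ∂(volume.restrict Ω), ∀ ξ : Eucl d,
    α * ‖ξ‖ ^ 2 ≤ inner ℝ (matVec (A x) ξ) ξ
  inv_coercive : ∀ᵐ x ∂(volume.restrict Ω), ∀ ξ : Eucl d,
    β⁻¹ * ‖ξ‖ ^ 2 ≤ inner ℝ (matVec (A x)⁻¹ ξ) ξ

/-- A coefficient matrix `A(x, y_1, …, y_n)` is `1`-periodic in every `y_i ∈ ℝ^d`. -/
def IsPeriodicCoeff {d n : ℕ}
    (A : Eucl d → (Fin n → Eucl d) → Matrix (Fin d) (Fin d) ℝ) : Prop :=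
  ∀ (x : Eucl d) (y : Fin n → Eucl d) (z : Fin n → Fin d → ℤ),
    A x (fun i => y i + WithLp.toLp 2 (fun j => (z i j : ℝ))) = A x y

/-- `A(x, y_1, …, y_n)` is Hölder continuous in all variables, with exponent `γ` and constant
`L`. -/
def IsHolderCoeff {d n : ℕ} (γ L : ℝ)
    (A : Eucl d → (Fin n → Eucl d) → Matrix (Fin d) (Fin d) ℝ) : Prop :=
  ∀ (x x' : Eucl d) (y y' : Fin n → Eucl d),
    matNorm (A x y - A x' y') ≤ L * (‖x - x'‖ + ∑ i, ‖y i - y' i‖) ^ γ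

/-- The matrix field `x ↦ A(x, x/ε_1, …, x/ε_n)`. -/
def atScales {d n : ℕ} (A : Eucl d → (Fin n → Eucl d) → Matrix (Fin d) (Fin d) ℝ)
    (ε : Fin n → ℝ) : Eucl d → Matrix (Fin d) (Fin d) ℝ :=
  fun x => A x (fun i => (ε i)⁻¹ • x)

/-- The Hilbert space `L²(Ω) × L²(Ω; ℝ^d)`, with the norm `(‖u‖² + ‖g‖²)^{1/2}`. -/
abbrev L2Pair {d : ℕ} (Ω : Set (Eucl d)) : Type :=
  WithLp 2 (Lp ℝ 2 (volume.restrict Ω) × Lp (Eucl d) 2 (volume.restrict Ω))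

/-- The pairs `(φ, ∇φ)` with `φ ∈ C_c^∞(Ω)`, as elements of `L²(Ω) × L²(Ω; ℝ^d)`. -/
def testPairs {d : ℕ} (Ω : Set (Eucl d)) : Set (L2Pair Ω) :=
  {p | ∃ φ : Eucl d → ℝ, ContDiff ℝ ∞ φ ∧ HasCompactSupport φ ∧ tsupport φ ⊆ Ω ∧
    p.fst =ᵐ[volume.restrict Ω] φ ∧ p.snd =ᵐ[volume.restrict Ω] gradient φ}

/-- `H¹₀(Ω)`, the closure of `C_c^∞(Ω)` in the `H¹` norm: an element is the pair `(u, ∇u)` of a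
function and its weak gradient. (`testPairs Ω` is already a linear subspace; the span only turns
it into a `Submodule`.) -/
def H10 {d : ℕ} (Ω : Set (Eucl d)) : Submodule ℝ (L2Pair Ω) :=
  (Submodule.span ℝ (testPairs Ω)).topologicalClosure

/-- The weak gradient of `u ∈ H¹₀(Ω)`. -/
def H10.grad {d : ℕ} {Ω : Set (Eucl d)} (u : H10 Ω) : Lp (Eucl d) 2 (volume.restrict Ω) :=
  (u : L2Pair Ω).snd

/-- `u ∈ H¹₀(Ω)` is a weak solution of `-div(A ∇u) = f`, for `f ∈ H^{-1}(Ω)`, the dual of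
`H¹₀(Ω)`. -/
def IsWeakSol {d : ℕ} {Ω : Set (Eucl d)} (A : Eucl d → Matrix (Fin d) (Fin d) ℝ)
    (f : StrongDual ℝ (H10 Ω)) (u : H10 Ω) : Prop :=
  ∀ v : H10 Ω, ∫ x in Ω, inner ℝ (matVec (A x) (H10.grad u x)) (H10.grad v x) = f v

/-- `H`-convergence of a sequence `A_k ∈ 𝓜(α, β; Ω)` to `Abar`: the limit belongs to
`𝓜(α', β'; Ω)` for some `0 < α' ≤ β'`, and for every `f ∈ H^{-1}(Ω)` the (unique) solutions
`u_k ∈ H¹₀(Ω)` of `-div(A_k ∇u_k) = f` and `ubar ∈ H¹₀(Ω)` of `-div(Abar ∇ubar) = f` satisfy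
`u_k ⇀ ubar` weakly in `H¹₀(Ω)` and `A_k ∇u_k ⇀ Abar ∇ubar` weakly in `L²(Ω; ℝ^d)`. -/
def HConverges {d : ℕ} (α β : ℝ) (Ω : Set (Eucl d))
    (A : ℕ → Eucl d → Matrix (Fin d) (Fin d) ℝ)
    (Abar : Eucl d → Matrix (Fin d) (Fin d) ℝ) : Prop :=
  (∀ k, InM α β Ω (A k)) ∧
  (∃ α' β' : ℝ, 0 < α' ∧ α' ≤ β' ∧ InM α' β' Ω Abar) ∧
  ∀ f : StrongDual ℝ (H10 Ω), ∃ (u : ℕ → H10 Ω) (ubar : H10 Ω),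
    (∀ k v, IsWeakSol (A k) f v ↔ v = u k) ∧
    (∀ v, IsWeakSol Abar f v ↔ v = ubar) ∧
    (∀ l : StrongDual ℝ (H10 Ω), Tendsto (fun k => l (u k)) atTop (𝓝 (l ubar))) ∧
    (∀ g : Lp (Eucl d) 2 (volume.restrict Ω),
      Tendsto (fun k => ∫ x in Ω, inner ℝ (matVec (A k x) (H10.grad (u k) x)) (g x)) atTop
        (𝓝 (∫ x in Ω, inner ℝ (matVec (Abar x) (H10.grad ubar x)) (g x))))

end

section WeakConvergence

variable {X Y : Type*} [NormedAddCommGroup X] [InnerProductSpace ℝ X]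
  [NormedAddCommGroup Y] [InnerProductSpace ℝ Y]

/-- Bounded weak convergence of a sequence in a Hilbert space, along a filter. -/
structure WeakLim (l : Filter ℕ) (u : ℕ → X) (v : X) : Prop where
  bdd : ∃ C, ∀ k, ‖u k‖ ≤ C
  lim : ∀ w, Tendsto (fun k => inner ℝ (u k) w) l (𝓝 (inner ℝ v w))

theorem WeakLim.bound {l : Filter ℕ} {u : ℕ → X} {v : X} (h : WeakLim l u v) :
    ∃ C, 0 < C ∧ ∀ k, ‖u k‖ ≤ C := by
  obtain ⟨C, hC⟩ := h.bdd
  exact ⟨max C 1, by positivity, fun k => (hC k).trans (le_max_left _ _)⟩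

theorem WeakLim.unique {l : Filter ℕ} [l.NeBot] {u : ℕ → X} {v w : X} (h : WeakLim l u v)
    (h' : WeakLim l u w) : v = w :=
  ext_inner_right ℝ fun z => tendsto_nhds_unique (h.lim z) (h'.lim z)

theorem WeakLim.const (l : Filter ℕ) (v : X) : WeakLim l (fun _ => v) v :=
  ⟨⟨‖v‖, fun _ => le_rfl⟩, fun _ => tendsto_const_nhds⟩

theorem WeakLim.add {l : Filter ℕ} {u u' : ℕ → X} {v v' : X} (h : WeakLim l u v)
    (h' : WeakLim l u' v') : WeakLim l (fun k => u k + u' k) (v + v') := by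
  obtain ⟨C, hC⟩ := h.bdd
  obtain ⟨C', hC'⟩ := h'.bdd
  refine ⟨⟨C + C', fun k => (norm_add_le _ _).trans (add_le_add (hC k) (hC' k))⟩, fun w => ?_⟩
  simpa only [inner_add_left] using (h.lim w).add (h'.lim w)

theorem WeakLim.smul {l : Filter ℕ} {u : ℕ → X} {v : X} (h : WeakLim l u v) (c : ℝ) :
    WeakLim l (fun k => c • u k) (c • v) := by
  obtain ⟨C, hC⟩ := h.bdd
  refine ⟨⟨‖c‖ * C, fun k => ?_⟩, fun w => ?_⟩
  · rw [norm_smul]; gcongr; exact hC k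
  · simpa only [inner_smul_left] using (h.lim w).const_mul _

theorem WeakLim.sub {l : Filter ℕ} {u u' : ℕ → X} {v v' : X} (h : WeakLim l u v)
    (h' : WeakLim l u' v') : WeakLim l (fun k => u k - u' k) (v - v') := by
  simpa [sub_eq_add_neg] using h.add (h'.smul (-1))

/-- The scalar product of a weakly and a strongly convergent sequence converges. -/
theorem WeakLim.inner_tendsto {l : Filter ℕ} {u w : ℕ → X} {v z : X} (h : WeakLim l u v)
    (hw : Tendsto w l (𝓝 z)) : Tendsto (fun k => inner ℝ (u k) (w k)) l (𝓝 (inner ℝ v z)) := by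
  obtain ⟨C, hC0, hC⟩ := h.bound
  have h1 : Tendsto (fun k => inner ℝ (u k) (w k - z)) l (𝓝 0) := by
    have h2 : Tendsto (fun k => C * ‖w k - z‖) l (𝓝 0) := by
      have := (tendsto_iff_norm_sub_tendsto_zero.1 hw).const_mul C
      simpa using this
    refine squeeze_zero_norm (fun k => ?_) h2
    exact (norm_inner_le_norm _ _).trans (by gcongr; exact hC k)
  have := h1.add (h.lim z)
  simpa [inner_sub_right] using this

theorem WeakLim.map [CompleteSpace X] [CompleteSpace Y] {l : Filter ℕ} {u : ℕ → X} {v : X}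
    (h : WeakLim l u v) (T : X →L[ℝ] Y) : WeakLim l (fun k => T (u k)) (T v) := by
  obtain ⟨C, hC0, hC⟩ := h.bound
  refine ⟨⟨‖T‖ * C, fun k => (T.le_opNorm _).trans (by gcongr; exact hC k)⟩, fun w => ?_⟩
  simpa only [← ContinuousLinearMap.adjoint_inner_right] using h.lim (T.adjoint w)

/-- Weak compactness of balls of a Hilbert space, along an ultrafilter. -/
theorem exists_weakLim [CompleteSpace X] (l : Ultrafilter ℕ) (u : ℕ → X)
    (hb : ∃ C, ∀ k, ‖u k‖ ≤ C) : ∃ v, WeakLim l u v := by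
  obtain ⟨C, hC⟩ := hb
  have hlim : ∀ w : X, ∃ c ∈ Metric.closedBall (0 : ℝ) (C * ‖w‖),
      Tendsto (fun k => inner ℝ (u k) w) l (𝓝 c) := by
    intro w
    have := (isCompact_closedBall (0 : ℝ) (C * ‖w‖)).ultrafilter_le_nhds
      (l.map fun k => inner ℝ (u k) w) (by
        rw [Ultrafilter.coe_map, le_principal_iff, mem_map]
        refine Eventually.of_forall fun k => ?_
        have : ‖inner ℝ (u k) w‖ ≤ C * ‖w‖ :=
          (norm_inner_le_norm _ _).trans (by gcongr; exact hC k)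
        simpa using this)
    simpa [Tendsto] using this
  choose f hf hfl using hlim
  let F : X →ₗ[ℝ] ℝ :=
    { toFun := f
      map_add' := fun w z => tendsto_nhds_unique (hfl (w + z))
        (by simpa only [inner_add_right] using (hfl w).add (hfl z))
      map_smul' := fun c w => tendsto_nhds_unique (hfl (c • w))
        (by simpa only [inner_smul_right, RingHom.id_apply, smul_eq_mul] using
          (hfl w).const_mul c) }
  let F' : StrongDual ℝ X := F.mkContinuous C fun w => by
    simpa [F] using hf w
  refine ⟨(InnerProductSpace.toDual ℝ X).symm F', ⟨C, hC⟩, fun w => ?_⟩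
  rw [InnerProductSpace.toDual_symm_apply]
  exact hfl w

/-- Lower semicontinuity of nonnegative quadratic forms under weak convergence. -/
theorem WeakLim.le_of_tendsto [CompleteSpace X] {l : Filter ℕ} [l.NeBot] {u : ℕ → X} {v : X}
    (h : WeakLim l u v) (T : X →L[ℝ] X) (hs : ∀ x y, inner ℝ (T x) y = inner ℝ (T y) x)
    (hT : ∀ x, 0 ≤ inner ℝ (T x) x)
    {q : ℕ → ℝ} {c : ℝ} (hq : Tendsto q l (𝓝 c)) (hle : ∀ k, inner ℝ (T (u k)) (u k) ≤ q k) :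
    inner ℝ (T v) v ≤ c := by
  have h1 : Tendsto (fun k => 2 * inner ℝ (u k) (T v) - inner ℝ (T v) v) l
      (𝓝 (2 * inner ℝ v (T v) - inner ℝ (T v) v)) :=
    ((h.lim (T v)).const_mul 2).sub tendsto_const_nhds
  have h2 : inner ℝ (T v) v = 2 * inner ℝ v (T v) - inner ℝ (T v) v := by
    rw [real_inner_comm]; ring
  rw [h2]
  refine le_of_tendsto_of_tendsto' h1 hq fun k => le_trans ?_ (hle k)
  have := hT (u k - v)
  rw [map_sub, inner_sub_left, inner_sub_right, inner_sub_right, hs (u k) v,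
    real_inner_comm (u k) (T v)] at this
  linarith

/-- A weak null sequence converges to zero uniformly on compact sets of test vectors. -/
theorem WeakLim.eventually_forall_compact {l : Filter ℕ} {u : ℕ → X} (h : WeakLim l u 0)
    {K : Set X} (hK : IsCompact K) {r : ℝ} (hr : 0 < r) :
    ∀ᶠ k in l, ∀ w ∈ K, |inner ℝ (u k) w| ≤ r := by
  obtain ⟨C, hC0, hC⟩ := h.bound
  obtain ⟨t, -, htf, ht⟩ := hK.finite_cover_balls (e := r / (2 * C)) (by positivity)
  have h1 : ∀ᶠ k in l, ∀ z ∈ t, |inner ℝ (u k) z| ≤ r / 2 := by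
    rw [eventually_all_finite htf]
    intro z _
    have := (h.lim z).abs
    simp only [inner_zero_left, abs_zero] at this
    exact (this.eventually_lt_const (half_pos hr)).mono fun k hk => hk.le
  filter_upwards [h1] with k hk w hw
  obtain ⟨z, hz, hwz⟩ := Set.mem_iUnion₂.1 (ht hw)
  have h2 : |inner ℝ (u k) (w - z)| ≤ C * (r / (2 * C)) := by
    refine (abs_real_inner_le_norm _ _).trans ?_
    gcongr
    · exact hC k
    · rw [← dist_eq_norm]; exact (Metric.mem_ball.1 hwz).le
  have h3 : C * (r / (2 * C)) = r / 2 := by field_simp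
  have h4 : inner ℝ (u k) w = inner ℝ (u k) (w - z) + inner ℝ (u k) z := by
    rw [← inner_add_right, sub_add_cancel]
  rw [h4]
  exact (abs_add_le _ _).trans (by linarith [hk z hz])

end WeakConvergence

section LaxMilgram

variable {X : Type*} [NormedAddCommGroup X] [InnerProductSpace ℝ X] [CompleteSpace X]

/-- A coercive operator is onto. -/
theorem surjective_of_coercive (T : X →L[ℝ] X) {c : ℝ} (hc : 0 < c)
    (h : ∀ x, c * ‖x‖ ^ 2 ≤ inner ℝ (T x) x) : Function.Bijective T := by
  have hB : IsCoercive ((innerSL ℝ : X →L[ℝ] X →L[ℝ] ℝ).comp T) :=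
    ⟨c, hc, fun u => by simpa [pow_two, mul_assoc] using h u⟩
  have : ∀ u, hB.continuousLinearEquivOfBilin u = T u := fun u =>
    (hB.unique_continuousLinearEquivOfBilin (fun w => by simp)).symm
  have h2 := hB.continuousLinearEquivOfBilin.bijective
  have h3 : (hB.continuousLinearEquivOfBilin : X → X) = T := funext this
  rwa [h3] at h2

theorem norm_le_of_coercive {X : Type*} [NormedAddCommGroup X] [InnerProductSpace ℝ X]
    (T : X →L[ℝ] X) {c : ℝ} (hc : 0 < c)
    (h : ∀ x, c * ‖x‖ ^ 2 ≤ inner ℝ (T x) x) (x : X) : ‖x‖ ≤ c⁻¹ * ‖T x‖ := by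
  rw [← div_eq_inv_mul, le_div_iff₀ hc]
  rcases (norm_nonneg x).eq_or_lt with h0 | h0
  · rw [← h0]; simp
  · have h1 := (h x).trans (real_inner_le_norm _ _)
    nlinarith

/-- Every uniformly coercive bounded sequence of operators `T_k` allows, for every `v`, to choose
`f` such that the solutions `u_k` of `T_k u_k = f` converge weakly to `v`. -/
theorem exists_weakLim_of_coercive (l : Ultrafilter ℕ) (T : ℕ → X →L[ℝ] X) {c C : ℝ} (hc : 0 < c)
    (hC : 0 < C) (h : ∀ k x, c * ‖x‖ ^ 2 ≤ inner ℝ (T k x) x) (hb : ∀ k x, ‖T k x‖ ≤ C * ‖x‖)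
    (v : X) : ∃ (f : X) (u : ℕ → X), (∀ k, T k (u k) = f) ∧ WeakLim l u v := by
  choose R hR using fun k f => (surjective_of_coercive (T k) hc (h k)).2 f
  have hRb : ∀ f k, ‖R k f‖ ≤ c⁻¹ * ‖f‖ := fun f k => by
    simpa [hR] using norm_le_of_coercive (T k) hc (h k) (R k f)
  choose S hS using fun f => exists_weakLim l (fun k => R k f) ⟨_, hRb f⟩
  have hinj : ∀ k, Function.Injective (T k) := fun k => (surjective_of_coercive (T k) hc (h k)).1
  have hadd : ∀ k f g, R k (f + g) = R k f + R k g := fun k f g =>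
    hinj k (by simp [hR])
  have hsmul : ∀ k (r : ℝ) f, R k (r • f) = r • R k f := fun k r f =>
    hinj k (by simp [hR])
  let SL : X →ₗ[ℝ] X :=
    { toFun := S
      map_add' := fun f g => (hS (f + g)).unique (by simpa only [hadd] using (hS f).add (hS g))
      map_smul' := fun r f => (hS (r • f)).unique (by
        simpa only [hsmul, RingHom.id_apply] using (hS f).smul r) }
  have hSb : ∀ f, ‖SL f‖ ≤ c⁻¹ * ‖f‖ := by
    intro f
    change ‖S f‖ ≤ _
    have h1 : inner ℝ (S f) (S f) ≤ c⁻¹ * ‖f‖ * ‖S f‖ :=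
      le_of_tendsto' ((hS f).lim (S f)) fun k => (real_inner_le_norm _ _).trans
        (by gcongr; exact hRb f k)
    rw [real_inner_self_eq_norm_sq] at h1
    rcases (norm_nonneg (S f)).eq_or_lt with h0 | h0
    · rw [← h0]; positivity
    · nlinarith
  let SC : X →L[ℝ] X := SL.mkContinuous _ hSb
  have hcoer : ∀ f, (c / C ^ 2) * ‖f‖ ^ 2 ≤ inner ℝ (SC f) f := by
    intro f
    refine ge_of_tendsto' ((hS f).lim f) fun k => ?_
    have h1 := h k (R k f)
    rw [hR, real_inner_comm] at h1
    refine le_trans ?_ h1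
    have h2 := hb k (R k f)
    rw [hR] at h2
    have h3 : ‖f‖ ^ 2 ≤ C ^ 2 * ‖R k f‖ ^ 2 := by
      rw [← mul_pow]; gcongr
    calc c / C ^ 2 * ‖f‖ ^ 2 ≤ c / C ^ 2 * (C ^ 2 * ‖R k f‖ ^ 2) := by gcongr
      _ = c * ‖R k f‖ ^ 2 := by field_simp
  obtain ⟨f, hf⟩ := (surjective_of_coercive SC (by positivity) hcoer).2 v
  exact ⟨f, fun k => R k f, fun k => hR k f, hf ▸ hS f⟩

end LaxMilgram

/-- `L²(ℝ^d; F)`. -/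
abbrev L2Rd (d : ℕ) (F : Type*) [NormedAddCommGroup F] : Type _ :=
  Lp F 2 (volume : Measure (Eucl d))

/-- A bounded strongly measurable field of continuous linear maps on `ℝ^d`. -/
structure BField (d : ℕ) (F F' : Type*) [NormedAddCommGroup F] [NormedSpace ℝ F]
    [NormedAddCommGroup F'] [NormedSpace ℝ F'] where
  toFun : Eucl d → F →L[ℝ] F'
  sm : StronglyMeasurable toFun
  bdd : ∃ C, ∀ x, ‖toFun x‖ ≤ C

namespace BField

variable {d : ℕ} {F F' F'' : Type*} [NormedAddCommGroup F] [NormedSpace ℝ F]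
  [NormedAddCommGroup F'] [NormedSpace ℝ F'] [NormedAddCommGroup F''] [NormedSpace ℝ F'']

instance : CoeFun (BField d F F') (fun _ => Eucl d → F →L[ℝ] F') := ⟨BField.toFun⟩

theorem exists_bound (c : BField d F F') : ∃ C, 0 < C ∧ ∀ x, ‖c x‖ ≤ C := by
  obtain ⟨C, hC⟩ := c.bdd
  exact ⟨max C 1, by positivity, fun x => (hC x).trans (le_max_left _ _)⟩

theorem aesm_apply (c : BField d F F') {μ : Measure (Eucl d)} {g : Eucl d → F}
    (hg : AEStronglyMeasurable g μ) : AEStronglyMeasurable (fun x => c x (g x)) μ :=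
  (ContinuousLinearMap.id ℝ (F →L[ℝ] F')).aestronglyMeasurable_comp₂
    c.sm.aestronglyMeasurable hg

theorem memLp (c : BField d F F') {μ : Measure (Eucl d)} (g : Lp F 2 μ) :
    MemLp (fun x => c x (g x)) 2 μ := by
  obtain ⟨C, hC⟩ := c.bdd
  refine MemLp.of_le_mul (c := C) (Lp.memLp g) (c.aesm_apply (Lp.aestronglyMeasurable g))
    (Eventually.of_forall fun x => ?_)
  exact ((c x).le_opNorm _).trans (by gcongr; exact hC x)

/-- The multiplication operator `g ↦ c g` on `L²`. -/
noncomputable def op (c : BField d F F') : L2Rd d F →L[ℝ] L2Rd d F' :=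
  LinearMap.mkContinuousOfExistsBound
    { toFun := fun g => (c.memLp g).toLp _
      map_add' := fun g h => by
        apply Lp.ext
        filter_upwards [(c.memLp (g + h)).coeFn_toLp, (c.memLp g).coeFn_toLp,
          (c.memLp h).coeFn_toLp, Lp.coeFn_add g h,
          Lp.coeFn_add ((c.memLp g).toLp _) ((c.memLp h).toLp _)] with x h1 h2 h3 h4 h5
        rw [h1, h5, Pi.add_apply, h2, h3, h4, Pi.add_apply, map_add]
      map_smul' := fun r g => by
        apply Lp.ext
        filter_upwards [(c.memLp (r • g)).coeFn_toLp, (c.memLp g).coeFn_toLp,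
          Lp.coeFn_smul r g, Lp.coeFn_smul r ((c.memLp g).toLp _)] with x h1 h2 h3 h4
        rw [h1, RingHom.id_apply, h4, Pi.smul_apply, h2, h3, Pi.smul_apply, map_smul] }
    (by
      obtain ⟨C, hC0, hC⟩ := c.exists_bound
      refine ⟨C, fun g => ?_⟩
      refine Lp.norm_le_mul_norm_of_ae_le_mul ?_
      filter_upwards [(c.memLp g).coeFn_toLp] with x hx
      change ‖(c.memLp g).toLp _ x‖ ≤ _
      rw [hx]
      exact ((c x).le_opNorm _).trans (by gcongr; exact hC x))

theorem coeFn_op (c : BField d F F') (g : L2Rd d F) :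
    c.op g =ᵐ[volume] fun x => c x (g x) := (c.memLp g).coeFn_toLp

theorem norm_op_le (c : BField d F F') {C : ℝ} (hC : ∀ x, ‖c x‖ ≤ C) (g : L2Rd d F) :
    ‖c.op g‖ ≤ C * ‖g‖ := by
  refine Lp.norm_le_mul_norm_of_ae_le_mul ?_
  filter_upwards [c.coeFn_op g] with x hx
  rw [hx]
  exact ((c x).le_opNorm _).trans (by gcongr; exact hC x)

/-- Composition with a fixed map of `ℝ^d`. -/
def precomp (c : BField d F F') (f : Eucl d → Eucl d) (hf : Measurable f) : BField d F F' where
  toFun x := c (f x)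
  sm := c.sm.comp_measurable hf
  bdd := c.bdd.imp fun _ hC x => hC (f x)

instance : Sub (BField d F F') where
  sub c c' :=
    { toFun := fun x => c x - c' x
      sm := c.sm.sub c'.sm
      bdd := by
        obtain ⟨C, hC⟩ := c.bdd
        obtain ⟨C', hC'⟩ := c'.bdd
        exact ⟨C + C', fun x => (norm_sub_le _ _).trans (add_le_add (hC x) (hC' x))⟩ }

theorem sub_apply (c c' : BField d F F') (x : Eucl d) : (c - c') x = c x - c' x := rfl

theorem sub_op (c c' : BField d F F') (g : L2Rd d F) : (c - c').op g = c.op g - c'.op g := by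
  apply Lp.ext
  filter_upwards [(c - c').coeFn_op g, c.coeFn_op g, c'.coeFn_op g,
    Lp.coeFn_sub (c.op g) (c'.op g)] with x h1 h2 h3 h4
  rw [h1, h4, Pi.sub_apply, h2, h3, sub_apply, _root_.sub_apply]

end BField

namespace BField

variable {d : ℕ} {F F' : Type*} [NormedAddCommGroup F] [InnerProductSpace ℝ F]
  [NormedAddCommGroup F'] [InnerProductSpace ℝ F']

theorem inner_op (c : BField d F F') (g : L2Rd d F) (h : L2Rd d F') :
    inner ℝ (c.op g) h = ∫ x, inner ℝ (c x (g x)) (h x) := by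
  rw [L2.inner_def]
  refine integral_congr_ae ?_
  filter_upwards [c.coeFn_op g] with x hx
  rw [hx]

variable [CompleteSpace F] [CompleteSpace F']

/-- The pointwise adjoint of a field. -/
noncomputable def adj (c : BField d F F') : BField d F' F where
  toFun x := (c x).adjoint
  sm := (LinearIsometryEquiv.continuous _).comp_stronglyMeasurable c.sm
  bdd := c.bdd.imp fun _ hC x => by simpa using hC x

theorem adj_apply (c : BField d F F') (x : Eucl d) : c.adj x = (c x).adjoint := rfl

end BField

section Scalar

variable {d : ℕ} {F : Type*} [NormedAddCommGroup F] [InnerProductSpace ℝ F]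

/-- Multiplication by a bounded scalar function. -/
noncomputable def scalarField (F : Type*) [NormedAddCommGroup F] [InnerProductSpace ℝ F]
    (φ : Eucl d → ℝ) (hφ : Continuous φ) (hb : ∃ C, ∀ x, ‖φ x‖ ≤ C) : BField d F F where
  toFun x := φ x • ContinuousLinearMap.id ℝ F
  sm := (hφ.smul continuous_const).stronglyMeasurable
  bdd := hb.imp fun C hC x => by
    refine ContinuousLinearMap.opNorm_le_bound _ ((norm_nonneg _).trans (hC x)) fun v => ?_
    rw [_root_.smul_apply, norm_smul, ContinuousLinearMap.id_apply]
    exact mul_le_mul_of_nonneg_right (hC x) (norm_nonneg _)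

/-- The map `u ↦ u g` for a bounded vector field `g`. -/
noncomputable def vectorField (g : Eucl d → F) (hg : Continuous g) (hb : ∃ C, ∀ x, ‖g x‖ ≤ C) :
    BField d ℝ F where
  toFun x := ContinuousLinearMap.toSpanSingleton ℝ (g x)
  sm := ((ContinuousLinearMap.toSpanSingletonCLE (𝕜 := ℝ) (E := F)).continuous.comp
    hg).stronglyMeasurable
  bdd := hb.imp fun C hC x => by simpa using hC x

end Scalar

section Shift

variable {d : ℕ} {F : Type*} [NormedAddCommGroup F] [InnerProductSpace ℝ F]

/-- Translation `g ↦ g(· + h)` on `L²`. -/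
noncomputable def shift (F : Type*) [NormedAddCommGroup F] [InnerProductSpace ℝ F]
    (h : Eucl d) : L2Rd d F →ₗᵢ[ℝ] L2Rd d F :=
  Lp.compMeasurePreservingₗᵢ ℝ (fun x => x + h) (measurePreserving_add_right volume h)

theorem coeFn_shift (h : Eucl d) (g : L2Rd d F) : shift F h g =ᵐ[volume] fun x => g (x + h) :=
  Lp.coeFn_compMeasurePreserving g (measurePreserving_add_right volume h)

theorem inner_shift (h : Eucl d) (g g' : L2Rd d F) :
    inner ℝ (shift F h g) g' = inner ℝ g (shift F (-h) g') := by
  rw [L2.inner_def, L2.inner_def, ← integral_add_right_eq_self (fun x => inner ℝ (g x) _) h]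
  refine integral_congr_ae ?_
  have h2 : ∀ᵐ x, shift F (-h) g' (x + h) = g' (x + h + -h) :=
    (measurePreserving_add_right volume h).quasiMeasurePreserving.ae (coeFn_shift (-h) g')
  filter_upwards [coeFn_shift h g, h2] with x h1 h2
  rw [h1, h2, add_neg_cancel_right]

theorem tendsto_shift {l : Filter ℕ} {h : ℕ → Eucl d} {h' : Eucl d} (hh : Tendsto h l (𝓝 h'))
    {g : ℕ → L2Rd d F} {g' : L2Rd d F} (hg : Tendsto g l (𝓝 g')) :
    Tendsto (fun k => shift F (h k) (g k)) l (𝓝 (shift F h' g')) := by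
  have h1 : Continuous fun h : Eucl d => (⟨fun x => x + h, by fun_prop⟩ : C(Eucl d, Eucl d)) :=
    ContinuousMap.continuous_of_continuous_uncurry _ (by
      change Continuous fun p : Eucl d × Eucl d => p.2 + p.1
      fun_prop)
  exact Filter.Tendsto.compMeasurePreservingLp hg ((h1.tendsto h').comp hh)
    (fun k => measurePreserving_add_right volume (h k)) (measurePreserving_add_right volume h')
    (by simp)

theorem WeakLim.shift [CompleteSpace F] {l : Filter ℕ} {h : ℕ → Eucl d} {h' : Eucl d}
    (hh : Tendsto h l (𝓝 h'))
    {g : ℕ → L2Rd d F} {g' : L2Rd d F} (hg : WeakLim l g g') :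
    WeakLim l (fun k => shift F (h k) (g k)) (shift F h' g') := by
  refine ⟨hg.bdd.imp fun C hC k => by simpa using hC k, fun w => ?_⟩
  simpa only [inner_shift] using hg.inner_tendsto (tendsto_shift hh.neg tendsto_const_nhds)

theorem shift_op {F' : Type*} [NormedAddCommGroup F'] [InnerProductSpace ℝ F'] (h : Eucl d)
    (c : BField d F F') (g : L2Rd d F) :
    shift F' h (c.op g) = (c.precomp (· + h) (measurable_add_const h)).op (shift F h g) := by
  apply Lp.ext
  have h2 : ∀ᵐ x, c.op g (x + h) = c (x + h) (g (x + h)) :=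
    (measurePreserving_add_right volume h).quasiMeasurePreserving.ae (c.coeFn_op g)
  filter_upwards [coeFn_shift h g, h2, coeFn_shift h (c.op g),
    (c.precomp (· + h) (measurable_add_const h)).coeFn_op (shift F h g)] with x h1 h2 h3 h4
  rw [h3, h4, h2, h1]
  rfl

end Shift

section Extension

variable {d : ℕ} {F : Type*} [NormedAddCommGroup F] [InnerProductSpace ℝ F]

theorem memLp_indicator {F : Type*} [NormedAddCommGroup F] {Ω : Set (Eucl d)}
    (hΩ : MeasurableSet Ω) (g : Lp F 2 (volume.restrict Ω)) :
    MemLp (Ω.indicator g) 2 volume :=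
  (memLp_indicator_iff_restrict hΩ).2 (Lp.memLp g)

/-- Extension by zero from `L²(Ω)` to `L²(ℝ^d)`. -/
noncomputable def extend (F : Type*) [NormedAddCommGroup F] [InnerProductSpace ℝ F]
    {Ω : Set (Eucl d)} (hΩ : MeasurableSet Ω) :
    Lp F 2 (volume.restrict Ω) →ₗᵢ[ℝ] L2Rd d F where
  toFun g := (memLp_indicator hΩ g).toLp _
  map_add' g h := by
    apply Lp.ext
    have h4 := (ae_restrict_iff' hΩ).1 (Lp.coeFn_add g h)
    filter_upwards [(memLp_indicator hΩ (g + h)).coeFn_toLp, (memLp_indicator hΩ g).coeFn_toLp,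
      (memLp_indicator hΩ h).coeFn_toLp, h4,
      Lp.coeFn_add ((memLp_indicator hΩ g).toLp _) ((memLp_indicator hΩ h).toLp _)]
      with x h1 h2 h3 h4 h5
    rw [h1, h5, Pi.add_apply, h2, h3]
    by_cases hx : x ∈ Ω
    · rw [Set.indicator_of_mem hx, Set.indicator_of_mem hx, Set.indicator_of_mem hx, h4 hx,
        Pi.add_apply]
    · simp [hx]
  map_smul' r g := by
    apply Lp.ext
    have h4 := (ae_restrict_iff' hΩ).1 (Lp.coeFn_smul r g)
    filter_upwards [(memLp_indicator hΩ (r • g)).coeFn_toLp, (memLp_indicator hΩ g).coeFn_toLp,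
      h4, Lp.coeFn_smul r ((memLp_indicator hΩ g).toLp _)] with x h1 h2 h4 h5
    rw [h1, RingHom.id_apply, h5, Pi.smul_apply, h2]
    by_cases hx : x ∈ Ω
    · simp [hx, h4 hx]
    · simp [hx]
  norm_map' g := by
    change ‖(memLp_indicator hΩ g).toLp _‖ = _
    rw [Lp.norm_toLp, eLpNorm_indicator_eq_eLpNorm_restrict hΩ, Lp.norm_def]

theorem coeFn_extend {Ω : Set (Eucl d)} (hΩ : MeasurableSet Ω) (g : Lp F 2 (volume.restrict Ω)) :
    extend F hΩ g =ᵐ[volume] Ω.indicator g := (memLp_indicator hΩ g).coeFn_toLp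

theorem coeFn_extend_restrict {Ω : Set (Eucl d)} (hΩ : MeasurableSet Ω)
    (g : Lp F 2 (volume.restrict Ω)) : extend F hΩ g =ᵐ[volume.restrict Ω] g := by
  filter_upwards [ae_restrict_of_ae (coeFn_extend hΩ g), ae_restrict_mem hΩ] with x hx hΩx
  rw [hx, Set.indicator_of_mem hΩx]

end Extension

/-- `φ ∈ C_c^∞(Ω)`. -/
structure IsTest {d : ℕ} (Ω : Set (Eucl d)) (φ : Eucl d → ℝ) : Prop where
  contDiff : ContDiff ℝ ∞ φ
  compact : HasCompactSupport φ
  subset : tsupport φ ⊆ Ω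

namespace IsTest

variable {d : ℕ} {Ω : Set (Eucl d)} {φ ψ : Eucl d → ℝ}

theorem mono {Ω' : Set (Eucl d)} (h : IsTest Ω φ) (hΩ : Ω ⊆ Ω') : IsTest Ω' φ :=
  ⟨h.contDiff, h.compact, h.subset.trans hΩ⟩

theorem univ (h : IsTest Ω φ) : IsTest Set.univ φ := h.mono (Set.subset_univ _)

theorem continuous (h : IsTest Ω φ) : Continuous φ := h.contDiff.continuous

theorem hasGradientAt (h : IsTest Ω φ) (x : Eucl d) : HasGradientAt φ (gradient φ x) x :=
  (h.contDiff.differentiable (by simp) x).hasGradientAt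

theorem continuous_gradient (h : IsTest Ω φ) : Continuous (gradient φ) :=
  (LinearIsometryEquiv.continuous _).comp (h.contDiff.continuous_fderiv (by simp))

theorem compact_gradient (h : IsTest Ω φ) : HasCompactSupport (gradient φ) :=
  (h.compact.fderiv ℝ).comp_left (g := (InnerProductSpace.toDual ℝ (Eucl d)).symm) (map_zero _)

theorem bdd (h : IsTest Ω φ) : ∃ C, ∀ x, ‖φ x‖ ≤ C :=
  h.compact.exists_bound_of_continuous h.continuous

theorem bdd_gradient (h : IsTest Ω φ) : ∃ C, ∀ x, ‖gradient φ x‖ ≤ C :=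
  h.compact_gradient.exists_bound_of_continuous h.continuous_gradient

theorem memLp (h : IsTest Ω φ) : MemLp φ 2 volume :=
  h.continuous.memLp_of_hasCompactSupport h.compact

theorem memLp_gradient (h : IsTest Ω φ) : MemLp (gradient φ) 2 volume :=
  h.continuous_gradient.memLp_of_hasCompactSupport h.compact_gradient

theorem zero : IsTest Ω (fun _ => 0) :=
  ⟨contDiff_const, HasCompactSupport.zero, by simp [tsupport, Function.support]⟩

theorem add (h : IsTest Ω φ) (h' : IsTest Ω ψ) : IsTest Ω (fun x => φ x + ψ x) :=
  ⟨h.contDiff.add h'.contDiff, h.compact.add h'.compact,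
    (tsupport_add φ ψ).trans (Set.union_subset h.subset h'.subset)⟩

theorem gradient_add (h : IsTest Ω φ) (h' : IsTest Ω ψ) (x : Eucl d) :
    gradient (fun x => φ x + ψ x) x = gradient φ x + gradient ψ x := by
  apply HasGradientAt.gradient
  rw [hasGradientAt_iff_hasFDerivAt, map_add]
  exact (h.hasGradientAt x).hasFDerivAt.add (h'.hasGradientAt x).hasFDerivAt

theorem mul (h : IsTest Ω φ) (h' : ContDiff ℝ ∞ ψ) : IsTest Ω (fun x => φ x * ψ x) :=
  ⟨h.contDiff.mul h', h.compact.mul_right,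
    (closure_mono (Function.support_mul_subset_left φ ψ)).trans h.subset⟩

theorem gradient_mul {φ ψ : Eucl d → ℝ} {x g g' : Eucl d} (h : HasGradientAt φ g x)
    (h' : HasGradientAt ψ g' x) :
    gradient (fun x => φ x * ψ x) x = φ x • g' + ψ x • g := by
  apply HasGradientAt.gradient
  rw [hasGradientAt_iff_hasFDerivAt, map_add, map_smul, map_smul]
  exact h.hasFDerivAt.mul h'.hasFDerivAt

theorem const_mul (h : IsTest Ω φ) (c : ℝ) : IsTest Ω (fun x => c * φ x) := by
  simpa only [mul_comm] using h.mul (ψ := fun _ => c) contDiff_const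

theorem gradient_const_mul (h : IsTest Ω φ) (c : ℝ) (x : Eucl d) :
    gradient (fun x => c * φ x) x = c • gradient φ x := by
  rw [gradient_mul (hasGradientAt_const x c) (h.hasGradientAt x)]; simp

theorem shift (h : IsTest Ω φ) (a : Eucl d) : IsTest Set.univ (fun x => φ (x + a)) :=
  ⟨h.contDiff.comp (contDiff_id.add contDiff_const),
    h.compact.comp_homeomorph (Homeomorph.addRight a), Set.subset_univ _⟩

theorem gradient_shift (h : IsTest Ω φ) (a x : Eucl d) :
    gradient (fun x => φ (x + a)) x = gradient φ (x + a) := by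
  apply HasGradientAt.gradient
  have := ((h.hasGradientAt (x + a)).hasFDerivAt).comp x
    ((hasFDerivAt_id x).add_const a)
  rw [hasGradientAt_iff_hasFDerivAt]
  exact this

end IsTest

/-- The space `L²(ℝ^d) × L²(ℝ^d; ℝ^d)`. -/
abbrev WPair (d : ℕ) : Type := WithLp 2 (L2Rd d ℝ × L2Rd d (Eucl d))

/-- The pairs `(φ, ∇φ)` with `φ ∈ C_c^∞(Ω)`. -/
def testSub {d : ℕ} (Ω : Set (Eucl d)) : Submodule ℝ (WPair d) where
  carrier := {p | ∃ φ, IsTest Ω φ ∧ p.fst =ᵐ[volume] φ ∧ p.snd =ᵐ[volume] gradient φ}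
  add_mem' := by
    rintro p q ⟨φ, h, h1, h2⟩ ⟨ψ, h', h1', h2'⟩
    refine ⟨_, h.add h', ?_, ?_⟩
    · filter_upwards [h1, h1', Lp.coeFn_add p.fst q.fst] with x a b c
      rw [WithLp.add_fst, c, Pi.add_apply, a, b]
    · filter_upwards [h2, h2', Lp.coeFn_add p.snd q.snd] with x a b c
      rw [WithLp.add_snd, c, Pi.add_apply, a, b, h.gradient_add h']
  zero_mem' := by
    refine ⟨_, IsTest.zero, ?_, ?_⟩
    · exact Lp.coeFn_zero ℝ 2 volume
    · filter_upwards [Lp.coeFn_zero (Eucl d) 2 (volume : Measure (Eucl d))] with x hx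
      rw [WithLp.zero_snd, hx, gradient_fun_const]
      rfl
  smul_mem' := by
    rintro c p ⟨φ, h, h1, h2⟩
    refine ⟨_, h.const_mul c, ?_, ?_⟩
    · filter_upwards [h1, Lp.coeFn_smul c p.fst] with x a b
      rw [WithLp.smul_fst, b, Pi.smul_apply, a, smul_eq_mul]
    · filter_upwards [h2, Lp.coeFn_smul c p.snd] with x a b
      rw [WithLp.smul_snd, b, Pi.smul_apply, a, h.gradient_const_mul]

/-- `H¹₀(Ω)`, extended by zero to `ℝ^d`. For `Ω = ℝ^d` this is `H¹(ℝ^d)`. -/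
noncomputable def sobZero {d : ℕ} (Ω : Set (Eucl d)) : Submodule ℝ (WPair d) :=
  (testSub Ω).topologicalClosure

theorem isClosed_sobZero {d : ℕ} (Ω : Set (Eucl d)) : IsClosed (sobZero Ω : Set (WPair d)) :=
  Submodule.isClosed_topologicalClosure _

instance {d : ℕ} (Ω : Set (Eucl d)) : CompleteSpace (sobZero Ω) :=
  (isClosed_sobZero Ω).completeSpace_coe

theorem sobZero_induction {d : ℕ} {Ω : Set (Eucl d)} {P : Set (WPair d)} (hP : IsClosed P)
    (h : ∀ p ∈ testSub Ω, p ∈ P) {p : WPair d} (hp : p ∈ sobZero Ω) : p ∈ P :=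
  closure_minimal (s := (testSub Ω : Set (WPair d))) h hP hp

theorem testSub_mono {d : ℕ} {Ω Ω' : Set (Eucl d)} (h : Ω ⊆ Ω') : testSub Ω ≤ testSub Ω' :=
  fun _ ⟨φ, hφ, h1, h2⟩ => ⟨φ, hφ.mono h, h1, h2⟩

theorem sobZero_mono {d : ℕ} {Ω Ω' : Set (Eucl d)} (h : Ω ⊆ Ω') : sobZero Ω ≤ sobZero Ω' :=
  Submodule.topologicalClosure_mono (testSub_mono h)

namespace IsTest

variable {d : ℕ} {Ω : Set (Eucl d)} {φ ψ : Eucl d → ℝ}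

/-- The pair `(φ, ∇φ)` of a test function. -/
noncomputable def pair (h : IsTest Ω φ) : WPair d :=
  WithLp.toLp 2 (h.memLp.toLp φ, h.memLp_gradient.toLp _)

theorem pair_mem (h : IsTest Ω φ) : h.pair ∈ sobZero Ω :=
  Submodule.le_topologicalClosure _ ⟨φ, h, h.memLp.coeFn_toLp, h.memLp_gradient.coeFn_toLp⟩

theorem pair_snd (h : IsTest Ω φ) : h.pair.snd =ᵐ[volume] gradient φ :=
  h.memLp_gradient.coeFn_toLp

/-- Multiplication by a test function, as a field. -/
noncomputable def field (F : Type*) [NormedAddCommGroup F] [InnerProductSpace ℝ F]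
    (h : IsTest Ω φ) : BField d F F := scalarField F φ h.continuous h.bdd

theorem field_apply {F : Type*} [NormedAddCommGroup F] [InnerProductSpace ℝ F]
    (h : IsTest Ω φ) (x : Eucl d) (v : F) : h.field F x v = φ x • v := rfl

/-- Multiplication by the gradient of a test function, as a field. -/
noncomputable def gradField (h : IsTest Ω φ) : BField d ℝ (Eucl d) :=
  vectorField (gradient φ) h.continuous_gradient h.bdd_gradient

theorem gradField_apply (h : IsTest Ω φ) (x : Eucl d) (v : ℝ) :
    h.gradField x v = v • gradient φ x := rfl

/-- Multiplication of `(u, ∇u)` by a test function: `(φ u, φ ∇u + u ∇φ)`. -/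
noncomputable def mulPair (h : IsTest Ω φ) : WPair d →L[ℝ] WPair d :=
  (WithLp.prodContinuousLinearEquiv 2 ℝ (L2Rd d ℝ) (L2Rd d (Eucl d))).symm.toContinuousLinearMap.comp
    (((h.field ℝ).op.comp (WithLp.fstL 2 ℝ _ _)).prod
      ((h.field (Eucl d)).op.comp (WithLp.sndL 2 ℝ _ _) +
        h.gradField.op.comp (WithLp.fstL 2 ℝ _ _)))

theorem mulPair_fst (h : IsTest Ω φ) (p : WPair d) :
    (h.mulPair p).fst = (h.field ℝ).op p.fst := rfl

theorem mulPair_snd (h : IsTest Ω φ) (p : WPair d) :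
    (h.mulPair p).snd = (h.field (Eucl d)).op p.snd + h.gradField.op p.fst := rfl

theorem mulPair_mem (h : IsTest Ω φ) {p : WPair d} (hp : p ∈ sobZero Set.univ) :
    h.mulPair p ∈ sobZero Ω := by
  refine sobZero_induction (P := h.mulPair ⁻¹' (sobZero Ω))
    ((isClosed_sobZero Ω).preimage h.mulPair.continuous) ?_ hp
  rintro p ⟨ψ, h', h1, h2⟩
  refine Submodule.le_topologicalClosure _ ⟨_, h.mul h'.contDiff, ?_, ?_⟩
  · filter_upwards [h1, (h.field ℝ).coeFn_op p.fst] with x a b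
    rw [mulPair_fst, b, a, field_apply, smul_eq_mul]
  · filter_upwards [h1, h2, (h.field (Eucl d)).coeFn_op p.snd, h.gradField.coeFn_op p.fst,
      Lp.coeFn_add ((h.field (Eucl d)).op p.snd) (h.gradField.op p.fst)] with x a b c e f
    rw [mulPair_snd, f, Pi.add_apply, c, e, a, b, field_apply, gradField_apply,
      gradient_mul (h.hasGradientAt x) (h'.hasGradientAt x)]

end IsTest

/-- Translation of pairs. -/
noncomputable def shiftPair {d : ℕ} (a : Eucl d) : WPair d →L[ℝ] WPair d :=
  (WithLp.prodContinuousLinearEquiv 2 ℝ (L2Rd d ℝ) (L2Rd d (Eucl d))).symm.toContinuousLinearMap.comp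
    (((shift ℝ a).toContinuousLinearMap.comp (WithLp.fstL 2 ℝ _ _)).prod
      ((shift (Eucl d) a).toContinuousLinearMap.comp (WithLp.sndL 2 ℝ _ _)))

theorem shiftPair_fst {d : ℕ} (a : Eucl d) (p : WPair d) :
    (shiftPair a p).fst = shift ℝ a p.fst := rfl

theorem shiftPair_snd {d : ℕ} (a : Eucl d) (p : WPair d) :
    (shiftPair a p).snd = shift (Eucl d) a p.snd := rfl

theorem shiftPair_mem {d : ℕ} (a : Eucl d) {p : WPair d} (hp : p ∈ sobZero Set.univ) :
    shiftPair a p ∈ sobZero Set.univ := by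
  have hc : IsClosed {p | shiftPair a p ∈ sobZero (Set.univ : Set (Eucl d))} :=
    (isClosed_sobZero Set.univ).preimage (shiftPair a).continuous
  refine sobZero_induction hc ?_ hp
  rintro p ⟨ψ, h', h1, h2⟩
  have hq := (measurePreserving_add_right (volume : Measure (Eucl d)) a).quasiMeasurePreserving
  refine Submodule.le_topologicalClosure _ ⟨_, h'.shift a, ?_, ?_⟩
  · filter_upwards [coeFn_shift a p.fst, hq.ae h1] with x h3 h4
    rw [shiftPair_fst, h3, h4]
  · filter_upwards [coeFn_shift a p.snd, hq.ae h2] with x h3 h4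
    rw [shiftPair_snd, h3, h4, h'.gradient_shift]

section Averages

variable {d : ℕ}

theorem eLpNorm_two_sq {T F : Type*} [MeasurableSpace T] [NormedAddCommGroup F] (f : T → F)
    (μ : Measure T) : eLpNorm f 2 μ ^ 2 = ∫⁻ x, ‖f x‖ₑ ^ 2 ∂μ := by
  have := eLpNorm_nnreal_pow_eq_lintegral (f := f) (μ := μ) (p := 2) (by norm_num)
  simpa using this

theorem sq_lintegral_enorm_le {T F : Type*} [MeasurableSpace T] [NormedAddCommGroup F] {f : T → F}
    {ν : Measure T} [IsProbabilityMeasure ν] (hf : AEStronglyMeasurable f ν) :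
    (∫⁻ t, ‖f t‖ₑ ∂ν) ^ 2 ≤ ∫⁻ t, ‖f t‖ₑ ^ 2 ∂ν := by
  rw [← eLpNorm_two_sq, ← eLpNorm_one_eq_lintegral_enorm]
  gcongr
  exact eLpNorm_le_eLpNorm_of_exponent_le (by norm_num) hf

/-- Minkowski's inequality for averages in `L²`. -/
theorem eLpNorm_integral_le {T : Type*} [MeasurableSpace T] {ν : Measure T}
    [IsProbabilityMeasure ν] {g : Eucl d → T → ℝ} (hg : Measurable (Function.uncurry g))
    {M : ENNReal} (h : ∀ᵐ t ∂ν, eLpNorm (fun x => g x t) 2 volume ≤ M) :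
    eLpNorm (fun x => ∫ t, g x t ∂ν) 2 volume ≤ M := by
  rw [← ENNReal.pow_le_pow_left_iff (two_ne_zero), eLpNorm_two_sq]
  calc ∫⁻ x, ‖∫ t, g x t ∂ν‖ₑ ^ 2 ≤ ∫⁻ x, ∫⁻ t, ‖g x t‖ₑ ^ 2 ∂ν := by
        refine lintegral_mono fun x => ?_
        refine le_trans ?_ (sq_lintegral_enorm_le
          (hg.comp measurable_prodMk_left).aestronglyMeasurable)
        gcongr
        exact enorm_integral_le_lintegral_enorm _
    _ = ∫⁻ t, ∫⁻ x, ‖g x t‖ₑ ^ 2 ∂volume ∂ν := by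
        refine lintegral_lintegral_swap ?_
        exact ((hg.enorm).pow_const 2).aemeasurable
    _ ≤ ∫⁻ t, M ^ 2 ∂ν := by
        refine lintegral_mono_ae ?_
        filter_upwards [h] with t ht
        rw [← eLpNorm_two_sq]
        gcongr
    _ = M ^ 2 := by simp

theorem IsTest.eLpNorm_shift_sub_le {Ω : Set (Eucl d)} {φ : Eucl d → ℝ} (hφ : IsTest Ω φ)
    (a : Eucl d) :
    eLpNorm (fun x => φ (x + a) - φ x) 2 volume ≤ ‖a‖ₑ * eLpNorm (gradient φ) 2 volume := by
  have h1 : ∀ x, φ (x + a) - φ x =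
      ∫ t in Set.Ioc (0 : ℝ) 1, inner ℝ (gradient φ (x + t • a)) a := by
    intro x
    have hd : ∀ t ∈ Set.uIcc (0 : ℝ) 1, HasDerivAt (fun t : ℝ => φ (x + t • a))
        (inner ℝ (gradient φ (x + t • a)) a) t := by
      intro t _
      have h2 : HasDerivAt (fun t : ℝ => x + t • a) a t := by
        simpa using ((hasDerivAt_id t).smul_const a).const_add x
      exact (hφ.hasGradientAt (x + t • a)).hasFDerivAt.comp_hasDerivAt t h2
    have hc : Continuous fun t : ℝ => inner ℝ (gradient φ (x + t • a)) a :=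
      (hφ.continuous_gradient.comp (by fun_prop)).inner continuous_const
    have := intervalIntegral.integral_eq_sub_of_hasDerivAt hd (hc.intervalIntegrable 0 1)
    rw [intervalIntegral.integral_of_le zero_le_one] at this
    simpa using this.symm
  simp_rw [h1]
  have : IsProbabilityMeasure (volume.restrict (Set.Ioc (0 : ℝ) 1)) := ⟨by simp⟩
  refine eLpNorm_integral_le ?_ (Eventually.of_forall fun t => ?_)
  · have : Continuous (fun q : Eucl d × ℝ => inner ℝ (gradient φ (q.1 + q.2 • a)) a) :=
      (hφ.continuous_gradient.comp (by fun_prop)).inner continuous_const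
    exact this.measurable
  · have hmp := measurePreserving_add_right (volume : Measure (Eucl d)) (t • a)
    have h3 := eLpNorm_comp_measurePreserving (p := 2)
      hφ.memLp_gradient.aestronglyMeasurable hmp
    rw [← h3]
    have h4 := eLpNorm_le_nnreal_smul_eLpNorm_of_ae_le_mul (μ := volume) (c := ‖a‖₊)
      (f := fun x => inner ℝ (gradient φ (x + t • a)) a)
      (g := gradient φ ∘ fun x => x + t • a) (Eventually.of_forall fun x => by
        rw [mul_comm]; exact nnnorm_inner_le_nnnorm _ _) 2
    simpa [ENNReal.smul_def, enorm_eq_nnnorm] using h4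

theorem norm_shift_sub_le (a : Eucl d) {p : WPair d} (hp : p ∈ sobZero Set.univ) :
    ‖shift ℝ a p.fst - p.fst‖ ≤ ‖a‖ * ‖p.snd‖ := by
  refine sobZero_induction (P := {p | ‖shift ℝ a p.fst - p.fst‖ ≤ ‖a‖ * ‖p.snd‖}) ?_ ?_ hp
  · have h1 : Continuous fun p : WPair d => p.fst := WithLp.continuous_fst _ _ _
    have h2 : Continuous fun p : WPair d => p.snd := WithLp.continuous_snd _ _ _
    exact isClosed_le ((((shift ℝ a).continuous.comp h1).sub h1).norm) (h2.norm.const_mul _)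
  · rintro p ⟨φ, hφ, h1, h2⟩
    have hq := (measurePreserving_add_right (volume : Measure (Eucl d)) a).quasiMeasurePreserving
    have h3 : (shift ℝ a p.fst - p.fst : L2Rd d ℝ) =ᵐ[volume] fun x => φ (x + a) - φ x := by
      filter_upwards [coeFn_shift a p.fst, hq.ae h1, h1,
        Lp.coeFn_sub (shift ℝ a p.fst) p.fst] with x a1 a2 a3 a4
      rw [a4, Pi.sub_apply, a1, a2, a3]
    have h4 := hφ.eLpNorm_shift_sub_le a
    rw [← eLpNorm_congr_ae h3, ← eLpNorm_congr_ae h2] at h4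
    rw [Set.mem_ofPred_eq, Lp.norm_def, Lp.norm_def]
    have h5 := ENNReal.toReal_mono (ENNReal.mul_ne_top enorm_ne_top (Lp.eLpNorm_ne_top _)) h4
    simpa [ENNReal.toReal_mul] using h5

end Averages

section Compactness

variable {d : ℕ}

/-- Poincaré's inequality on bounded sets. -/
theorem exists_poincare (hd : 1 ≤ d) {Ω : Set (Eucl d)} (hΩ : Bornology.IsBounded Ω) :
    ∃ C, 0 < C ∧ ∀ p ∈ sobZero Ω, ‖p.fst‖ ≤ C * ‖p.snd‖ := by
  obtain ⟨R, hR0, hR⟩ := hΩ.exists_pos_norm_le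
  let e : Eucl d := EuclideanSpace.single ⟨0, hd⟩ 1
  have he : ‖e‖ = 1 := by simp [e]
  let a : Eucl d := (3 * R) • e
  have ha : ‖a‖ = 3 * R := by rw [norm_smul, he]; simp [abs_of_pos hR0]
  refine ⟨3 * R, by positivity, fun p hp => ?_⟩
  have key := norm_shift_sub_le a (sobZero_mono (Set.subset_univ Ω) hp)
  rw [ha] at key
  refine le_trans ?_ key
  refine sobZero_induction (P := {p | ‖p.fst‖ ≤ ‖shift ℝ a p.fst - p.fst‖}) ?_ ?_ hp
  · have h1 : Continuous fun p : WPair d => p.fst := WithLp.continuous_fst _ _ _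
    exact isClosed_le h1.norm ((((shift ℝ a).continuous.comp h1).sub h1).norm)
  · rintro p ⟨φ, hφ, h1, -⟩
    have hq := (measurePreserving_add_right (volume : Measure (Eucl d)) a).quasiMeasurePreserving
    have h3 : inner ℝ (shift ℝ a p.fst) p.fst = 0 := by
      rw [L2.inner_def]
      refine integral_eq_zero_of_ae ?_
      filter_upwards [coeFn_shift a p.fst, hq.ae h1, h1] with x a1 a2 a3
      rw [a1, a2, a3]
      by_cases hx : x ∈ Ω
      · have hxa : x + a ∉ Ω := fun h => by
          have h4 := hR _ h
          have h5 := hR _ hx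
          have h6 : ‖a‖ ≤ ‖x + a‖ + ‖x‖ := by
            simpa using norm_sub_le (x + a) x
          linarith
        have : φ (x + a) = 0 := image_eq_zero_of_notMem_tsupport fun h => hxa (hφ.subset h)
        simp [this]
      · have : φ x = 0 := image_eq_zero_of_notMem_tsupport fun h => hx (hφ.subset h)
        simp [this]
    have h4 : ‖shift ℝ a p.fst - p.fst‖ ^ 2 = ‖p.fst‖ ^ 2 + ‖p.fst‖ ^ 2 := by
      rw [norm_sub_sq_real, h3, LinearIsometry.norm_map]; ring
    refine le_of_sq_le_sq ?_ (norm_nonneg _)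
    rw [h4]
    have := sq_nonneg ‖p.fst‖
    linarith

/-- The indicator of a ball, as an element of `L²`. -/
noncomputable def ballInd (d : ℕ) (r : ℝ) : L2Rd d ℝ :=
  indicatorConstLp 2 (measurableSet_ball (x := (0 : Eucl d)) (ε := r))
    (measure_ball_lt_top).ne (1 : ℝ)

theorem inner_shift_ballInd (r : ℝ) (x : Eucl d) (u : L2Rd d ℝ) {φ : Eucl d → ℝ}
    (hu : u =ᵐ[volume] φ) :
    inner ℝ u (shift ℝ (-x) (ballInd d r)) = ∫ h in Metric.ball (0 : Eucl d) r, φ (x + h) := by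
  rw [← inner_shift, ballInd, real_inner_comm, L2.inner_indicatorConstLp_one]
  refine integral_congr_ae (ae_restrict_of_ae ?_)
  have hq := (measurePreserving_add_right (volume : Measure (Eucl d)) x).quasiMeasurePreserving
  filter_upwards [coeFn_shift x u, hq.ae hu] with h h1 h2
  rw [h1, h2, add_comm]

/-- A local `L²` norm is controlled by a small multiple of the gradient and by finitely many (here:
a compact set of) linear functionals. -/
theorem norm_field_op_le {φ : Eucl d → ℝ} (hφ : IsTest Set.univ φ) {r : ℝ} (hr : 0 < r) :
    ∃ (K : Set (L2Rd d ℝ)) (C : ℝ), IsCompact K ∧ 0 < C ∧ ∀ p ∈ sobZero (Set.univ : Set (Eucl d)),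
      ∀ M : ℝ, 0 ≤ M → (∀ g ∈ K, |inner ℝ p.fst g| ≤ M) →
        ‖(hφ.field ℝ).op p.fst‖ ≤ r * ‖p.snd‖ + C * M := by
  obtain ⟨Cφ, hCφ0, hCφ⟩ : ∃ C, 0 < C ∧ ∀ x, ‖φ x‖ ≤ C := by
    obtain ⟨C, hC⟩ := hφ.bdd
    exact ⟨max C 1, by positivity, fun x => (hC x).trans (le_max_left _ _)⟩
  set s : ℝ := r / Cφ with hs
  have hs0 : 0 < s := by positivity
  set B : Set (Eucl d) := Metric.ball 0 s with hB
  have hBpos : 0 < volume.real B :=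
    ENNReal.toReal_pos (Metric.measure_ball_pos _ _ hs0).ne' measure_ball_lt_top.ne
  set m : ℝ := (volume.real B)⁻¹ with hm
  have hm0 : 0 < m := by positivity
  have hshift : Continuous fun x : Eucl d => shift ℝ (-x) (ballInd d s) := by
    refine continuous_iff_seqContinuous.2 fun u v huv => ?_
    exact tendsto_shift huv.neg tendsto_const_nhds
  have hφn : 0 ≤ ‖hφ.memLp.toLp φ‖ := norm_nonneg _
  refine ⟨(fun x => shift ℝ (-x) (ballInd d s)) '' tsupport φ, m * ‖hφ.memLp.toLp φ‖ + 1,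
    hφ.compact.isCompact.image hshift, by positivity, fun p hp => ?_⟩
  refine sobZero_induction (Ω := Set.univ) (P := {p | ∀ M : ℝ, 0 ≤ M →
    (∀ g ∈ (fun x => shift ℝ (-x) (ballInd d s)) '' tsupport φ, |inner ℝ p.fst g| ≤ M) →
        ‖(hφ.field ℝ).op p.fst‖ ≤ r * ‖p.snd‖ + (m * ‖hφ.memLp.toLp φ‖ + 1) * M}) ?_ ?_ hp
  · refine isClosed_of_closure_subset fun p hp M hM hg => ?_
    obtain ⟨q, hqm, hq⟩ := mem_closure_iff_seq_limit.1 hp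
    have h1 : Tendsto (fun k => (q k).fst) atTop (𝓝 p.fst) :=
      ((WithLp.continuous_fst _ _ _).tendsto p).comp hq
    have h2 : Tendsto (fun k => (q k).snd) atTop (𝓝 p.snd) :=
      ((WithLp.continuous_snd _ _ _).tendsto p).comp hq
    have h3 : Tendsto (fun k => M + ‖(q k).fst - p.fst‖ * ‖ballInd d s‖) atTop (𝓝 M) := by
      have := ((tendsto_iff_norm_sub_tendsto_zero.1 h1).mul_const ‖ballInd d s‖).const_add M
      simpa using this
    refine le_of_tendsto_of_tendsto' ((((hφ.field ℝ).op.continuous.tendsto _).comp h1).norm)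
      ((h2.norm.const_mul r).add (h3.const_mul _)) fun k => ?_
    refine hqm k _ (by positivity) fun g hgm => ?_
    have h4 : inner ℝ (q k).fst g = inner ℝ p.fst g + inner ℝ ((q k).fst - p.fst) g := by
      rw [← inner_add_left, add_sub_cancel]
    rw [h4]
    refine (abs_add_le _ _).trans (add_le_add (hg g hgm) ((abs_real_inner_le_norm _ _).trans ?_))
    obtain ⟨x, -, rfl⟩ := hgm
    simp
  · rintro p ⟨ψ, hψ, h1, h2⟩ M hM hg
    have hw : ∀ x ∈ tsupport φ, |∫ h in B, ψ (x + h)| ≤ M := fun x hx => by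
      rw [← inner_shift_ballInd s x p.fst h1]
      exact hg _ ⟨x, hx, rfl⟩
    let ν : Measure (Eucl d) := ProbabilityTheory.cond volume B
    have hν : IsProbabilityMeasure ν := ProbabilityTheory.cond_isProbabilityMeasure_of_finite
      (Metric.measure_ball_pos _ _ hs0).ne' measure_ball_lt_top.ne
    have hνint : ∀ f : Eucl d → ℝ, ∫ h, f h ∂ν = m * ∫ h in B, f h := fun f => by
      simp only [ν, ProbabilityTheory.cond]
      rw [integral_smul_measure, smul_eq_mul, ENNReal.toReal_inv]
      rfl
    have hi : ∀ x, Integrable (fun h => ψ (x + h)) ν := fun x => by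
      obtain ⟨C, hC⟩ := hψ.bdd
      exact Integrable.of_bound (hψ.continuous.comp (by fun_prop)).aestronglyMeasurable C
        (Eventually.of_forall fun h => hC _)
    have hdiff : eLpNorm (fun x => ∫ h, (ψ (x + h) - ψ x) ∂ν) 2 volume ≤
        ENNReal.ofReal s * eLpNorm (gradient ψ) 2 volume := by
      refine eLpNorm_integral_le ?_ ?_
      · have : Continuous fun q : Eucl d × Eucl d => ψ (q.1 + q.2) - ψ q.1 :=
          (hψ.continuous.comp (by fun_prop)).sub (hψ.continuous.comp (by fun_prop))
        exact this.measurable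
      · have hmem : ∀ᵐ h ∂ν, h ∈ B := ProbabilityTheory.ae_cond_mem measurableSet_ball
        filter_upwards [hmem] with h hh
        refine (hψ.eLpNorm_shift_sub_le h).trans ?_
        gcongr
        rw [← ofReal_norm]
        exact ENNReal.ofReal_le_ofReal (mem_ball_zero_iff.1 hh).le
    have hsplit : ∀ x, φ x * ψ x =
        φ x * (m * ∫ h in B, ψ (x + h)) - φ x * ∫ h, (ψ (x + h) - ψ x) ∂ν := fun x => by
      rw [integral_sub (hi x) (integrable_const _), hνint]
      simp only [integral_const, probReal_univ, one_smul]
      ring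
    have hcont : Continuous fun x => ∫ h, (ψ (x + h) - ψ x) ∂ν := by
      obtain ⟨C, hC⟩ := hψ.bdd
      refine continuous_of_dominated (bound := fun _ => C + C) (fun x => ?_) (fun x => ?_)
        (integrable_const _) ?_
      · exact ((hψ.continuous.comp (by fun_prop)).sub continuous_const).aestronglyMeasurable
      · exact Eventually.of_forall fun h => (norm_sub_le _ _).trans (add_le_add (hC _) (hC _))
      · exact Eventually.of_forall fun h =>
          (hψ.continuous.comp (by fun_prop)).sub (hψ.continuous)
    have hprod : Continuous fun x => φ x * ∫ h, (ψ (x + h) - ψ x) ∂ν := hφ.continuous.mul hcont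
    have h6 : MemLp (fun x => φ x * ∫ h, (ψ (x + h) - ψ x) ∂ν) 2 volume :=
      hprod.memLp_of_hasCompactSupport hφ.compact.mul_right
    have h7 : MemLp (fun x => φ x * ψ x) 2 volume := (hφ.mul hψ.contDiff).memLp
    have h8 : MemLp (fun x => φ x * (m * ∫ h in B, ψ (x + h))) 2 volume := by
      have : (fun x => φ x * (m * ∫ h in B, ψ (x + h))) =
          (fun x => φ x * ψ x) + fun x => φ x * ∫ h, (ψ (x + h) - ψ x) ∂ν := by
        funext x
        rw [Pi.add_apply, hsplit]; ring
      rw [this]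
      exact h7.add h6
    have heq : (hφ.field ℝ).op p.fst = h8.toLp _ - h6.toLp _ := by
      apply Lp.ext
      filter_upwards [(hφ.field ℝ).coeFn_op p.fst, h1, h8.coeFn_toLp, h6.coeFn_toLp,
        Lp.coeFn_sub (h8.toLp _) (h6.toLp _)] with x a1 a2 a3 a4 a5
      rw [a1, a2, a5, Pi.sub_apply, a3, a4, IsTest.field_apply, smul_eq_mul]
      exact hsplit x
    have h9 : ‖h8.toLp _‖ ≤ (m * M) * ‖hφ.memLp.toLp φ‖ := by
      refine Lp.norm_le_mul_norm_of_ae_le_mul ?_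
      filter_upwards [h8.coeFn_toLp, hφ.memLp.coeFn_toLp] with x a1 a2
      rw [a1, a2, norm_mul, mul_comm]
      by_cases hx : x ∈ tsupport φ
      · refine mul_le_mul_of_nonneg_right ?_ (norm_nonneg _)
        rw [norm_mul, Real.norm_of_nonneg hm0.le]
        exact mul_le_mul_of_nonneg_left (hw x hx) hm0.le
      · rw [image_eq_zero_of_notMem_tsupport hx]; simp
    have h10 : ‖h6.toLp _‖ ≤ r * ‖p.snd‖ := by
      have e1 := eLpNorm_le_nnreal_smul_eLpNorm_of_ae_le_mul (μ := volume) (c := Cφ.toNNReal)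
        (f := fun x => φ x * ∫ h, (ψ (x + h) - ψ x) ∂ν)
        (g := fun x => ∫ h, (ψ (x + h) - ψ x) ∂ν) (Eventually.of_forall fun x => by
          rw [← NNReal.coe_le_coe, NNReal.coe_mul, coe_nnnorm, coe_nnnorm, norm_mul,
            Real.coe_toNNReal _ hCφ0.le]
          gcongr
          exact hCφ x) 2
      rw [Lp.norm_toLp, Lp.norm_def, eLpNorm_congr_ae h2]
      have e2 : eLpNorm (fun x => φ x * ∫ h, (ψ (x + h) - ψ x) ∂ν) 2 volume ≤
          ENNReal.ofReal Cφ * (ENNReal.ofReal s * eLpNorm (gradient ψ) 2 volume) :=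
        e1.trans (by
          rw [ENNReal.smul_def, smul_eq_mul]
          exact mul_le_mul_right hdiff _)
      rw [← mul_assoc, ← ENNReal.ofReal_mul hCφ0.le, hs, mul_div_cancel₀ _ hCφ0.ne'] at e2
      have e3 := ENNReal.toReal_mono (ENNReal.mul_ne_top ENNReal.ofReal_ne_top
        hψ.memLp_gradient.eLpNorm_ne_top) e2
      rwa [ENNReal.toReal_mul, ENNReal.toReal_ofReal hr.le] at e3
    rw [heq]
    refine (norm_sub_le _ _).trans ?_
    nlinarith

/-- Rellich's theorem: weak convergence in `H¹(ℝ^d)` implies strong convergence in `L²_loc`. -/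
theorem WeakLim.tendsto_field_op {l : Filter ℕ} {u : ℕ → WPair d} {v : WPair d}
    (h : WeakLim l u v) (hu : ∀ k, u k ∈ sobZero Set.univ) (hv : v ∈ sobZero Set.univ)
    {Ω : Set (Eucl d)} {φ : Eucl d → ℝ} (hφ : IsTest Ω φ) :
    Tendsto (fun k => (hφ.field ℝ).op (u k).fst) l (𝓝 ((hφ.field ℝ).op v.fst)) := by
  have hw : WeakLim l (fun k => u k - v) 0 := by simpa using h.sub (WeakLim.const l v)
  obtain ⟨C, hC0, hC⟩ := hw.bound
  rw [tendsto_iff_norm_sub_tendsto_zero]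
  rw [Metric.tendsto_nhds]
  intro ε hε
  obtain ⟨K, C', hK, hC', hmain⟩ := norm_field_op_le hφ.univ (r := ε / (3 * C)) (by positivity)
  have hw1 : WeakLim l (fun k => (u k - v).fst) 0 := by
    simpa using hw.map (WithLp.fstL 2 ℝ (L2Rd d ℝ) (L2Rd d (Eucl d)))
  filter_upwards [hw1.eventually_forall_compact hK (r := ε / (3 * C')) (by positivity)] with k hk
  have h1 := hmain (u k - v) (Submodule.sub_mem _ (hu k) hv) _ (by positivity) hk
  rw [WithLp.sub_fst, map_sub] at h1
  have h2 : ‖(u k - v).snd‖ ≤ C := (WithLp.norm_snd_le _ _).trans (hC k)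
  have h3 : ε / (3 * C) * ‖(u k - v).snd‖ ≤ ε / (3 * C) * C := by gcongr
  have h4 : ε / (3 * C) * C = ε / 3 := by field_simp
  have h5 : C' * (ε / (3 * C')) = ε / 3 := by field_simp
  rw [dist_zero_right, norm_norm]
  change ‖(hφ.univ.field ℝ).op (u k).fst - (hφ.univ.field ℝ).op v.fst‖ < ε
  linarith

end Compactness

section Localization

variable {d : ℕ}

theorem exists_isTest_ball (R : ℝ) (hR : 0 < R) : ∃ χ : Eucl d → ℝ, IsTest Set.univ χ ∧
    (∀ x ∈ Metric.ball (0 : Eucl d) R, χ =ᶠ[𝓝 x] fun _ => 1) ∧ ∀ x, 0 ≤ χ x := by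
  let f : ContDiffBump (0 : Eucl d) := ⟨R, R + 1, hR, by linarith⟩
  exact ⟨f, ⟨f.contDiff, f.hasCompactSupport, Set.subset_univ _⟩,
    fun x hx => f.eventuallyEq_one_of_mem_ball hx, fun x => f.nonneg⟩

/-- A pair in `H¹(ℝ^d)` whose gradient is a given constant on a given ball. -/
theorem exists_affine (R : ℝ) (hR : 0 < R) (ξ : Eucl d) : ∃ p ∈ sobZero (Set.univ : Set (Eucl d)),
    ∀ᵐ x, x ∈ Metric.ball (0 : Eucl d) R → p.snd x = ξ := by
  obtain ⟨χ, hχ, h1, -⟩ := exists_isTest_ball (d := d) R hR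
  have hl : ContDiff ℝ ∞ fun x : Eucl d => (inner ℝ ξ x : ℝ) := contDiff_const.inner ℝ contDiff_id
  refine ⟨(hχ.mul hl).pair, (hχ.mul hl).pair_mem, ?_⟩
  filter_upwards [(hχ.mul hl).pair_snd] with x hx hxR
  rw [hx]
  have h2 : (fun x => χ x * inner ℝ ξ x) =ᶠ[𝓝 x] fun x => inner ℝ ξ x := by
    filter_upwards [h1 x hxR] with y hy
    rw [hy, one_mul]
  rw [h2.gradient_eq]
  apply HasGradientAt.gradient
  rw [hasGradientAt_iff_hasFDerivAt]
  exact ((InnerProductSpace.toDual ℝ (Eucl d)) ξ).hasFDerivAt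

/-- An integrable function with nonnegative integral against all nonnegative test functions of an
open set is nonnegative almost everywhere on that set. -/
theorem ae_nonneg_of_forall_isTest {U : Set (Eucl d)} (hU : IsOpen U) {F : Eucl d → ℝ}
    (hF : Integrable F) (h : ∀ φ, IsTest U φ → (∀ x, 0 ≤ φ x) → 0 ≤ ∫ x, φ x * F x) :
    ∀ᵐ x, x ∈ U → 0 ≤ F x := by
  let f : ℕ → ContDiffBump (0 : Eucl d) := fun k =>
    ⟨1 / (k + 1), 2 / (k + 1), by positivity, by gcongr; norm_num⟩
  have hlim : Tendsto (fun k => (f k).rOut) atTop (𝓝 0) := by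
    have := (tendsto_one_div_add_atTop_nhds_zero_nat (𝕜 := ℝ)).const_mul 2
    simpa only [f, mul_one_div, mul_zero] using this
  have key := ContDiffBump.ae_convolution_tendsto_right_of_locallyIntegrable (μ := volume)
    (φ := f) (K := 2) hlim (Eventually.of_forall fun k => by
      simp only [f]; rw [mul_one_div]) hF.locallyIntegrable
  filter_upwards [key] with x hx hxU
  obtain ⟨r, hr, hrU⟩ := Metric.isOpen_iff.1 hU x hxU
  refine ge_of_tendsto hx ?_
  filter_upwards [hlim.eventually_lt_const hr] with k hk
  rw [convolution_eq_swap]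
  have h1 : ∀ t, (f k).normed volume (x - t) =
      (∫ y, f k y)⁻¹ * f k (x - t) := fun t => by
    rw [ContDiffBump.normed_def, div_eq_inv_mul]
  have h2 : IsTest U fun t => f k (x - t) := by
    have hcont : ContDiff ℝ ∞ fun t : Eucl d => f k (x - t) :=
      (f k).contDiff.comp (contDiff_const.sub contDiff_id)
    have hsub : Function.support (fun t : Eucl d => f k (x - t)) ⊆
        Metric.closedBall x (f k).rOut := by
      intro t ht
      have : x - t ∈ Function.support (f k) := ht
      rw [ContDiffBump.support_eq, mem_ball_zero_iff] at this
      rw [Metric.mem_closedBall, dist_comm, dist_eq_norm]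
      exact this.le
    refine ⟨hcont, HasCompactSupport.of_support_subset_isCompact (isCompact_closedBall _ _) hsub,
      (closure_minimal hsub Metric.isClosed_closedBall).trans ?_⟩
    exact (Metric.closedBall_subset_ball hk).trans hrU
  have h3 := h _ h2 fun t => (f k).nonneg
  simp only [ContinuousLinearMap.lsmul_apply, smul_eq_mul, h1, mul_assoc]
  rw [integral_const_mul]
  exact mul_nonneg (inv_nonneg.2 (integral_nonneg fun y => (f k).nonneg)) h3

theorem ae_eq_zero_of_forall_isTest {U : Set (Eucl d)} (hU : IsOpen U) {F : Eucl d → ℝ}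
    (hF : Integrable F) (h : ∀ φ, IsTest U φ → ∫ x, φ x * F x = 0) :
    ∀ᵐ x, x ∈ U → F x = 0 :=
  hU.ae_eq_zero_of_integral_contDiff_smul_eq_zero (hF.locallyIntegrable.locallyIntegrableOn U)
    fun g h1 h2 h3 => by simpa using h g ⟨h1, h2, h3⟩

variable {F : Type*} [NormedAddCommGroup F] [InnerProductSpace ℝ F]

theorem IsTest.inner_field_op {Ω : Set (Eucl d)} {φ : Eucl d → ℝ} (h : IsTest Ω φ)
    (g g' : L2Rd d F) : inner ℝ ((h.field F).op g) g' = ∫ x, φ x * inner ℝ (g x) (g' x) := by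
  rw [BField.inner_op]
  refine integral_congr_ae (Eventually.of_forall fun x => ?_)
  simp only [IsTest.field_apply, inner_smul_left, RCLike.conj_to_real]

theorem IsTest.inner_field_op_comm {Ω : Set (Eucl d)} {φ : Eucl d → ℝ} (h : IsTest Ω φ)
    (g g' : L2Rd d F) : inner ℝ ((h.field F).op g) g' = inner ℝ ((h.field F).op g') g := by
  rw [h.inner_field_op, h.inner_field_op]
  simp only [real_inner_comm]

theorem IsTest.inner_field_op_nonneg {Ω : Set (Eucl d)} {φ : Eucl d → ℝ} (h : IsTest Ω φ)
    (h0 : ∀ x, 0 ≤ φ x) (g : L2Rd d F) : 0 ≤ inner ℝ ((h.field F).op g) g := by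
  rw [h.inner_field_op]
  exact integral_nonneg fun x => mul_nonneg (h0 x) real_inner_self_nonneg

theorem IsTest.integrable_mul {Ω : Set (Eucl d)} {φ : Eucl d → ℝ} (h : IsTest Ω φ)
    {f : Eucl d → ℝ} (hf : Integrable f) : Integrable fun x => φ x * f x := by
  obtain ⟨C, hC⟩ := h.bdd
  exact hf.bdd_mul h.continuous.aestronglyMeasurable (Eventually.of_forall hC)

/-- The form `∫ φ c g · g'` with the coefficient moved to the other side. -/
theorem IsTest.inner_field_op_op {Ω : Set (Eucl d)} {φ : Eucl d → ℝ} (h : IsTest Ω φ)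
    (c : BField d (Eucl d) (Eucl d)) (g g' : L2Rd d (Eucl d)) :
    inner ℝ ((h.field (Eucl d)).op (c.op g)) g' =
      inner ℝ ((h.field (Eucl d)).op (c.adj.op g')) g := by
  rw [h.inner_field_op, h.inner_field_op]
  refine integral_congr_ae ?_
  filter_upwards [c.coeFn_op g, c.adj.coeFn_op g'] with x h1 h2
  rw [h1, h2, BField.adj_apply, ContinuousLinearMap.adjoint_inner_left, real_inner_comm]

end Localization

section CompensatedCompactness

variable {d : ℕ}

/-- Weak convergence in `H¹(ℝ^d)`. -/
structure GradConv (l : Filter ℕ) (u : ℕ → WPair d) (v : WPair d) : Prop where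
  mem : ∀ k, u k ∈ sobZero (Set.univ : Set (Eucl d))
  mem_lim : v ∈ sobZero (Set.univ : Set (Eucl d))
  lim : WeakLim l u v

/-- Weak convergence in `L²(ℝ^d; ℝ^d)` of vector fields with precompact divergence in
`H^{-1}_loc(Ω)`. -/
structure DivConv (l : Filter ℕ) (Ω : Set (Eucl d)) (D : ℕ → L2Rd d (Eucl d))
    (D' : L2Rd d (Eucl d)) : Prop where
  lim : WeakLim l D D'
  div : ∀ {φ : Eucl d → ℝ} (hφ : IsTest Ω φ) {w : ℕ → WPair d} {w' : WPair d}, GradConv l w w' →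
    Tendsto (fun k => inner ℝ (D k) (hφ.mulPair (w k)).snd) l
      (𝓝 (inner ℝ D' (hφ.mulPair w').snd))

theorem WeakLim.fst {l : Filter ℕ} {u : ℕ → WPair d} {v : WPair d} (h : WeakLim l u v) :
    WeakLim l (fun k => (u k).fst) v.fst :=
  h.map (WithLp.fstL 2 ℝ (L2Rd d ℝ) (L2Rd d (Eucl d)))

theorem WeakLim.snd {l : Filter ℕ} {u : ℕ → WPair d} {v : WPair d} (h : WeakLim l u v) :
    WeakLim l (fun k => (u k).snd) v.snd :=
  h.map (WithLp.sndL 2 ℝ (L2Rd d ℝ) (L2Rd d (Eucl d)))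

theorem WeakLim.pair {l : Filter ℕ} {u : ℕ → WPair d} {v : WPair d}
    (h1 : WeakLim l (fun k => (u k).fst) v.fst) (h2 : WeakLim l (fun k => (u k).snd) v.snd) :
    WeakLim l u v := by
  obtain ⟨C, hC0, hC⟩ := h1.bound
  obtain ⟨C', hC0', hC'⟩ := h2.bound
  refine ⟨⟨C + C', fun k => ?_⟩, fun w => ?_⟩
  · refine le_of_sq_le_sq ?_ (by positivity)
    rw [WithLp.prod_norm_sq_eq_of_L2]
    nlinarith [hC k, hC' k, norm_nonneg (u k).fst, norm_nonneg (u k).snd]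
  · simp only [WithLp.prod_inner_apply]
    exact (h1.lim _).add (h2.lim _)

theorem GradConv.mulPair {l : Filter ℕ} {u : ℕ → WPair d} {v : WPair d} (h : GradConv l u v)
    {Ω : Set (Eucl d)} {φ : Eucl d → ℝ} (hφ : IsTest Ω φ) :
    GradConv l (fun k => hφ.mulPair (u k)) (hφ.mulPair v) :=
  ⟨fun k => hφ.univ.mulPair_mem (h.mem k), hφ.univ.mulPair_mem h.mem_lim, h.lim.map hφ.mulPair⟩

theorem GradConv.tendsto_gradField {l : Filter ℕ} {u : ℕ → WPair d} {v : WPair d}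
    (h : GradConv l u v) {Ω : Set (Eucl d)} {φ : Eucl d → ℝ} (hφ : IsTest Ω φ) :
    Tendsto (fun k => hφ.gradField.op (u k).fst) l (𝓝 (hφ.gradField.op v.fst)) := by
  obtain ⟨R, hR0, hR⟩ := hφ.compact.isCompact.isBounded.exists_pos_norm_lt
  obtain ⟨χ, hχ, h1, -⟩ := exists_isTest_ball (d := d) R hR0
  have hkey : ∀ g : L2Rd d ℝ, hφ.gradField.op ((hχ.field ℝ).op g) = hφ.gradField.op g := by
    intro g
    apply Lp.ext
    filter_upwards [hφ.gradField.coeFn_op ((hχ.field ℝ).op g), hφ.gradField.coeFn_op g,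
      (hχ.field ℝ).coeFn_op g] with x a1 a2 a3
    rw [a1, a2, a3, IsTest.gradField_apply, IsTest.gradField_apply, IsTest.field_apply]
    by_cases hx : x ∈ tsupport φ
    · rw [(h1 x (mem_ball_zero_iff.2 (hR x hx))).self_of_nhds, one_smul]
    · have : gradient φ x = 0 := by
        have h3 : φ =ᶠ[𝓝 x] fun _ => 0 := notMem_tsupport_iff_eventuallyEq.1 hx
        rw [h3.gradient_eq, gradient_fun_const]
      rw [this]; simp
  rw [← hkey v.fst]
  exact ((hφ.gradField.op.continuous.tendsto _).comp
    (h.lim.tendsto_field_op h.mem h.mem_lim hχ)).congr fun k => hkey _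

/-- The div-curl lemma. -/
theorem DivConv.tendsto_inner {l : Filter ℕ} {Ω : Set (Eucl d)} {D : ℕ → L2Rd d (Eucl d)}
    {D' : L2Rd d (Eucl d)} (hD : DivConv l Ω D D') {u : ℕ → WPair d} {v : WPair d}
    (hu : GradConv l u v) {φ : Eucl d → ℝ} (hφ : IsTest Ω φ) :
    Tendsto (fun k => inner ℝ ((hφ.field (Eucl d)).op (D k)) (u k).snd) l
      (𝓝 (inner ℝ ((hφ.field (Eucl d)).op D') v.snd)) := by
  have h1 := (hD.div hφ hu).sub (hD.lim.inner_tendsto (hu.tendsto_gradField hφ))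
  have h2 : ∀ g g' : L2Rd d (Eucl d), inner ℝ ((hφ.field (Eucl d)).op g) g' =
      inner ℝ g ((hφ.field (Eucl d)).op g') := fun g g' => by
    rw [hφ.inner_field_op_comm, real_inner_comm]
  have h3 : ∀ (E : L2Rd d (Eucl d)) (p : WPair d),
      inner ℝ E (hφ.mulPair p).snd - inner ℝ E (hφ.gradField.op p.fst) =
        inner ℝ ((hφ.field (Eucl d)).op E) p.snd := fun E p => by
    rw [IsTest.mulPair_snd, inner_add_right, add_sub_cancel_right, h2]
  rw [h3] at h1
  exact h1.congr fun k => h3 _ _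

/-- Uniform ellipticity `α |ξ|² ≤ T ξ · ξ` and `|T ξ|² ≤ β T ξ · ξ`. -/
def Ell (α β : ℝ) (T : Eucl d →L[ℝ] Eucl d) : Prop :=
  ∀ ξ, α * ‖ξ‖ ^ 2 ≤ inner ℝ (T ξ) ξ ∧ ‖T ξ‖ ^ 2 ≤ β * inner ℝ (T ξ) ξ

theorem Ell.norm_le {α β : ℝ} (hβ : 0 ≤ β) {T : Eucl d →L[ℝ] Eucl d} (h : Ell α β T) :
    ‖T‖ ≤ β := by
  refine T.opNorm_le_bound hβ fun ξ => ?_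
  have h1 := (h ξ).2
  have h2 := real_inner_le_norm (T ξ) ξ
  rcases (norm_nonneg (T ξ)).eq_or_lt with h0 | h0
  · rw [← h0]; positivity
  · have : ‖T ξ‖ ^ 2 ≤ β * (‖T ξ‖ * ‖ξ‖) := h1.trans (by gcongr)
    nlinarith

theorem isClosed_ell (α β : ℝ) : IsClosed {T : Eucl d →L[ℝ] Eucl d | Ell α β T} := by
  simp only [Ell, Set.ofPred_forall, Set.ofPred_and]
  refine isClosed_iInter fun ξ => IsClosed.inter (isClosed_le ?_ ?_) (isClosed_le ?_ ?_)
  all_goals fun_prop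

theorem ell_of_dense {α β : ℝ} {T : Eucl d →L[ℝ] Eucl d} {s : Set (Eucl d)} (hs : Dense s)
    (h : ∀ ξ ∈ s, α * ‖ξ‖ ^ 2 ≤ inner ℝ (T ξ) ξ ∧ ‖T ξ‖ ^ 2 ≤ β * inner ℝ (T ξ) ξ) :
    Ell α β T := by
  intro ξ
  have hc : IsClosed {ξ : Eucl d | α * ‖ξ‖ ^ 2 ≤ inner ℝ (T ξ) ξ ∧
      ‖T ξ‖ ^ 2 ≤ β * inner ℝ (T ξ) ξ} := by
    rw [Set.ofPred_and]
    refine IsClosed.inter (isClosed_le ?_ ?_) (isClosed_le ?_ ?_)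
    all_goals fun_prop
  exact closure_minimal (s := s) h hc (hs ξ)

theorem ell_smul_id {α β : ℝ} (hα : 0 < α) (hαβ : α ≤ β) :
    Ell α β (α • ContinuousLinearMap.id ℝ (Eucl d)) := by
  intro ξ
  simp only [_root_.smul_apply, ContinuousLinearMap.id_apply, inner_smul_left, norm_smul,
    real_inner_self_eq_norm_sq, RCLike.conj_to_real, Real.norm_of_nonneg hα.le, mul_pow]
  refine ⟨le_rfl, ?_⟩
  nlinarith [mul_le_mul_of_nonneg_right hαβ (mul_nonneg hα.le (sq_nonneg ‖ξ‖))]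

/-- Recovery sequences: every `v ∈ H¹(ℝ^d)` is the weak limit of functions `u_k` such that
`div (a_k ∇u_k)` is precompact. -/
theorem exists_recovery (l : Ultrafilter ℕ) (a : ℕ → BField d (Eucl d) (Eucl d)) {α β : ℝ}
    (hα : 0 < α) (hβ : 0 < β) (hcoer : ∀ k x ξ, α * ‖ξ‖ ^ 2 ≤ inner ℝ (a k x ξ) ξ)
    (hb : ∀ k x, ‖a k x‖ ≤ β) {v : WPair d} (hv : v ∈ sobZero (Set.univ : Set (Eucl d))) :
    ∃ (u : ℕ → WPair d) (D : L2Rd d (Eucl d)), GradConv l u v ∧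
      DivConv l Set.univ (fun k => (a k).op (u k).snd) D := by
  let X := sobZero (Set.univ : Set (Eucl d))
  let J : X →L[ℝ] WPair d := X.subtypeL
  let Q : ℕ → WPair d →L[ℝ] WPair d := fun k =>
    (WithLp.prodContinuousLinearEquiv 2 ℝ (L2Rd d ℝ) (L2Rd d (Eucl d))).symm.toContinuousLinearMap.comp
      ((WithLp.fstL 2 ℝ _ _).prod ((a k).op.comp (WithLp.sndL 2 ℝ _ _)))
  have hQ : ∀ k p q, inner ℝ (Q k p) q = inner ℝ p.fst q.fst + inner ℝ ((a k).op p.snd) q.snd :=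
    fun k p q => WithLp.prod_inner_apply _ _
  let T : ℕ → X →L[ℝ] X := fun k => J.adjoint.comp ((Q k).comp J)
  have hT : ∀ k (p q : X), inner ℝ (T k p) q =
      inner ℝ (p : WPair d).fst (q : WPair d).fst +
        inner ℝ ((a k).op (p : WPair d).snd) (q : WPair d).snd := fun k p q => by
    rw [← hQ]
    exact ContinuousLinearMap.adjoint_inner_left J q (Q k p)
  have hac : ∀ k (g : L2Rd d (Eucl d)), α * ‖g‖ ^ 2 ≤ inner ℝ ((a k).op g) g := by
    intro k g
    rw [← real_inner_self_eq_norm_sq, L2.inner_def, L2.inner_def, ← integral_const_mul]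
    refine integral_mono_ae ((L2.integrable_inner g g).const_mul _)
      (L2.integrable_inner ((a k).op g) g) ?_
    filter_upwards [(a k).coeFn_op g] with x hx
    simp only [hx, real_inner_self_eq_norm_sq]
    exact hcoer k x _
  have hTc : ∀ k (p : X), min α 1 * ‖p‖ ^ 2 ≤ inner ℝ (T k p) p := by
    intro k p
    rw [hT]
    have h1 := hac k (p : WPair d).snd
    have h2 : ‖p‖ ^ 2 = ‖(p : WPair d).fst‖ ^ 2 + ‖(p : WPair d).snd‖ ^ 2 :=
      WithLp.prod_norm_sq_eq_of_L2 (p : WPair d)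
    rw [real_inner_self_eq_norm_sq, h2]
    nlinarith [min_le_left α 1, min_le_right α 1, sq_nonneg ‖(p : WPair d).fst‖,
      sq_nonneg ‖(p : WPair d).snd‖]
  have hTb : ∀ k (p : X), ‖T k p‖ ≤ (1 + β) * ‖p‖ := by
    intro k p
    have h1 : inner ℝ (T k p) (T k p) ≤ (1 + β) * ‖p‖ * ‖T k p‖ := by
      rw [hT]
      have e1 : ‖(p : WPair d).fst‖ ≤ ‖p‖ := WithLp.norm_fst_le _ _
      have e2 : ‖(p : WPair d).snd‖ ≤ ‖p‖ := WithLp.norm_snd_le _ _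
      have e3 : ‖(T k p : WPair d).fst‖ ≤ ‖T k p‖ := WithLp.norm_fst_le _ _
      have e4 : ‖(T k p : WPair d).snd‖ ≤ ‖T k p‖ := WithLp.norm_snd_le _ _
      have e5 := (a k).norm_op_le (hb k) (p : WPair d).snd
      calc _ ≤ ‖(p : WPair d).fst‖ * ‖(T k p : WPair d).fst‖ +
            ‖(a k).op (p : WPair d).snd‖ * ‖(T k p : WPair d).snd‖ :=
            add_le_add (real_inner_le_norm _ _) (real_inner_le_norm _ _)
        _ ≤ ‖p‖ * ‖T k p‖ + (β * ‖p‖) * ‖T k p‖ := by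
            gcongr
            exact e5.trans (by gcongr)
        _ = _ := by ring
    rw [real_inner_self_eq_norm_sq] at h1
    rcases (norm_nonneg (T k p)).eq_or_lt with h0 | h0
    · rw [← h0]; positivity
    · nlinarith
  obtain ⟨f, u, hfu, hu⟩ := exists_weakLim_of_coercive l T (c := min α 1) (C := 1 + β)
    (by positivity) (by positivity) hTc hTb (⟨v, hv⟩ : X)
  have hgc : GradConv l (fun k => (u k : WPair d)) v :=
    ⟨fun k => (u k).2, hv, hu.map J⟩
  obtain ⟨C, hC⟩ := hgc.lim.snd.bdd
  obtain ⟨D, hD⟩ := exists_weakLim l (fun k => (a k).op (u k : WPair d).snd)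
    ⟨β * C, fun k => ((a k).norm_op_le (hb k) _).trans (by gcongr; exact hC k)⟩
  have heq : ∀ k (q : X), inner ℝ ((a k).op (u k : WPair d).snd) (q : WPair d).snd =
      inner ℝ (f : WPair d) (q : WPair d) - inner ℝ (u k : WPair d).fst (q : WPair d).fst := by
    intro k q
    have := hT k (u k) q
    rw [hfu] at this
    rw [eq_sub_iff_add_eq, add_comm, ← this]
    rfl
  have heq' : ∀ (q : X), inner ℝ D (q : WPair d).snd =
      inner ℝ (f : WPair d) (q : WPair d) - inner ℝ v.fst (q : WPair d).fst := fun q => by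
    refine tendsto_nhds_unique (hD.lim (q : WPair d).snd) ?_
    simp only [heq]
    exact tendsto_const_nhds.sub (hgc.lim.fst.lim _)
  refine ⟨_, D, hgc, hD, fun {φ} hφ {w w'} hw => ?_⟩
  have hm := hw.mulPair hφ
  have e1 : ∀ k, inner ℝ ((a k).op (u k : WPair d).snd) (hφ.mulPair (w k)).snd =
      inner ℝ (f : WPair d) (hφ.mulPair (w k)) -
        inner ℝ (u k : WPair d).fst ((hφ.field ℝ).op (w k).fst) :=
    fun k => heq k ⟨_, hm.mem k⟩
  have e2 : inner ℝ D (hφ.mulPair w').snd =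
      inner ℝ (f : WPair d) (hφ.mulPair w') - inner ℝ v.fst ((hφ.field ℝ).op w'.fst) :=
    heq' ⟨_, hm.mem_lim⟩
  simp only [e1, e2]
  refine Tendsto.sub ?_ (hgc.lim.fst.inner_tendsto
    (hw.lim.tendsto_field_op hw.mem hw.mem_lim hφ))
  simpa only [real_inner_comm] using hm.lim.lim (f : WPair d)

end CompensatedCompactness

section HLimit

variable {d : ℕ}

theorem ae_le_of_forall_isTest {U : Set (Eucl d)} (hU : IsOpen U) {f g : Eucl d → ℝ}
    (hf : Integrable f) (hg : Integrable g)
    (h : ∀ φ, IsTest U φ → (∀ x, 0 ≤ φ x) → ∫ x, φ x * f x ≤ ∫ x, φ x * g x) :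
    ∀ᵐ x, x ∈ U → f x ≤ g x := by
  have := ae_nonneg_of_forall_isTest hU (hg.sub hf) fun φ hφ h0 => by
    simp only [Pi.sub_apply, mul_sub]
    rw [integral_sub (hφ.integrable_mul hg) (hφ.integrable_mul hf)]
    exact sub_nonneg.2 (h φ hφ h0)
  filter_upwards [this] with x hx hxU
  exact sub_nonneg.1 (hx hxU)

theorem ae_eq_of_forall_isTest {U : Set (Eucl d)} (hU : IsOpen U) {f g : Eucl d → ℝ}
    (hf : Integrable f) (hg : Integrable g)
    (h : ∀ φ, IsTest U φ → ∫ x, φ x * f x = ∫ x, φ x * g x) :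
    ∀ᵐ x, x ∈ U → f x = g x := by
  have := ae_eq_zero_of_forall_isTest hU (hf.sub hg) fun φ hφ => by
    simp only [Pi.sub_apply, mul_sub]
    rw [integral_sub (hφ.integrable_mul hf) (hφ.integrable_mul hg), h φ hφ, sub_self]
  filter_upwards [this] with x hx hxU
  exact sub_eq_zero.1 (hx hxU)

theorem IsTest.integral_mul_mono {Ω : Set (Eucl d)} {φ : Eucl d → ℝ} (h : IsTest Ω φ)
    (h0 : ∀ x, 0 ≤ φ x) {f g : Eucl d → ℝ} (hf : Integrable f) (hg : Integrable g)
    (hfg : ∀ᵐ x, x ∈ Ω → f x ≤ g x) : ∫ x, φ x * f x ≤ ∫ x, φ x * g x := by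
  refine integral_mono_ae (h.integrable_mul hf) (h.integrable_mul hg) ?_
  filter_upwards [hfg] with x hx
  by_cases hxs : x ∈ tsupport φ
  · exact mul_le_mul_of_nonneg_left (hx (h.subset hxs)) (h0 x)
  · simp [image_eq_zero_of_notMem_tsupport hxs]

/-- Energy inequalities for the limit of `a_k ∇u_k`. -/
theorem ae_energy {l : Filter ℕ} [l.NeBot] {a : ℕ → BField d (Eucl d) (Eucl d)} {α β : ℝ}
    (hE : ∀ k x, Ell α β (a k x)) {Ω : Set (Eucl d)} (hΩ : IsOpen Ω)
    {u : ℕ → WPair d} {v : WPair d} (hu : GradConv l u v) {D : L2Rd d (Eucl d)}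
    (hD : DivConv l Ω (fun k => (a k).op (u k).snd) D) (hα : 0 < α) :
    ∀ᵐ x, x ∈ Ω → α * ‖v.snd x‖ ^ 2 ≤ inner ℝ (D x) (v.snd x) ∧
      ‖D x‖ ^ 2 ≤ β * inner ℝ (D x) (v.snd x) := by
  have hIntg : ∀ g h : L2Rd d (Eucl d), Integrable fun x => (inner ℝ (g x) (h x) : ℝ) :=
    fun g h => L2.integrable_inner g h
  have h1 : ∀ᵐ x, x ∈ Ω → α * inner ℝ (v.snd x) (v.snd x) ≤ inner ℝ (D x) (v.snd x) := by
    refine ae_le_of_forall_isTest hΩ ((hIntg _ _).const_mul α) (hIntg _ _) fun φ hφ h0 => ?_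
    have e1 := hu.lim.snd.le_of_tendsto (hφ.field (Eucl d)).op (hφ.inner_field_op_comm)
      (hφ.inner_field_op_nonneg h0) ((hD.tendsto_inner hu hφ).const_mul α⁻¹) fun k => by
        rw [hφ.inner_field_op, hφ.inner_field_op, ← integral_const_mul]
        simp only [mul_left_comm α⁻¹]
        refine hφ.integral_mul_mono h0 (hIntg _ _) ((hIntg _ _).const_mul _) ?_
        filter_upwards [(a k).coeFn_op (u k).snd] with x hx _
        rw [hx, real_inner_self_eq_norm_sq, le_inv_mul_iff₀ hα]
        exact (hE k x _).1
    rw [hφ.inner_field_op, hφ.inner_field_op, le_inv_mul_iff₀ hα, ← integral_const_mul] at e1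
    simpa only [mul_left_comm α] using e1
  have h2 : ∀ᵐ x, x ∈ Ω → inner ℝ (D x) (D x) ≤ β * inner ℝ (D x) (v.snd x) := by
    refine ae_le_of_forall_isTest hΩ (hIntg _ _) ((hIntg _ _).const_mul β) fun φ hφ h0 => ?_
    have e1 := hD.lim.le_of_tendsto (hφ.field (Eucl d)).op (hφ.inner_field_op_comm)
      (hφ.inner_field_op_nonneg h0) ((hD.tendsto_inner hu hφ).const_mul β) fun k => by
        rw [hφ.inner_field_op, hφ.inner_field_op, ← integral_const_mul]
        simp only [mul_left_comm β]
        refine hφ.integral_mul_mono h0 (hIntg _ _) ((hIntg _ _).const_mul _) ?_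
        filter_upwards [(a k).coeFn_op (u k).snd] with x hx _
        rw [hx, real_inner_self_eq_norm_sq]
        exact (hE k x _).2
    rw [hφ.inner_field_op, hφ.inner_field_op, ← integral_const_mul] at e1
    simpa only [mul_left_comm β] using e1
  filter_upwards [h1, h2] with x h1 h2 hx
  rw [← real_inner_self_eq_norm_sq, ← real_inner_self_eq_norm_sq]
  exact ⟨h1 hx, h2 hx⟩

/-- Duality between the limits of `a_k ∇u_k` and `a_k^T ∇w_k`. -/
theorem ae_duality {l : Filter ℕ} [l.NeBot] {a : ℕ → BField d (Eucl d) (Eucl d)}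
    {Ω Ω' : Set (Eucl d)} (hΩ : IsOpen Ω) (hΩ' : IsOpen Ω')
    {u w : ℕ → WPair d} {v z : WPair d} (hu : GradConv l u v) (hw : GradConv l w z)
    {D Q : L2Rd d (Eucl d)} (hD : DivConv l Ω (fun k => (a k).op (u k).snd) D)
    (hQ : DivConv l Ω' (fun k => (a k).adj.op (w k).snd) Q) :
    ∀ᵐ x, x ∈ Ω ∩ Ω' → inner ℝ (D x) (z.snd x) = inner ℝ (Q x) (v.snd x) := by
  refine ae_eq_of_forall_isTest (hΩ.inter hΩ') (L2.integrable_inner _ _)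
    (L2.integrable_inner _ _) fun φ hφ => ?_
  have hφ1 := hφ.mono Set.inter_subset_left
  have hφ2 := hφ.mono Set.inter_subset_right
  have e1 := hD.tendsto_inner hw hφ1
  have e2 := hQ.tendsto_inner hu hφ2
  rw [← hφ1.inner_field_op, ← hφ2.inner_field_op]
  refine tendsto_nhds_unique e1 (e2.congr fun k => ?_)
  exact (hφ.inner_field_op_op (a k) _ _).symm

/-- `abar` is the `H`-limit of `a_k` along the filter `l`, on `ℝ^d`: limits of fluxes with
precompact divergence are fluxes for `abar`. -/
def IsHLim (l : Filter ℕ) (a : ℕ → BField d (Eucl d) (Eucl d))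
    (abar : BField d (Eucl d) (Eucl d)) : Prop :=
  ∀ (Ω : Set (Eucl d)), IsOpen Ω → ∀ (u : ℕ → WPair d) (v : WPair d) (D : L2Rd d (Eucl d)),
    GradConv l u v → DivConv l Ω (fun k => (a k).op (u k).snd) D →
    ∀ᵐ x, x ∈ Ω → D x = abar x (v.snd x)

theorem Ell.adj_coercive {α β : ℝ} {T : Eucl d →L[ℝ] Eucl d} (h : Ell α β T) (ξ : Eucl d) :
    α * ‖ξ‖ ^ 2 ≤ inner ℝ (T.adjoint ξ) ξ := by
  rw [ContinuousLinearMap.adjoint_inner_left, real_inner_comm]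
  exact (h ξ).1

theorem exists_recovery_ell (l : Ultrafilter ℕ) (a : ℕ → BField d (Eucl d) (Eucl d)) {α β : ℝ}
    (hα : 0 < α) (hβ : 0 < β) (hE : ∀ k x, Ell α β (a k x))
    {v : WPair d} (hv : v ∈ sobZero (Set.univ : Set (Eucl d))) :
    ∃ (u : ℕ → WPair d) (D : L2Rd d (Eucl d)), GradConv l u v ∧
      DivConv l Set.univ (fun k => (a k).op (u k).snd) D :=
  exists_recovery l a hα hβ (fun k x ξ => (hE k x ξ).1) (fun k x => (hE k x).norm_le hβ.le) hv

theorem exists_recovery_adj (l : Ultrafilter ℕ) (a : ℕ → BField d (Eucl d) (Eucl d)) {α β : ℝ}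
    (hα : 0 < α) (hβ : 0 < β) (hE : ∀ k x, Ell α β (a k x))
    {v : WPair d} (hv : v ∈ sobZero (Set.univ : Set (Eucl d))) :
    ∃ (u : ℕ → WPair d) (D : L2Rd d (Eucl d)), GradConv l u v ∧
      DivConv l Set.univ (fun k => (a k).adj.op (u k).snd) D := by
  have hb : ∀ k x, ‖(a k).adj x‖ ≤ β := fun k x => by
    have : ‖(a k).adj x‖ = ‖a k x‖ := LinearIsometryEquiv.norm_map _ _
    rw [this]
    exact (hE k x).norm_le hβ.le
  exact exists_recovery l (fun k => (a k).adj) hα hβ (fun k x => (hE k x).adj_coercive) hb hv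

theorem ae_forall_of_forall_ball {P : Eucl d → Prop}
    (h : ∀ R : ℕ, ∀ᵐ x, x ∈ Metric.ball (0 : Eucl d) (R + 1) → P x) : ∀ᵐ x, P x := by
  filter_upwards [ae_all_iff.2 h] with x hx
  refine hx ⌈‖x‖⌉₊ (mem_ball_zero_iff.2 ?_)
  have := Nat.le_ceil ‖x‖
  linarith

/-- Compactness of `H`-convergence. -/
theorem exists_isHLim (l : Ultrafilter ℕ) (a : ℕ → BField d (Eucl d) (Eucl d)) {α β : ℝ}
    (hα : 0 < α) (hαβ : α ≤ β) (hE : ∀ k x, Ell α β (a k x)) :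
    ∃ abar : BField d (Eucl d) (Eucl d), (∀ x, Ell α β (abar x)) ∧ IsHLim l a abar := by
  have hβ : 0 < β := hα.trans_le hαβ
  choose p hp hpR using fun R : ℕ => fun ξ : Eucl d =>
    exists_affine (d := d) ((R : ℝ) + 1) (by positivity) ξ
  let e : Fin d → Eucl d := fun i => EuclideanSpace.single i 1
  choose w q hw hq using fun (R : ℕ) (i : Fin d) => exists_recovery_adj l a hα hβ hE (hp R (e i))
  let rho : Eucl d → ℕ := fun x => ⌈‖x‖⌉₊
  have hrho : Measurable rho := Nat.measurable_ceil.comp measurable_norm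
  have hqm : ∀ i, Measurable fun x => q (rho x) i x := fun i => by
    have h1 : Measurable fun t : ℕ × Eucl d => q t.1 i t.2 :=
      measurable_from_prod_countable_right fun R => (Lp.stronglyMeasurable (q R i)).measurable
    exact h1.comp (hrho.prodMk measurable_id)
  let M : Eucl d → Eucl d →L[ℝ] Eucl d := fun x =>
    ∑ i, (innerSL ℝ (q (rho x) i x)).smulRight (e i)
  have hMm : Measurable M := by
    have hc : Continuous fun Q : Fin d → Eucl d =>
        ∑ i, (innerSL ℝ (Q i)).smulRight (e i) := by
      refine continuous_finsetSum _ fun i _ => ?_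
      have : Continuous fun t : Eucl d => (innerSL ℝ t).smulRight (e i) :=
        ((ContinuousLinearMap.smulRightL ℝ (Eucl d) (Eucl d)).flip (e i)).continuous.comp
          (innerSL ℝ (E := Eucl d)).continuous
      exact this.comp (continuous_apply i)
    exact hc.measurable.comp (measurable_pi_lambda _ hqm)
  have hMi : ∀ x ξ i, M x ξ i = inner ℝ (q (rho x) i x) ξ := by
    intro x ξ i
    simp [M, e, Finset.sum_apply, Pi.single_apply]
  have hflux : ∀ (Ω : Set (Eucl d)), IsOpen Ω → ∀ (u : ℕ → WPair d) (v : WPair d)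
      (D : L2Rd d (Eucl d)), GradConv l u v → DivConv l Ω (fun k => (a k).op (u k).snd) D →
      ∀ᵐ x, x ∈ Ω → D x = M x (v.snd x) := by
    intro Ω hΩ u v D hu hD
    have h1 : ∀ (R : ℕ) (i : Fin d), ∀ᵐ x, x ∈ Ω → x ∈ Metric.ball (0 : Eucl d) (R + 1) →
        D x i = inner ℝ (q R i x) (v.snd x) := by
      intro R i
      filter_upwards [ae_duality hΩ isOpen_univ hu (hw R i) hD (hq R i), hpR R (e i)]
        with x h2 h3 hxΩ hxR
      rw [← h2 ⟨hxΩ, trivial⟩, h3 hxR]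
      simp [e, EuclideanSpace.inner_single_right]
    filter_upwards [ae_all_iff.2 fun R => ae_all_iff.2 (h1 R)] with x hx hxΩ
    ext i
    rw [hMi]
    refine hx (rho x) i hxΩ (mem_ball_zero_iff.2 ?_)
    have := Nat.le_ceil ‖x‖
    simp only [rho]
    linarith
  have hMell : ∀ᵐ x, Ell α β (M x) := by
    obtain ⟨s, hsc, hsd⟩ := TopologicalSpace.exists_countable_dense (Eucl d)
    have h1 : ∀ ξ ∈ s, ∀ᵐ x, α * ‖ξ‖ ^ 2 ≤ inner ℝ (M x ξ) ξ ∧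
        ‖M x ξ‖ ^ 2 ≤ β * inner ℝ (M x ξ) ξ := by
      intro ξ _
      refine ae_forall_of_forall_ball fun R => ?_
      obtain ⟨u, D, hu, hD⟩ := exists_recovery_ell l a hα hβ hE (hp R ξ)
      filter_upwards [ae_energy hE isOpen_univ hu hD hα, hflux _ isOpen_univ _ _ _ hu hD,
        hpR R ξ] with x h2 h3 h4 hxR
      have h5 := h2 trivial
      rwa [h3 trivial, h4 hxR] at h5
    filter_upwards [(ae_ball_iff hsc).2 h1] with x hx
    exact ell_of_dense hsd hx
  classical
  let abar : Eucl d → Eucl d →L[ℝ] Eucl d := fun x =>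
    if Ell α β (M x) then M x else α • ContinuousLinearMap.id ℝ (Eucl d)
  have habar : ∀ x, Ell α β (abar x) := fun x => by
    simp only [abar]
    split_ifs with h
    · exact h
    · exact ell_smul_id hα hαβ
  have hm : Measurable abar :=
    Measurable.ite (hMm (isClosed_ell α β).measurableSet) hMm measurable_const
  refine ⟨⟨abar, hm.stronglyMeasurable, β, fun x => (habar x).norm_le hβ.le⟩, habar, ?_⟩
  intro Ω hΩ u v D hu hD
  filter_upwards [hflux Ω hΩ u v D hu hD, hMell] with x h1 h2 hx
  rw [h1 hx]
  simp only [abar, if_pos h2]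

/-- `H`-convergence is stable under transposition. -/
theorem IsHLim.adj {l : Ultrafilter ℕ} {a : ℕ → BField d (Eucl d) (Eucl d)} {α β : ℝ}
    (hα : 0 < α) (hβ : 0 < β) (hE : ∀ k x, Ell α β (a k x))
    {abar : BField d (Eucl d) (Eucl d)} (h : IsHLim l a abar) :
    IsHLim l (fun k => (a k).adj) abar.adj := by
  intro Ω hΩ w z Q hw hQ
  choose p hp hpR using fun R : ℕ => fun ξ : Eucl d =>
    exists_affine (d := d) ((R : ℝ) + 1) (by positivity) ξ
  let e : Fin d → Eucl d := fun i => EuclideanSpace.single i 1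
  have h1 : ∀ i, ∀ᵐ x, x ∈ Ω → inner ℝ (Q x) (e i) = inner ℝ (abar.adj x (z.snd x)) (e i) := by
    intro i
    refine ae_forall_of_forall_ball fun R => ?_
    obtain ⟨u, D, hu, hD⟩ := exists_recovery_ell l a hα hβ hE (hp R (e i))
    filter_upwards [ae_duality isOpen_univ hΩ hu hw hD hQ, h _ isOpen_univ _ _ _ hu hD,
      hpR R (e i)] with x h2 h3 h4 hxR hxΩ
    have h5 := h2 ⟨trivial, hxΩ⟩
    rw [h3 trivial, h4 hxR] at h5
    rw [← h5, BField.adj_apply, ContinuousLinearMap.adjoint_inner_left, real_inner_comm]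
  filter_upwards [ae_all_iff.2 h1] with x hx hxΩ
  ext i
  simpa [e, EuclideanSpace.inner_single_right] using hx i hxΩ

theorem norm_le_of_inner_le {T : Eucl d →L[ℝ] Eucl d} {c : ℝ} (hc : 0 ≤ c) {s : Set (Eucl d)}
    (hs : Dense s) (h : ∀ ξ ∈ s, ∀ ζ ∈ s, inner ℝ (T ξ) ζ ≤ c / 2 * (‖ξ‖ ^ 2 + ‖ζ‖ ^ 2)) :
    ‖T‖ ≤ c := by
  have h1 : ∀ ξ ζ : Eucl d, inner ℝ (T ξ) ζ ≤ c / 2 * (‖ξ‖ ^ 2 + ‖ζ‖ ^ 2) := by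
    have hcl : IsClosed {t : Eucl d × Eucl d |
        inner ℝ (T t.1) t.2 ≤ c / 2 * (‖t.1‖ ^ 2 + ‖t.2‖ ^ 2)} :=
      isClosed_le (by fun_prop) (by fun_prop)
    intro ξ ζ
    exact closure_minimal (s := s ×ˢ s) (fun t ht => h _ ht.1 _ ht.2) hcl
      ((hs.prod hs) (ξ, ζ))
  refine T.opNorm_le_of_unit_norm hc fun ξ hξ => ?_
  rcases eq_or_ne (T ξ) 0 with h0 | h0
  · rw [h0, norm_zero]; exact hc
  · have h2 := h1 ξ (‖T ξ‖⁻¹ • T ξ)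
    have h3 : ‖T ξ‖ ≠ 0 := norm_ne_zero_iff.2 h0
    rw [norm_smul, norm_inv, norm_norm, inv_mul_cancel₀ h3, hξ, inner_smul_right,
      real_inner_self_eq_norm_sq, pow_two, inv_mul_cancel_left₀ h3] at h2
    linarith

/-- Local Lipschitz dependence of the `H`-limit on the coefficients. -/
theorem IsHLim.ae_norm_sub_le {l : Ultrafilter ℕ} {a c : ℕ → BField d (Eucl d) (Eucl d)} {α β : ℝ}
    (hα : 0 < α) (hβ : 0 < β) (hE : ∀ k x, Ell α β (a k x)) (hE' : ∀ k x, Ell α β (c k x))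
    {abar cbar : BField d (Eucl d) (Eucl d)} (h : IsHLim l a abar) (h' : IsHLim l c cbar)
    (hb : ∀ x, ‖abar x‖ ≤ β) (hb' : ∀ x, ‖cbar x‖ ≤ β) {U : Set (Eucl d)} (hU : IsOpen U) {s : ℝ}
    (hs : 0 ≤ s) (hac : ∀ᶠ k in (l : Filter ℕ), ∀ x ∈ U, ‖a k x - c k x‖ ≤ s) :
    ∀ᵐ x, x ∈ U → ‖abar x - cbar x‖ ≤ s * β / α := by
  obtain ⟨S, hSc, hSd⟩ := TopologicalSpace.exists_countable_dense (Eucl d)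
  choose p hp hpR using fun R : ℕ => fun ξ : Eucl d =>
    exists_affine (d := d) ((R : ℝ) + 1) (by positivity) ξ
  have hIntg : ∀ g h : L2Rd d (Eucl d), Integrable fun x => (inner ℝ (g x) (h x) : ℝ) :=
    fun g h => L2.integrable_inner g h
  have h1 : ∀ ξ ∈ S, ∀ ζ ∈ S, ∀ᵐ x, x ∈ U →
      inner ℝ ((abar x - cbar x) ξ) ζ ≤ (s * β / α) / 2 * (‖ξ‖ ^ 2 + ‖ζ‖ ^ 2) := by
    intro ξ _ ζ _
    refine ae_forall_of_forall_ball fun R => ?_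
    obtain ⟨u, D, hu, hD⟩ := exists_recovery_ell l a hα hβ hE (hp R ξ)
    obtain ⟨w, Q, hw, hQ⟩ := exists_recovery_adj l c hα hβ hE' (hp R ζ)
    have key : ∀ᵐ x, x ∈ U → inner ℝ (D x) ((p R ζ).snd x) - inner ℝ (Q x) ((p R ξ).snd x) ≤
        s / (2 * α) * (inner ℝ (D x) ((p R ξ).snd x) + inner ℝ (Q x) ((p R ζ).snd x)) := by
      refine ae_le_of_forall_isTest hU ((hIntg _ _).sub (hIntg _ _))
        (((hIntg _ _).add (hIntg _ _)).const_mul _) fun φ hφ h0 => ?_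
      have e1 := (hD.tendsto_inner hw hφ.univ).sub (hQ.tendsto_inner hu hφ.univ)
      have e2 := ((hD.tendsto_inner hu hφ.univ).add (hQ.tendsto_inner hw hφ.univ)).const_mul
        (s / (2 * α))
      have hsub : ∀ g g' E E' : L2Rd d (Eucl d),
          ∫ x, φ x * (inner ℝ (g x) (g' x) - inner ℝ (E x) (E' x)) =
          inner ℝ ((hφ.univ.field (Eucl d)).op g) g' -
            inner ℝ ((hφ.univ.field (Eucl d)).op E) E' := fun g g' E E' => by
        rw [hφ.univ.inner_field_op, hφ.univ.inner_field_op]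
        simp only [mul_sub]
        exact integral_sub (hφ.integrable_mul (hIntg _ _)) (hφ.integrable_mul (hIntg _ _))
      have hadd : ∀ g g' E E' : L2Rd d (Eucl d),
          ∫ x, φ x * (s / (2 * α) * (inner ℝ (g x) (g' x) + inner ℝ (E x) (E' x))) =
          s / (2 * α) * (inner ℝ ((hφ.univ.field (Eucl d)).op g) g' +
            inner ℝ ((hφ.univ.field (Eucl d)).op E) E') := fun g g' E E' => by
        rw [hφ.univ.inner_field_op, hφ.univ.inner_field_op,
          ← integral_add (hφ.integrable_mul (hIntg _ _)) (hφ.integrable_mul (hIntg _ _)),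
          ← integral_const_mul]
        refine integral_congr_ae (Eventually.of_forall fun x => ?_)
        ring
      rw [hsub, hadd]
      refine le_of_tendsto_of_tendsto e1 e2 ?_
      filter_upwards [hac] with k hk
      rw [← hsub, ← hadd]
      refine hφ.integral_mul_mono h0 ((hIntg _ _).sub (hIntg _ _))
        (((hIntg _ _).add (hIntg _ _)).const_mul _) ?_
      filter_upwards [(a k).coeFn_op (u k).snd, (c k).adj.coeFn_op (w k).snd] with x f1 f2 hx
      rw [f1, f2, BField.adj_apply, ContinuousLinearMap.adjoint_inner_left,
        ContinuousLinearMap.adjoint_inner_left, real_inner_comm (c k x ((u k).snd x)),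
        ← inner_sub_left, ← _root_.sub_apply]
      have g1 := (hE k x ((u k).snd x)).1
      have g2 := (hE' k x ((w k).snd x)).1
      rw [real_inner_comm] at g2
      have g3 : inner ℝ ((a k x - c k x) ((u k).snd x)) ((w k).snd x) ≤
          s * (‖(u k).snd x‖ * ‖(w k).snd x‖) := by
        refine (real_inner_le_norm _ _).trans ?_
        rw [← mul_assoc]
        gcongr
        exact ((a k x - c k x).le_opNorm _).trans (by gcongr; exact hk x hx)
      refine g3.trans ?_
      have g4 : ‖(u k).snd x‖ * ‖(w k).snd x‖ ≤
          (‖(u k).snd x‖ ^ 2 + ‖(w k).snd x‖ ^ 2) / 2 := by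
        nlinarith [sq_nonneg (‖(u k).snd x‖ - ‖(w k).snd x‖)]
      calc s * (‖(u k).snd x‖ * ‖(w k).snd x‖)
          ≤ s * ((‖(u k).snd x‖ ^ 2 + ‖(w k).snd x‖ ^ 2) / 2) := by gcongr
        _ = s / (2 * α) * (α * ‖(u k).snd x‖ ^ 2 + α * ‖(w k).snd x‖ ^ 2) := by
            field_simp
        _ ≤ _ := by gcongr
    filter_upwards [key, h _ isOpen_univ _ _ _ hu hD,
      (h'.adj hα hβ hE') _ isOpen_univ _ _ _ hw hQ, hpR R ξ, hpR R ζ] with x k1 k2 k3 k4 k5 hxR hxU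
    have k6 := k1 hxU
    rw [k2 trivial, k3 trivial, k4 hxR, k5 hxR, BField.adj_apply,
      ContinuousLinearMap.adjoint_inner_left, ContinuousLinearMap.adjoint_inner_left,
      real_inner_comm (cbar x ξ), ← inner_sub_left, ← _root_.sub_apply] at k6
    refine k6.trans ?_
    have k7 : inner ℝ (abar x ξ) ξ ≤ β * ‖ξ‖ ^ 2 := by
      refine (real_inner_le_norm _ _).trans ?_
      rw [pow_two, ← mul_assoc]
      gcongr
      exact ((abar x).le_opNorm _).trans (by gcongr; exact hb x)
    have k8 : inner ℝ ζ (cbar x ζ) ≤ β * ‖ζ‖ ^ 2 := by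
      rw [real_inner_comm]
      refine (real_inner_le_norm _ _).trans ?_
      rw [pow_two, ← mul_assoc]
      gcongr
      exact ((cbar x).le_opNorm _).trans (by gcongr; exact hb' x)
    calc _ ≤ s / (2 * α) * (β * ‖ξ‖ ^ 2 + β * ‖ζ‖ ^ 2) := by gcongr
      _ = _ := by field_simp
  have h2 : ∀ᵐ x, ∀ ξ ∈ S, ∀ ζ ∈ S, x ∈ U →
      inner ℝ ((abar x - cbar x) ξ) ζ ≤ (s * β / α) / 2 * (‖ξ‖ ^ 2 + ‖ζ‖ ^ 2) :=
    (ae_ball_iff hSc).2 fun ξ hξ => (ae_ball_iff hSc).2 fun ζ hζ => h1 ξ hξ ζ hζ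
  filter_upwards [h2] with x hx hxU
  exact norm_le_of_inner_le (by positivity) hSd fun ξ hξ ζ hζ => hx ξ hξ ζ hζ hxU

end HLimit

section Translation

variable {d : ℕ}

theorem GradConv.shift {l : Filter ℕ} {u : ℕ → WPair d} {v : WPair d} (hu : GradConv l u v)
    {h : ℕ → Eucl d} {h' : Eucl d} (hh : Tendsto h l (𝓝 h')) :
    GradConv l (fun k => shiftPair (h k) (u k)) (shiftPair h' v) :=
  ⟨fun k => shiftPair_mem _ (hu.mem k), shiftPair_mem _ hu.mem_lim,
    WeakLim.pair (hu.lim.fst.shift hh) (hu.lim.snd.shift hh)⟩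

theorem IsTest.mulPair_eq_self {Ω : Set (Eucl d)} {χ : Eucl d → ℝ} (hχ : IsTest Ω χ)
    {K : Set (Eucl d)} (hK : ∀ x ∈ K, χ =ᶠ[𝓝 x] fun _ => 1) {q : WPair d}
    (hq : ∀ᵐ x, x ∉ K → q.fst x = 0 ∧ q.snd x = 0) : hχ.mulPair q = q := by
  have h1 : (hχ.field ℝ).op q.fst = q.fst := by
    apply Lp.ext
    filter_upwards [hq, (hχ.field ℝ).coeFn_op q.fst] with x a1 a2
    rw [a2, hχ.field_apply]
    by_cases hx : x ∈ K
    · rw [(hK x hx).self_of_nhds, one_smul]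
    · rw [(a1 hx).1, smul_zero]
  have h2 : (hχ.field (Eucl d)).op q.snd + hχ.gradField.op q.fst = q.snd := by
    apply Lp.ext
    filter_upwards [hq, (hχ.field (Eucl d)).coeFn_op q.snd, hχ.gradField.coeFn_op q.fst,
      Lp.coeFn_add ((hχ.field (Eucl d)).op q.snd) (hχ.gradField.op q.fst)] with x a1 a2 a3 a4
    rw [a4, Pi.add_apply, a2, a3, hχ.field_apply, hχ.gradField_apply]
    by_cases hx : x ∈ K
    · rw [(hK x hx).self_of_nhds, one_smul, (hK x hx).gradient_eq, gradient_fun_const,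
        smul_zero, add_zero]
    · rw [(a1 hx).1, (a1 hx).2, smul_zero, zero_smul, add_zero]
  change WithLp.toLp 2 ((hχ.field ℝ).op q.fst,
    (hχ.field (Eucl d)).op q.snd + hχ.gradField.op q.fst) = q
  rw [h1, h2]
  rfl

theorem IsTest.ae_mulPair_eq_zero {Ω : Set (Eucl d)} {φ : Eucl d → ℝ} (hφ : IsTest Ω φ)
    (p : WPair d) :
    ∀ᵐ x, x ∉ tsupport φ → (hφ.mulPair p).fst x = 0 ∧ (hφ.mulPair p).snd x = 0 := by
  filter_upwards [(hφ.field ℝ).coeFn_op p.fst, (hφ.field (Eucl d)).coeFn_op p.snd,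
    hφ.gradField.coeFn_op p.fst,
    Lp.coeFn_add ((hφ.field (Eucl d)).op p.snd) (hφ.gradField.op p.fst)] with x a1 a2 a3 a4 hx
  have h3 : φ =ᶠ[𝓝 x] fun _ => 0 := notMem_tsupport_iff_eventuallyEq.1 hx
  rw [hφ.mulPair_fst, hφ.mulPair_snd, a1, a4, Pi.add_apply, a2, a3, hφ.field_apply,
    hφ.field_apply, hφ.gradField_apply, h3.gradient_eq, gradient_fun_const, h3.self_of_nhds]
  simp

theorem DivConv.shift {l : Filter ℕ} {D : ℕ → L2Rd d (Eucl d)} {D' : L2Rd d (Eucl d)}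
    (hD : DivConv l Set.univ D D') {h : ℕ → Eucl d} {h' : Eucl d} (hh : Tendsto h l (𝓝 h')) :
    DivConv l Set.univ (fun k => _root_.shift (Eucl d) (h k) (D k))
      (_root_.shift (Eucl d) h' D') := by
  refine ⟨hD.lim.shift hh, fun {φ} hφ {w w'} hw => ?_⟩
  obtain ⟨R, hR0, hR⟩ := hφ.compact.isCompact.isBounded.exists_pos_norm_lt
  set R' : ℝ := R + (‖h'‖ + 1) with hR'
  obtain ⟨χ, hχ, hχ1, -⟩ := exists_isTest_ball (d := d) R' (by positivity)
  have hz := (hw.mulPair hφ).shift hh.neg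
  have hcut : ∀ (a : Eucl d), ‖a‖ ≤ ‖h'‖ + 1 → ∀ p : WPair d,
      hχ.mulPair (shiftPair (-a) (hφ.mulPair p)) = shiftPair (-a) (hφ.mulPair p) := by
    intro a ha p
    refine hχ.mulPair_eq_self (K := {x | x + -a ∈ tsupport φ}) (fun x hx => hχ1 x ?_) ?_
    · have h1 := hR _ hx
      rw [mem_ball_zero_iff]
      calc ‖x‖ = ‖(x + -a) + a‖ := by simp
        _ ≤ ‖x + -a‖ + ‖a‖ := norm_add_le _ _
        _ < R' := by linarith
    · have hq := (measurePreserving_add_right (volume : Measure (Eucl d))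
        (-a)).quasiMeasurePreserving
      filter_upwards [hq.ae (hφ.ae_mulPair_eq_zero p), coeFn_shift (-a) (hφ.mulPair p).fst,
        coeFn_shift (-a) (hφ.mulPair p).snd] with x a1 a2 a3 hx
      rw [shiftPair_fst, shiftPair_snd, a2, a3]
      exact a1 hx
  have e1 := hD.div hχ hz
  rw [hcut h' (by linarith), shiftPair_snd, ← inner_shift] at e1
  refine e1.congr' ?_
  filter_upwards [hh.norm.eventually_le_const (lt_add_one ‖h'‖)] with k hk
  rw [hcut (h k) hk, shiftPair_snd, ← inner_shift]

/-- The `H`-limit inherits asymptotic periods. -/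
theorem IsHLim.ae_shift_eq {l : Ultrafilter ℕ} {c : ℕ → BField d (Eucl d) (Eucl d)} {α β : ℝ}
    (hα : 0 < α) (hβ : 0 < β) (hE : ∀ k x, Ell α β (c k x))
    {cbar : BField d (Eucl d) (Eucl d)} (hc : IsHLim l c cbar)
    {h : ℕ → Eucl d} {h' : Eucl d} (hh : Tendsto h l (𝓝 h'))
    (hs : ∀ ε > 0, ∀ᶠ k in (l : Filter ℕ), ∀ x, ‖c k (x + h k) - c k x‖ ≤ ε) :
    ∀ᵐ x, cbar (x + h') = cbar x := by
  choose p hp hpR using fun R : ℕ => fun ξ : Eucl d =>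
    exists_affine (d := d) ((R : ℝ) + 1) (by positivity) ξ
  let e : Fin d → Eucl d := fun i => EuclideanSpace.single i 1
  have hq := (measurePreserving_add_right (volume : Measure (Eucl d)) h').quasiMeasurePreserving
  have h1 : ∀ (i j : Fin d) (R : ℕ), ∀ᵐ x, x ∈ Metric.ball (0 : Eucl d) (R + 1) →
      x + h' ∈ Metric.ball (0 : Eucl d) (R + 1) →
      inner ℝ (cbar (x + h') (e i)) (e j) = inner ℝ (cbar x (e i)) (e j) := by
    intro i j R
    obtain ⟨u, D, hu, hD⟩ := exists_recovery_ell l c hα hβ hE (hp R (e i))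
    obtain ⟨w, Q, hw, hQ⟩ := exists_recovery_adj l c hα hβ hE (hp R (e j))
    have hu' := hu.shift hh
    have hD' := hD.shift hh
    have key : ∀ᵐ x, x ∈ Set.univ →
        inner ℝ (_root_.shift (Eucl d) h' D x) ((p R (e j)).snd x) =
          inner ℝ (Q x) ((shiftPair h' (p R (e i))).snd x) := by
      refine ae_eq_of_forall_isTest isOpen_univ (L2.integrable_inner _ _)
        (L2.integrable_inner _ _) fun φ hφ => ?_
      rw [← hφ.inner_field_op, ← hφ.inner_field_op, ← sub_eq_zero]
      refine tendsto_nhds_unique ((hD'.tendsto_inner hw hφ).sub (hQ.tendsto_inner hu' hφ)) ?_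
      obtain ⟨Cφ, hCφ0, hCφ⟩ := (hφ.field (Eucl d)).exists_bound
      obtain ⟨C, hC0, hC⟩ := hu.lim.snd.bound
      obtain ⟨C', hC0', hC'⟩ := hw.lim.snd.bound
      rw [Metric.tendsto_nhds]
      intro ε hε
      filter_upwards [hs (ε / (2 * (Cφ * C * C'))) (by positivity)] with k hk
      set c' := (c k).precomp (· + h k) (measurable_add_const (h k)) with hc'
      have f1 : _root_.shift (Eucl d) (h k) ((c k).op (u k).snd) =
          c'.op (shiftPair (h k) (u k)).snd := shift_op _ _ _
      rw [← hφ.inner_field_op_op (c k), f1, ← inner_sub_left, ← map_sub, ← BField.sub_op,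
        dist_zero_right]
      have f2 : ‖(c' - c k).op (shiftPair (h k) (u k)).snd‖ ≤ ε / (2 * (Cφ * C * C')) * C := by
        refine ((c' - c k).norm_op_le hk _).trans ?_
        rw [shiftPair_snd, LinearIsometry.norm_map]
        gcongr
        exact hC k
      calc _ ≤ ‖(hφ.field (Eucl d)).op ((c' - c k).op (shiftPair (h k) (u k)).snd)‖ *
            ‖(w k).snd‖ := norm_inner_le_norm _ _
        _ ≤ (Cφ * (ε / (2 * (Cφ * C * C')) * C)) * C' := by
            gcongr
            · exact ((hφ.field (Eucl d)).norm_op_le hCφ _).trans (by gcongr)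
            · exact hC' k
        _ = ε / 2 := by field_simp
        _ < ε := by linarith
    filter_upwards [key, hq.ae (hc _ isOpen_univ _ _ _ hu hD),
      (hc.adj hα hβ hE) _ isOpen_univ _ _ _ hw hQ, hq.ae (hpR R (e i)), hpR R (e j),
      coeFn_shift h' D, coeFn_shift h' (p R (e i)).snd] with x k1 k2 k3 k4 k5 k6 k7 hx hxh
    have k8 := k1 trivial
    rwa [k6, shiftPair_snd, k7, k2 trivial, k3 trivial, k4 hxh, k5 hx, BField.adj_apply,
      ContinuousLinearMap.adjoint_inner_left, real_inner_comm (cbar x (e i))] at k8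
  have h2 := ae_all_iff.2 fun i => ae_all_iff.2 fun j => ae_all_iff.2 (h1 i j)
  filter_upwards [h2] with x hx
  have h3 : ∀ i j, inner ℝ (cbar (x + h') (e i)) (e j) = inner ℝ (cbar x (e i)) (e j) := by
    intro i j
    refine hx i j (⌈‖x‖⌉₊ + ⌈‖x + h'‖⌉₊) (mem_ball_zero_iff.2 ?_) (mem_ball_zero_iff.2 ?_)
    · have := Nat.le_ceil ‖x‖
      push_cast
      have h5 : (0 : ℝ) ≤ ⌈‖x + h'‖⌉₊ := by positivity
      linarith
    · have := Nat.le_ceil ‖x + h'‖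
      push_cast
      have h5 : (0 : ℝ) ≤ ⌈‖x‖⌉₊ := by positivity
      linarith
  have h4 : ∀ i, cbar (x + h') (e i) = cbar x (e i) := by
    intro i
    ext j
    simpa [e, EuclideanSpace.inner_single_right] using h3 i j
  refine ContinuousLinearMap.coe_injective ?_
  refine (EuclideanSpace.basisFun (Fin d) ℝ).toBasis.ext fun i => ?_
  simpa [e] using h4 i

/-- A measurable field invariant under all translations is constant. -/
theorem exists_ae_eq_const_of_shift {cbar : BField d (Eucl d) (Eucl d)}
    (h : ∀ h', ∀ᵐ x, cbar (x + h') = cbar x) : ∃ x₀, ∀ᵐ x, cbar x = cbar x₀ := by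
  have hm : MeasurableSet {q : Eucl d × Eucl d | cbar (q.1 + q.2) = cbar q.1} := by
    refine measurableSet_eq_fun ?_ ?_
    · exact cbar.sm.measurable.comp (measurable_fst.add measurable_snd)
    · exact cbar.sm.measurable.comp measurable_fst
  have h1 : ∀ᵐ x, ∀ᵐ h', cbar (x + h') = cbar x :=
    (Measure.ae_ae_comm hm).2 (Eventually.of_forall h)
  obtain ⟨x₀, hx₀⟩ := h1.exists
  refine ⟨x₀, ?_⟩
  have hq := (measurePreserving_add_right (volume : Measure (Eucl d)) (-x₀)).quasiMeasurePreserving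
  filter_upwards [hq.ae hx₀] with x hx
  rw [← hx]
  congr 1
  abel

end Translation

section Kronecker

variable {ι : Type*} [Fintype ι]

/-- The Haar probability measure of the torus. -/
noncomputable def torusHaar (ι : Type*) [Fintype ι] : Measure (UnitAddTorus ι) :=
  Measure.pi fun _ => AddCircle.haarAddCircle

instance : IsProbabilityMeasure (torusHaar ι) := by unfold torusHaar; infer_instance

instance : (torusHaar ι).IsOpenPosMeasure := by unfold torusHaar; infer_instance

theorem integral_mFourier_of_ne {z : ι → ℤ} (hz : z ≠ 0) :
    ∫ t, UnitAddTorus.mFourier z t ∂torusHaar ι = 0 := by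
  obtain ⟨i, hi⟩ := Function.ne_iff.1 hz
  simp only [UnitAddTorus.mFourier, ContinuousMap.coe_mk, torusHaar]
  rw [integral_fintype_prod_eq_prod (f := fun i (x : UnitAddCircle) => fourier (z i) x)]
  refine Finset.prod_eq_zero (Finset.mem_univ i) ?_
  exact integral_eq_zero_of_add_right_eq_neg (fourier_add_half_inv_index hi one_pos)

/-- The point `s fr` of the torus. -/
noncomputable def torusLine (fr : ι → ℝ) (s : ℝ) : UnitAddTorus ι :=
  fun j => ((s * fr j : ℝ) : UnitAddCircle)

theorem continuous_torusLine {ι : Type*} (fr : ι → ℝ) : Continuous (torusLine fr) :=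
  continuous_pi fun j => (AddCircle.continuous_mk' 1).comp (by fun_prop)

theorem mFourier_torusLine (z : ι → ℤ) (fr : ι → ℝ) (s : ℝ) :
    UnitAddTorus.mFourier z (torusLine fr s) =
      Complex.exp ((2 * Real.pi * ∑ j, z j * fr j : ℝ) * Complex.I * s) := by
  simp only [UnitAddTorus.mFourier, ContinuousMap.coe_mk, torusLine, fourier_coe_apply]
  rw [← Complex.exp_sum]
  congr 1
  push_cast
  rw [Finset.mul_sum, Finset.sum_mul, Finset.sum_mul]
  refine Finset.sum_congr rfl fun j _ => ?_
  ring

theorem norm_integral_exp_le {c : ℝ} (hc : c ≠ 0) (r : ℝ) :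
    ‖∫ s in (-r)..r, Complex.exp ((c : ℂ) * Complex.I * s)‖ ≤ 2 / |c| := by
  have hc' : (c : ℂ) * Complex.I ≠ 0 := mul_ne_zero (by exact_mod_cast hc) Complex.I_ne_zero
  rw [integral_exp_mul_complex hc', norm_div]
  have h1 : ∀ s : ℝ, ‖Complex.exp ((c : ℂ) * Complex.I * s)‖ = 1 := fun s => by
    have : (c : ℂ) * Complex.I * s = ((c * s : ℝ) : ℂ) * Complex.I := by push_cast; ring
    rw [this, Complex.norm_exp_ofReal_mul_I]
  have h2 : ‖(c : ℂ) * Complex.I‖ = |c| := by simp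
  rw [h2]
  gcongr
  refine (norm_sub_le _ _).trans ?_
  rw [h1, h1]
  norm_num

/-- Equidistribution on short segments of lines in the torus whose directions satisfy no bounded
integer relation. -/
theorem tendsto_average_torusLine {l : Filter ℕ} {fr : ℕ → ι → ℝ}
    (hfr : ∀ z : ι → ℤ, z ≠ 0 → Tendsto (fun k => |∑ j, z j * fr k j|) l atTop) {r : ℝ} (hr : 0 < r)
    (f : C(UnitAddTorus ι, ℂ)) :
    Tendsto (fun k => (2 * r : ℂ)⁻¹ * ∫ s in (-r)..r, f (torusLine (fr k) s)) l
      (𝓝 (∫ t, f t ∂torusHaar ι)) := by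
  have hIntg : ∀ (g : C(UnitAddTorus ι, ℂ)) k,
      IntervalIntegrable (fun s => g (torusLine (fr k) s)) volume (-r) r := fun g k =>
    (g.continuous.comp (continuous_torusLine _)).intervalIntegrable _ _
  have hIntg' : ∀ g : C(UnitAddTorus ι, ℂ), Integrable g (torusHaar ι) := fun g =>
    Integrable.of_bound g.continuous.aestronglyMeasurable ‖g‖
      (Eventually.of_forall g.norm_coe_le_norm)
  have hr' : (2 * r : ℂ) ≠ 0 := by
    exact_mod_cast (mul_pos two_pos hr).ne'
  have hspan : ∀ g ∈ Submodule.span ℂ (Set.range (UnitAddTorus.mFourier (d := ι))),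
      Tendsto (fun k => (2 * r : ℂ)⁻¹ * ∫ s in (-r)..r, g (torusLine (fr k) s)) l
      (𝓝 (∫ t, g t ∂torusHaar ι)) := by
    intro g hg
    induction hg using Submodule.span_induction with
    | mem g hg =>
      obtain ⟨z, rfl⟩ := hg
      rcases eq_or_ne z 0 with rfl | hz
      · simp only [UnitAddTorus.mFourier_zero, ContinuousMap.one_apply,
          intervalIntegral.integral_const, integral_const, probReal_univ, one_smul]
        have : (2 * r : ℂ)⁻¹ * ((r - -r) • (1 : ℂ)) = 1 := by
          rw [Complex.real_smul, mul_one]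
          push_cast
          rw [sub_neg_eq_add, ← two_mul, inv_mul_cancel₀ hr']
        rw [this]
        exact tendsto_const_nhds
      · rw [integral_mFourier_of_ne hz]
        simp only [mFourier_torusLine]
        have h1 : Tendsto (fun k => (2 * r)⁻¹ * (2 / (2 * Real.pi * |∑ j, z j * fr k j|))) l
            (𝓝 0) := by
          have h2 := ((hfr z hz).const_mul_atTop (mul_pos two_pos Real.pi_pos)).inv_tendsto_atTop
          have h3 := (h2.const_mul 2).const_mul (2 * r)⁻¹
          simpa [div_eq_mul_inv] using h3
        refine squeeze_zero_norm' ?_ h1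
        filter_upwards [(hfr z hz).eventually_gt_atTop 0] with k hk
        have hne : 2 * Real.pi * ∑ j, z j * fr k j ≠ 0 :=
          mul_ne_zero (by positivity) (abs_pos.1 hk)
        rw [norm_mul]
        have h4 := norm_integral_exp_le hne r
        rw [abs_mul, abs_of_pos (by positivity : 0 < 2 * Real.pi)] at h4
        have h5 : ‖(2 * r : ℂ)⁻¹‖ = (2 * r)⁻¹ := by
          rw [norm_inv, norm_mul, Complex.norm_real, Real.norm_of_nonneg hr.le]
          norm_num
        rw [h5]
        gcongr
    | zero => simpa using tendsto_const_nhds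
    | add g g' _ _ hg hg' =>
      have := hg.add hg'
      simp only [ContinuousMap.add_apply]
      rw [integral_add (hIntg' g) (hIntg' g')]
      refine this.congr fun k => ?_
      rw [intervalIntegral.integral_add (hIntg g k) (hIntg g' k)]
      ring
    | smul c g _ hg =>
      have := hg.const_mul c
      simp only [ContinuousMap.smul_apply, smul_eq_mul]
      rw [integral_const_mul]
      refine this.congr fun k => ?_
      rw [intervalIntegral.integral_const_mul]
      ring
  rw [Metric.tendsto_nhds]
  intro ε hε
  have hf : f ∈ (Submodule.span ℂ
      (Set.range (UnitAddTorus.mFourier (d := ι)))).topologicalClosure := by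
    rw [UnitAddTorus.span_mFourier_closure_eq_top]; trivial
  obtain ⟨g, hg, hfg⟩ := Metric.mem_closure_iff.1 hf (ε / 3) (by positivity)
  rw [dist_eq_norm] at hfg
  filter_upwards [Metric.tendsto_nhds.1 (hspan g hg) (ε / 3) (by positivity)] with k hk
  have e1 : ‖(2 * r : ℂ)⁻¹ * (∫ s in (-r)..r, f (torusLine (fr k) s)) -
      (2 * r : ℂ)⁻¹ * ∫ s in (-r)..r, g (torusLine (fr k) s)‖ ≤ ‖f - g‖ := by
    rw [← mul_sub, ← intervalIntegral.integral_sub (hIntg f k) (hIntg g k), norm_mul]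
    have h1 := intervalIntegral.norm_integral_le_of_norm_le_const (a := -r) (b := r)
      (f := fun s => f (torusLine (fr k) s) - g (torusLine (fr k) s)) (C := ‖f - g‖)
      fun s _ => (f - g).norm_coe_le_norm _
    rw [sub_neg_eq_add, ← two_mul, abs_of_pos (by positivity)] at h1
    have h5 : ‖(2 * r : ℂ)⁻¹‖ = (2 * r)⁻¹ := by
      rw [norm_inv, norm_mul, Complex.norm_real, Real.norm_of_nonneg hr.le]
      norm_num
    rw [h5, inv_mul_le_iff₀ (by positivity), mul_comm (2 * r)]
    exact h1
  have e2 : ‖∫ t, g t ∂torusHaar ι - ∫ t, f t ∂torusHaar ι‖ ≤ ‖f - g‖ := by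
    rw [← integral_sub (hIntg' g) (hIntg' f)]
    have := norm_integral_le_of_norm_le_const (μ := torusHaar ι) (f := fun t => g t - f t)
      (C := ‖f - g‖) (Eventually.of_forall fun t => by
        rw [norm_sub_rev]; exact (f - g).norm_coe_le_norm t)
    simpa using this
  rw [dist_eq_norm] at hk ⊢
  have e3 := norm_add_le (((2 * r : ℂ)⁻¹ * (∫ s in (-r)..r, f (torusLine (fr k) s)) -
      (2 * r : ℂ)⁻¹ * ∫ s in (-r)..r, g (torusLine (fr k) s)) +
      ((2 * r : ℂ)⁻¹ * (∫ s in (-r)..r, g (torusLine (fr k) s)) - ∫ t, g t ∂torusHaar ι))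
      (∫ t, g t ∂torusHaar ι - ∫ t, f t ∂torusHaar ι)
  rw [sub_add_sub_cancel, sub_add_sub_cancel] at e3
  have e4 := norm_add_le ((2 * r : ℂ)⁻¹ * (∫ s in (-r)..r, f (torusLine (fr k) s)) -
      (2 * r : ℂ)⁻¹ * ∫ s in (-r)..r, g (torusLine (fr k) s))
      ((2 * r : ℂ)⁻¹ * (∫ s in (-r)..r, g (torusLine (fr k) s)) - ∫ t, g t ∂torusHaar ι)
  rw [sub_add_sub_cancel] at e4
  linarith

/-- Asymptotic density of short segments of lines in the torus. -/
theorem eventually_exists_dist_torusLine {l : Filter ℕ} {fr : ℕ → ι → ℝ}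
    (hfr : ∀ z : ι → ℤ, z ≠ 0 → Tendsto (fun k => |∑ j, z j * fr k j|) l atTop) {r δ : ℝ}
    (hr : 0 < r) (hδ : 0 < δ) (θ : UnitAddTorus ι) :
    ∀ᶠ k in l, ∃ s : ℝ, |s| ≤ r ∧ dist (torusLine (fr k) s) θ < δ := by
  let f : UnitAddTorus ι → ℝ := fun t => max 0 (δ - dist t θ)
  have hf : Continuous f := by fun_prop
  let F : C(UnitAddTorus ι, ℂ) := ⟨fun t => (f t : ℂ), Complex.continuous_ofReal.comp hf⟩
  have hpos : 0 < ∫ t, f t ∂torusHaar ι := by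
    refine hf.integral_pos_of_hasCompactSupport_nonneg_nonzero
      (HasCompactSupport.of_compactSpace f) (fun t => le_max_left _ _) (x := θ) ?_
    simp only [f, dist_self, sub_zero]
    exact (lt_max_of_lt_right hδ).ne'
  have hne : ∫ t, F t ∂torusHaar ι ≠ 0 := by
    have : ∫ t, F t ∂torusHaar ι = ((∫ t, f t ∂torusHaar ι : ℝ) : ℂ) := integral_ofReal
    rw [this]
    exact_mod_cast hpos.ne'
  filter_upwards [(tendsto_average_torusLine hfr hr F).eventually_ne hne] with k hk
  by_contra! hcon
  apply hk
  have : ∫ s in (-r)..r, F (torusLine (fr k) s) = 0 := by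
    refine intervalIntegral.integral_zero_ae (Eventually.of_forall fun s hs => ?_)
    rw [Set.uIoc_of_le (by linarith)] at hs
    have := hcon s (abs_le.2 ⟨hs.1.le, hs.2⟩)
    simp only [F, ContinuousMap.coe_mk, f]
    rw [max_eq_left (by linarith)]
    simp
  rw [this, mul_zero]

theorem exists_int_abs_sub_le_norm (x : ℝ) : ∃ n : ℤ, |x - n| = ‖(x : UnitAddCircle)‖ :=
  ⟨round x, by rw [UnitAddCircle.norm_eq]⟩

/-- Every translation is asymptotically a period, up to a vanishing correction. -/
theorem exists_tendsto_almost_period {l : Ultrafilter ℕ} (hl : (l : Filter ℕ) ≤ atTop)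
    {fr : ℕ → ι → ℝ}
    (hfr : ∀ z : ι → ℤ, z ≠ 0 → Tendsto (fun k => |∑ j, z j * fr k j|) l atTop) (h : ℝ) :
    ∃ (s : ℕ → ℝ) (n : ℕ → ι → ℤ), Tendsto s l (𝓝 h) ∧
      ∀ j, Tendsto (fun k => s k * fr k j - n k j) l (𝓝 0) := by
  let Φ : ℕ → ℝ → ℝ := fun k s => |s| + ∑ j, ‖(((h - s) * fr k j : ℝ) : UnitAddCircle)‖
  have hΦ0 : ∀ k s, 0 ≤ Φ k s := fun k s => by positivity
  have hbdd : ∀ k, BddBelow (Set.range (Φ k)) := fun k => ⟨0, by rintro _ ⟨s, rfl⟩; exact hΦ0 k s⟩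
  have hlim : ∀ ε > 0, ∀ᶠ k in (l : Filter ℕ), ∃ s, Φ k s < ε := by
    intro ε hε
    obtain ⟨θ, -, hθ⟩ := isCompact_univ.ultrafilter_le_nhds
      (l.map fun k => torusLine (fr k) h) (by simp)
    have hθ' : Tendsto (fun k => torusLine (fr k) h) l (𝓝 θ) := hθ
    set δ : ℝ := ε / (4 * (Fintype.card ι + 1)) with hδ
    have hδ0 : 0 < δ := by positivity
    filter_upwards [eventually_exists_dist_torusLine hfr (half_pos hε) hδ0 θ,
      Metric.tendsto_nhds.1 hθ' δ hδ0] with k hk1 hk2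
    obtain ⟨s, hs, hsθ⟩ := hk1
    refine ⟨s, ?_⟩
    have h1 : ∀ j, ‖(((h - s) * fr k j : ℝ) : UnitAddCircle)‖ ≤ 2 * δ := by
      intro j
      have e1 : (((h - s) * fr k j : ℝ) : UnitAddCircle) =
          torusLine (fr k) h j - torusLine (fr k) s j := by
        simp only [torusLine]
        rw [← AddCircle.coe_sub, sub_mul]
      rw [e1, ← dist_eq_norm]
      have e2 := dist_triangle (torusLine (fr k) h j) (θ j) (torusLine (fr k) s j)
      have e3 := dist_le_pi_dist (torusLine (fr k) h) θ j
      have e4 := dist_le_pi_dist (torusLine (fr k) s) θ j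
      rw [dist_comm (θ j)] at e2
      linarith
    have h2 : ∑ j, ‖(((h - s) * fr k j : ℝ) : UnitAddCircle)‖ ≤ Fintype.card ι * (2 * δ) := by
      refine (Finset.sum_le_card_nsmul _ _ _ fun j _ => h1 j).trans ?_
      simp
    have h3 : (Fintype.card ι : ℝ) * (2 * δ) < ε / 2 := by
      have h4 : δ * (4 * (Fintype.card ι + 1)) = ε := by
        rw [hδ]; field_simp
      nlinarith
    simp only [Φ]
    linarith
  choose s hs using fun k => exists_lt_of_ciInf_lt (f := Φ k)
    (a := (⨅ t, Φ k t) + 1 / ((k : ℝ) + 1))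
    (lt_add_of_pos_right _ (by positivity))
  have hΦlim : Tendsto (fun k => Φ k (s k)) l (𝓝 0) := by
    have h0 : Tendsto (fun k : ℕ => 1 / ((k : ℝ) + 1)) l (𝓝 0) :=
      tendsto_one_div_add_atTop_nhds_zero_nat.mono_left hl
    rw [Metric.tendsto_nhds]
    intro ε hε
    filter_upwards [hlim (ε / 2) (half_pos hε), h0.eventually_lt_const (half_pos hε)] with k h1 h2
    obtain ⟨t, ht⟩ := h1
    rw [dist_zero_right, Real.norm_of_nonneg (hΦ0 k _)]
    have := hs k
    have := ciInf_le (hbdd k) t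
    linarith
  choose n hn using fun k j => exists_int_abs_sub_le_norm ((h - s k) * fr k j)
  refine ⟨fun k => h - s k, n, ?_, fun j => ?_⟩
  · have : Tendsto s l (𝓝 0) := by
      refine squeeze_zero_norm (fun k => ?_) hΦlim
      have : 0 ≤ ∑ j, ‖(((h - s k) * fr k j : ℝ) : UnitAddCircle)‖ :=
        Finset.sum_nonneg fun _ _ => norm_nonneg _
      simp only [Φ, Real.norm_eq_abs]
      linarith
    simpa using this.const_sub h
  · refine squeeze_zero_norm (fun k => ?_) hΦlim
    rw [Real.norm_eq_abs, hn]
    have := Finset.single_le_sum (f := fun j => ‖(((h - s k) * fr k j : ℝ) : UnitAddCircle)‖)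
      (fun _ _ => norm_nonneg _) (Finset.mem_univ j)
    have := abs_nonneg (s k)
    simp only [Φ]
    linarith

end Kronecker

section Lattice

/-- Splitting of frequencies: after a unimodular change of variables, the frequencies split into
convergent ones and ones without bounded integer relations. -/
theorem exists_frequency_splitting (l : Ultrafilter ℕ) {n : ℕ} (fr : ℕ → Fin n → ℝ) (i₀ : Fin n)
    (hfr : Tendsto (fun k => |fr k i₀|) l atTop) :
    ∃ (m N : ℕ) (_ : m ≤ n - 1) (P : Fin n → Fin m → ℤ) (Q : Fin n → Fin N → ℤ)
      (μ : ℕ → Fin m → ℝ) (ν : ℕ → Fin N → ℝ) (η : Fin m → ℝ),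
      (∀ k i, fr k i = ∑ a, P i a * μ k a + ∑ b, Q i b * ν k b) ∧
      (∀ a, Tendsto (fun k => μ k a) l (𝓝 (η a))) ∧
      (∀ z : Fin N → ℤ, z ≠ 0 → Tendsto (fun k => |∑ b, z b * ν k b|) l atTop) := by
  let L : ℕ → (Fin n → ℤ) →ₗ[ℤ] ℝ := fun k =>
    { toFun := fun z => ∑ i, z i * fr k i
      map_add' := fun z w => by
        rw [← Finset.sum_add_distrib]
        refine Finset.sum_congr rfl fun i _ => ?_
        push_cast [Pi.add_apply]
        ring
      map_smul' := fun c z => by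
        simp only [Pi.smul_apply, smul_eq_mul, zsmul_eq_mul, Finset.mul_sum, Int.cast_mul,
          eq_intCast, Int.cast_id, mul_assoc] }
  have hL : ∀ k z, L k z = ∑ i, z i * fr k i := fun _ _ => rfl
  let Γ : Submodule ℤ (Fin n → ℤ) :=
    { carrier := {z | ∃ C, ∀ᶠ k in (l : Filter ℕ), |L k z| ≤ C}
      add_mem' := by
        rintro z w ⟨C, hC⟩ ⟨C', hC'⟩
        refine ⟨C + C', ?_⟩
        filter_upwards [hC, hC'] with k h1 h2
        rw [map_add]
        exact (abs_add_le _ _).trans (add_le_add h1 h2)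
      zero_mem' := ⟨0, by simp⟩
      smul_mem' := by
        rintro c z ⟨C, hC⟩
        refine ⟨|(c : ℝ)| * C, ?_⟩
        filter_upwards [hC] with k h1
        rw [map_smul, zsmul_eq_mul, abs_mul]
        gcongr }
  have hΓ : ∀ z, z ∈ Γ ↔ ∃ C, ∀ᶠ k in (l : Filter ℕ), |L k z| ≤ C := fun _ => Iff.rfl
  have hnot : ∀ z, z ∉ Γ → Tendsto (fun k => |L k z|) l atTop := by
    intro z hz
    rw [tendsto_atTop]
    intro C
    by_contra hcon
    rw [← Ultrafilter.eventually_not] at hcon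
    exact hz ⟨C, hcon.mono fun k hk => (not_le.1 hk).le⟩
  have hconv : ∀ z, z ∈ Γ → ∃ c, Tendsto (fun k => L k z) l (𝓝 c) := by
    rintro z ⟨C, hC⟩
    obtain ⟨c, -, hc⟩ := (isCompact_closedBall (0 : ℝ) C).ultrafilter_le_nhds
      (l.map fun k => L k z) (by
        rw [Ultrafilter.coe_map, le_principal_iff, mem_map]
        filter_upwards [hC] with k hk
        simpa using hk)
    exact ⟨c, hc⟩
  have htf : Module.IsTorsionFree ℤ ((Fin n → ℤ) ⧸ Γ) := by
    rw [Module.isTorsionFree_iff_smul_eq_zero]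
    intro c q hcq
    by_cases hc : c = 0
    · exact Or.inl hc
    right
    obtain ⟨z, rfl⟩ := Submodule.Quotient.mk_surjective Γ q
    rw [← Submodule.Quotient.mk_smul, Submodule.Quotient.mk_eq_zero, hΓ] at hcq
    rw [Submodule.Quotient.mk_eq_zero, hΓ]
    obtain ⟨C, hC⟩ := hcq
    refine ⟨C, ?_⟩
    filter_upwards [hC] with k hk
    rw [map_smul, zsmul_eq_mul, abs_mul] at hk
    have : (1 : ℝ) ≤ |(c : ℝ)| := by exact_mod_cast Int.one_le_abs hc
    exact le_trans (le_mul_of_one_le_left (abs_nonneg _) this) hk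
  let b := Module.finBasis ℤ Γ
  let q := Module.finBasis ℤ ((Fin n → ℤ) ⧸ Γ)
  choose c hc using fun j => Submodule.Quotient.mk_surjective Γ (q j)
  let E : Fin n → Fin n → ℤ := fun i => Pi.single i 1
  have hLE : ∀ k i, L k (E i) = fr k i := fun k i => by
    rw [hL]
    simp [E, Pi.single_apply]
  let Q : Fin n → Fin (Module.finrank ℤ ((Fin n → ℤ) ⧸ Γ)) → ℤ := fun i j =>
    q.repr (Submodule.Quotient.mk (E i)) j
  have hdiff : ∀ i, E i - ∑ j, Q i j • c j ∈ Γ := by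
    intro i
    rw [← Submodule.Quotient.mk_eq_zero, Submodule.Quotient.mk_sub, sub_eq_zero,
      ← Submodule.mkQ_apply Γ (∑ j, _), map_sum]
    simp only [map_smul, Submodule.mkQ_apply, hc]
    exact (q.sum_repr _).symm
  let P : Fin n → Fin (Module.finrank ℤ Γ) → ℤ := fun i a => b.repr ⟨_, hdiff i⟩ a
  have hE : ∀ i, E i = ∑ a, P i a • (b a : Fin n → ℤ) + ∑ j, Q i j • c j := by
    intro i
    have h1 := congrArg Subtype.val (b.sum_repr ⟨_, hdiff i⟩)
    rw [Submodule.coe_sum] at h1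
    rw [eq_comm, ← eq_sub_iff_add_eq]
    exact h1
  have hrank := Submodule.finrank_quotient_add_finrank Γ
  rw [Module.finrank_fin_fun] at hrank
  have hpos : 0 < Module.finrank ℤ ((Fin n → ℤ) ⧸ Γ) := by
    rw [Module.finrank_pos_iff]
    refine ⟨Submodule.Quotient.mk (E i₀), 0, ?_⟩
    rw [Ne, Submodule.Quotient.mk_eq_zero]
    rintro ⟨C, hC⟩
    obtain ⟨k, h1, h2⟩ := (hC.and (hfr.eventually_gt_atTop C)).exists
    rw [hLE] at h1
    linarith
  choose η hη using fun a => hconv (b a) (b a).2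
  refine ⟨_, _, by omega, P, Q, fun k a => L k (b a), fun k j => L k (c j), η, ?_, hη, ?_⟩
  · intro k i
    rw [← hLE, hE i, map_add, map_sum, map_sum]
    congr 1 <;> exact Finset.sum_congr rfl fun _ _ => by rw [map_smul, zsmul_eq_mul]
  · intro z hz
    have h1 : ∑ j, z j • c j ∉ Γ := by
      intro hmem
      rw [← Submodule.Quotient.mk_eq_zero, ← Submodule.mkQ_apply, map_sum] at hmem
      simp only [map_smul, Submodule.mkQ_apply, hc] at hmem
      exact hz (funext fun j => Fintype.linearIndependent_iff.1 q.linearIndependent z hmem j)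
    refine (hnot _ h1).congr fun k => ?_
    rw [map_sum]
    congr 1
    exact Finset.sum_congr rfl fun _ _ => by rw [map_smul, zsmul_eq_mul]

end Lattice

section Frozen

variable {d n m N : ℕ}

/-- The point of `ℝ^d` with the given integer coordinates. -/
noncomputable def intPoint (z : Fin d → ℤ) : Eucl d := WithLp.toLp 2 fun j => (z j : ℝ)

/-- A coefficient `A(x, y_1, …, y_n)` that is elliptic for `x ∈ Ω`, periodic in every `y_i` and
Hölder continuous. -/
structure IsAdmissible (α β γ L : ℝ) (Ω : Set (Eucl d))
    (A : Eucl d → (Fin n → Eucl d) → Eucl d →L[ℝ] Eucl d) : Prop where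
  ell : ∀ x ∈ Ω, ∀ y, Ell α β (A x y)
  periodic : ∀ x y (z : Fin n → Fin d → ℤ), A x (fun i => y i + intPoint (z i)) = A x y
  holder : ∀ x x' y y', ‖A x y - A x' y'‖ ≤ L * (‖x - x'‖ + ∑ i, ‖y i - y' i‖) ^ γ

theorem continuous_of_holder {γ L : ℝ} (hγ : 0 < γ)
    {A : Eucl d → (Fin n → Eucl d) → Eucl d →L[ℝ] Eucl d}
    (h : ∀ x x' y y', ‖A x y - A x' y'‖ ≤ L * (‖x - x'‖ + ∑ i, ‖y i - y' i‖) ^ γ) :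
    Continuous fun p : Eucl d × (Fin n → Eucl d) => A p.1 p.2 := by
  rw [continuous_iff_continuousAt]
  intro q
  refine tendsto_iff_norm_sub_tendsto_zero.2
    (squeeze_zero (fun _ => norm_nonneg _) (fun p => h p.1 q.1 p.2 q.2) ?_)
  have h1 : Continuous fun p : Eucl d × (Fin n → Eucl d) =>
      L * (‖p.1 - q.1‖ + ∑ i, ‖p.2 i - q.2 i‖) ^ γ := by
    refine continuous_const.mul (Continuous.rpow_const (by fun_prop) fun _ => Or.inr hγ.le)
  have h2 := h1.tendsto q
  simpa [Real.zero_rpow hγ.ne'] using h2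

/-- The field with constant value `T`. -/
def constField (T : Eucl d →L[ℝ] Eucl d) : BField d (Eucl d) (Eucl d) where
  toFun _ := T
  sm := stronglyMeasurable_const
  bdd := ⟨‖T‖, fun _ => le_rfl⟩

theorem constField_apply (T : Eucl d →L[ℝ] Eucl d) (x : Eucl d) : constField T x = T := rfl

theorem IsHLim.norm_sub_le_of_const {l : Ultrafilter ℕ} {a c : ℕ → BField d (Eucl d) (Eucl d)}
    {α β : ℝ} (hα : 0 < α) (hβ : 0 < β) (hE : ∀ k x, Ell α β (a k x))
    (hE' : ∀ k x, Ell α β (c k x)) {T T' : Eucl d →L[ℝ] Eucl d} (hT : Ell α β T)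
    (hT' : Ell α β T') (h : IsHLim l a (constField T)) (h' : IsHLim l c (constField T')) {s : ℝ}
    (hs : 0 ≤ s) (hac : ∀ k x, ‖a k x - c k x‖ ≤ s) : ‖T - T'‖ ≤ s * β / α := by
  have h1 := h.ae_norm_sub_le hα hβ hE hE' h' (fun _ => hT.norm_le hβ.le)
    (fun _ => hT'.norm_le hβ.le) isOpen_univ hs (Eventually.of_forall fun k x _ => hac k x)
  obtain ⟨x, hx⟩ := h1.exists
  exact hx trivial

/-- The slow part `(∑_a P_{ia} y_a)_i` of the periodic variables. -/
def slowArg (P : Fin n → Fin m → ℤ) (y : Fin m → Eucl d) (i : Fin n) : Eucl d :=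
  ∑ a, (P i a : ℝ) • y a

/-- The fast part `(∑_b Q_{ib} ν_b z)_i` of the periodic variables. -/
def fastArg (Q : Fin n → Fin N → ℤ) (ν : Fin N → ℝ) (z : Eucl d) (i : Fin n) : Eucl d :=
  (∑ b, Q i b * ν b) • z

theorem continuous_fastArg (Q : Fin n → Fin N → ℤ) (ν : Fin N → ℝ) :
    Continuous (fastArg (d := d) Q ν) :=
  continuous_pi fun _ => continuous_const_smul _

theorem sum_norm_slowArg_sub_le (P : Fin n → Fin m → ℤ) (y y' : Fin m → Eucl d) :
    ∑ i, ‖slowArg P y i - slowArg P y' i‖ ≤ (∑ i, ∑ a, |(P i a : ℝ)|) * ∑ a, ‖y a - y' a‖ := by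
  rw [Finset.sum_mul]
  refine Finset.sum_le_sum fun i _ => ?_
  rw [slowArg, slowArg, ← Finset.sum_sub_distrib, Finset.sum_mul]
  refine (norm_sum_le _ _).trans (Finset.sum_le_sum fun a _ => ?_)
  rw [← smul_sub, norm_smul, Real.norm_eq_abs]
  gcongr
  exact Finset.single_le_sum (f := fun a => ‖y a - y' a‖) (fun _ _ => norm_nonneg _)
    (Finset.mem_univ a)

theorem sum_smul_intPoint {ι : Type*} (s : Finset ι) (c : ι → ℤ) (z : ι → Fin d → ℤ) :
    ∑ a ∈ s, (c a : ℝ) • intPoint (z a) = intPoint fun j => ∑ a ∈ s, c a * z a j := by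
  ext j
  simp [intPoint]

theorem slowArg_add_intPoint (P : Fin n → Fin m → ℤ) (y : Fin m → Eucl d)
    (z : Fin m → Fin d → ℤ) (i : Fin n) :
    slowArg P (fun a => y a + intPoint (z a)) i =
      slowArg P y i + intPoint fun j => ∑ a, P i a * z a j := by
  simp only [slowArg, smul_add, Finset.sum_add_distrib, sum_smul_intPoint]

variable {α β γ L : ℝ} {Ω : Set (Eucl d)} {A : Eucl d → (Fin n → Eucl d) → Eucl d →L[ℝ] Eucl d}

namespace IsAdmissible

variable (hA : IsAdmissible α β γ L Ω A) (hγ : 0 < γ) (hβ : 0 < β) {x₀ : Eucl d} (hx₀ : x₀ ∈ Ω)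

/-- The coefficient with its first variable frozen at `x₀` and its slow periodic variables
frozen at `y`. -/
def frozen (P : Fin n → Fin m → ℤ) (Q : Fin n → Fin N → ℤ) (ν : Fin N → ℝ)
    (y : Fin m → Eucl d) : BField d (Eucl d) (Eucl d) where
  toFun z := A x₀ fun i => slowArg P y i + fastArg Q ν z i
  sm := ((continuous_of_holder hγ hA.holder).comp (continuous_const.prodMk
    (continuous_pi fun i => continuous_const.add
      (continuous_pi_iff.1 (continuous_fastArg Q ν) i)))).stronglyMeasurable
  bdd := ⟨β, fun _ => (hA.ell _ hx₀ _).norm_le hβ.le⟩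

theorem frozen_apply (P : Fin n → Fin m → ℤ) (Q : Fin n → Fin N → ℤ) (ν : Fin N → ℝ)
    (y : Fin m → Eucl d) (z : Eucl d) : hA.frozen hγ hβ hx₀ P Q ν y z =
      A x₀ fun i => slowArg P y i + fastArg Q ν z i := rfl

theorem exists_isHLim_frozen (hα : 0 < α) (hαβ : α ≤ β)
    {l : Ultrafilter ℕ} (hl : (l : Filter ℕ) ≤ atTop) (P : Fin n → Fin m → ℤ)
    (Q : Fin n → Fin N → ℤ) {ν : ℕ → Fin N → ℝ}
    (hν : ∀ z : Fin N → ℤ, z ≠ 0 → Tendsto (fun k => |∑ b, z b * ν k b|) l atTop)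
    (y : Fin m → Eucl d) :
    ∃ T, Ell α β T ∧ IsHLim l (fun k => hA.frozen hγ hβ hx₀ P Q (ν k) y) (constField T) := by
  set c : ℕ → BField d (Eucl d) (Eucl d) := fun k => hA.frozen hγ hβ hx₀ P Q (ν k) y
  have hc : ∀ k z, Ell α β (c k z) := fun k z => hA.ell _ hx₀ _
  obtain ⟨cbar, hE, hlim⟩ := exists_isHLim l c hα hαβ hc
  have hconst : ∀ h', ∀ᵐ x, cbar (x + h') = cbar x := by
    intro h'
    choose s p hs hp using fun j : Fin d => exists_tendsto_almost_period hl hν (h' j)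
    let h : ℕ → Eucl d := fun k => WithLp.toLp 2 fun j => s j k
    have hh : Tendsto h l (𝓝 h') := by
      have h1 : Tendsto (fun k j => s j k) l (𝓝 fun j => h' j) := tendsto_pi_nhds.2 hs
      exact ((PiLp.continuous_toLp 2 _).tendsto _).comp h1
    refine hlim.ae_shift_eq hα hβ hc hh fun ε hε => ?_
    let e : ℕ → Fin n → Eucl d := fun k i =>
      fastArg Q (ν k) (h k) i - intPoint fun j => ∑ b, Q i b * p j k b
    have he : ∀ i, Tendsto (fun k => e k i) l (𝓝 0) := by
      intro i
      have h1 : Tendsto (fun k (j : Fin d) => ∑ b, (Q i b : ℝ) * (s j k * ν k b - p j k b)) l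
          (𝓝 fun j => ∑ b : Fin N, (Q i b : ℝ) * 0) :=
        tendsto_pi_nhds.2 fun j => tendsto_finsetSum _ fun b _ => (hp j b).const_mul _
      have h2 := ((PiLp.continuous_toLp 2 _).tendsto _).comp h1
      have h3 : WithLp.toLp 2 (fun _ => ∑ b : Fin N, (Q i b : ℝ) * 0) = (0 : Eucl d) := by
        ext; simp
      rw [h3] at h2
      refine h2.congr fun k => ?_
      ext j
      simp only [Function.comp_apply, e, fastArg, intPoint, h, PiLp.sub_apply, PiLp.smul_apply,
        smul_eq_mul, mul_sub, Finset.sum_sub_distrib, Finset.sum_mul, Int.cast_sum, Int.cast_mul]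
      congr 1
      exact Finset.sum_congr rfl fun b _ => by ring
    have hdiff : ∀ k x, ‖c k (x + h k) - c k x‖ ≤ L * (∑ i, ‖e k i‖) ^ γ := by
      intro k x
      have h1 : c k (x + h k) = A x₀ fun i => slowArg P y i + fastArg Q (ν k) x i + e k i := by
        rw [← hA.periodic _ _ fun i j => ∑ b, Q i b * p j k b]
        simp only [c, frozen_apply]
        congr 1
        ext1 i
        simp only [e, fastArg, smul_add]
        abel
      rw [h1]
      refine (hA.holder _ _ _ _).trans (le_of_eq ?_)
      simp
    have hlim0 : Tendsto (fun k => L * (∑ i, ‖e k i‖) ^ γ) l (𝓝 0) := by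
      have h1 : Tendsto (fun k => ∑ i, ‖e k i‖) l (𝓝 0) := by
        simpa using tendsto_finsetSum (Finset.univ : Finset (Fin n)) fun i _ => (he i).norm
      have h2 := (h1.rpow_const (p := γ) (Or.inr hγ.le)).const_mul L
      simpa [Real.zero_rpow hγ.ne'] using h2
    filter_upwards [hlim0.eventually_lt_const hε] with k hk x
    exact (hdiff k x).trans hk.le
  obtain ⟨x₁, hx₁⟩ := exists_ae_eq_const_of_shift hconst
  refine ⟨cbar x₁, hE x₁, fun U hU u v D hu hD => ?_⟩
  filter_upwards [hlim U hU u v D hu hD, hx₁] with x h1 h2 hxU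
  rw [h1 hxU, h2, constField_apply]

/-- The effective coefficient: the `H`-limits of the frozen fields. -/
theorem exists_effective (hA : IsAdmissible α β γ L Ω A) (hγ : 0 < γ) (hβ : 0 < β)
    (hα : 0 < α) (hαβ : α ≤ β) (hL : 0 < L) (hΩ : IsOpen Ω)
    {l : Ultrafilter ℕ} (hl : (l : Filter ℕ) ≤ atTop) {fr : ℕ → Fin n → ℝ} (P : Fin n → Fin m → ℤ)
    (Q : Fin n → Fin N → ℤ) {μ : ℕ → Fin m → ℝ} {ν : ℕ → Fin N → ℝ} {η : Fin m → ℝ}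
    (hfr : ∀ k i, fr k i = ∑ a, P i a * μ k a + ∑ b, Q i b * ν k b)
    (hμ : ∀ a, Tendsto (fun k => μ k a) l (𝓝 (η a)))
    (hν : ∀ z : Fin N → ℤ, z ≠ 0 → Tendsto (fun k => |∑ b, z b * ν k b|) l atTop) :
    ∃ (B : Ω → (Fin m → Eucl d) → Eucl d →L[ℝ] Eucl d) (L' : ℝ), 0 < L' ∧
      (∀ x y, Ell α β (B x y)) ∧
      (∀ x y (z : Fin m → Fin d → ℤ), B x (fun a => y a + intPoint (z a)) = B x y) ∧
      (∀ x x' y y', ‖B x y - B x' y'‖ ≤ L' * (‖(x : Eucl d) - x'‖ + ∑ a, ‖y a - y' a‖) ^ γ) ∧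
      ∀ (a : ℕ → BField d (Eucl d) (Eucl d)) (abar : BField d (Eucl d) (Eucl d)),
        (∀ k x, Ell α β (a k x)) → (∀ x, Ell α β (abar x)) →
        (∀ k, ∀ x ∈ Ω, a k x = A x fun i => fr k i • x) → IsHLim l a abar →
        ∀ᵐ x, ∀ hx : x ∈ Ω, abar x = B ⟨x, hx⟩ fun a => η a • x := by
  choose B hBE hB using fun x : Ω => hA.exists_isHLim_frozen hγ hβ x.2 hα hαβ hl P Q hν
  have hcE : ∀ (x : Ω) y k z, Ell α β (hA.frozen hγ hβ x.2 P Q (ν k) y z) :=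
    fun x y k z => hA.ell _ x.2 _
  set K : ℝ := 1 + ∑ i, ∑ a, |(P i a : ℝ)| with hK
  have hK0 : 0 ≤ ∑ i, ∑ a, |(P i a : ℝ)| := by positivity
  have hK1 : 1 ≤ K := by linarith
  have harg : ∀ (x x' : Eucl d) (y y' : Fin m → Eucl d) (w : Fin n → Eucl d),
      ‖A x (fun i => slowArg P y i + w i) - A x' fun i => slowArg P y' i + w i‖ ≤
        L * (K * (‖x - x'‖ + ∑ a, ‖y a - y' a‖)) ^ γ := by
    intro x x' y y' w
    refine (hA.holder _ _ _ _).trans ?_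
    gcongr
    simp only [add_sub_add_right_eq_sub]
    have h1 := sum_norm_slowArg_sub_le P y y'
    have h2 : 0 ≤ ∑ a, ‖y a - y' a‖ := by positivity
    have h3 := norm_nonneg (x - x')
    rw [hK]
    nlinarith
  have hBhol : ∀ x x' y y', ‖B x y - B x' y'‖ ≤
      L * K ^ γ * β / α * (‖(x : Eucl d) - x'‖ + ∑ a, ‖y a - y' a‖) ^ γ := by
    intro x x' y y'
    have h1 := (hB x y).norm_sub_le_of_const hα hβ (hcE x y) (hcE x' y') (hBE x y) (hBE x' y')
      (hB x' y') (by positivity) fun k z => harg x x' y y' (fastArg Q (ν k) z)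
    rw [Real.mul_rpow (by positivity) (by positivity)] at h1
    refine h1.trans (le_of_eq ?_)
    ring
  refine ⟨B, L * K ^ γ * β / α, by positivity, hBE, fun x y z => ?_, hBhol, ?_⟩
  · have h1 := (hB x (fun a => y a + intPoint (z a))).norm_sub_le_of_const hα hβ (hcE x _)
      (hcE x y) (hBE x _) (hBE x y) (hB x y) le_rfl fun k w => by
        rw [frozen_apply, frozen_apply, ← hA.periodic _ (fun i => slowArg P y i + _)
          fun i j => ∑ a, P i a * z a j]
        simp only [slowArg_add_intPoint, add_right_comm]
        simp
    rw [zero_mul, zero_div] at h1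
    exact sub_eq_zero.1 (norm_le_zero_iff.1 h1)
  intro a abar haE habE ha hlim
  let S : ℝ := 1 + ∑ a : Fin m, (1 + |η a|)
  have hS : 0 ≤ ∑ a : Fin m, (1 + |η a|) := by positivity
  have hS0 : 0 ≤ S := by positivity
  let C : ℝ := L * (K * S) ^ γ * β / α + L * K ^ γ * β / α * S ^ γ
  have hball : ∀ (x₀ : Eucl d) (r : ℝ), 0 < r → Metric.ball x₀ r ⊆ Ω →
      ∀ᵐ x, x ∈ Metric.ball x₀ r → ∀ hx : x ∈ Ω,
        ‖abar x - B ⟨x, hx⟩ (fun a => η a • x)‖ ≤ C * r ^ γ := by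
    intro x₀ r hr hsub
    have hx₀ : x₀ ∈ Ω := hsub (Metric.mem_ball_self hr)
    have hev : ∀ᶠ k in (l : Filter ℕ), ∀ a, |μ k a - η a| * (‖x₀‖ + r) ≤ r := by
      rw [eventually_all]
      intro a
      have h1 : Tendsto (fun k => |μ k a - η a| * (‖x₀‖ + r)) l (𝓝 0) := by
        have := ((hμ a).sub_const (η a)).abs.mul_const (‖x₀‖ + r)
        simpa using this
      filter_upwards [h1.eventually_lt_const hr] with k hk using hk.le
    have h1 := hlim.ae_norm_sub_le hα hβ haE (hcE ⟨x₀, hx₀⟩ fun a => η a • x₀)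
      (hB ⟨x₀, hx₀⟩ fun a => η a • x₀) (fun x => (habE x).norm_le hβ.le)
      (fun x => (hBE _ _).norm_le hβ.le) Metric.isOpen_ball (s := L * (K * (S * r)) ^ γ)
      (by positivity) (by
        filter_upwards [hev] with k hk x hx
        have hxr : ‖x - x₀‖ < r := by rwa [← dist_eq_norm]
        have e1 : (fun i => fr k i • x) = fun i =>
            slowArg P (fun a => μ k a • x) i + fastArg Q (ν k) x i := by
          ext1 i
          rw [hfr, add_smul, Finset.sum_smul]
          simp only [slowArg, fastArg, mul_smul]
        rw [ha k x (hsub hx), e1, frozen_apply]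
        refine (harg _ _ _ _ _).trans ?_
        have e2 : ∀ a, ‖μ k a • x - η a • x₀‖ ≤ (1 + |η a|) * r := by
          intro a
          have e3 : μ k a • x - η a • x₀ = (μ k a - η a) • x + η a • (x - x₀) := by
            rw [sub_smul, smul_sub]; abel
          have e4 : ‖x‖ ≤ ‖x₀‖ + r := by
            have := norm_sub_norm_le x x₀
            linarith
          rw [e3]
          refine (norm_add_le _ _).trans ?_
          rw [norm_smul, norm_smul, Real.norm_eq_abs, Real.norm_eq_abs, add_mul, one_mul]
          refine add_le_add ((mul_le_mul_of_nonneg_left e4 (abs_nonneg _)).trans (hk a)) ?_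
          gcongr
        have e5 : ∑ a, ‖μ k a • x - η a • x₀‖ ≤ (∑ a, (1 + |η a|)) * r := by
          rw [Finset.sum_mul]
          exact Finset.sum_le_sum fun a _ => e2 a
        have e6 : ‖x - x₀‖ + ∑ a, ‖μ k a • x - η a • x₀‖ ≤ S * r := by
          rw [show S * r = r + (∑ a, (1 + |η a|)) * r by simp only [S]; ring]
          linarith
        gcongr)
    filter_upwards [h1] with x hx hxr hxΩ
    have h2 := hx hxr
    have hxr' : ‖x₀ - x‖ ≤ r := by
      rw [norm_sub_rev, ← dist_eq_norm]; exact (Metric.mem_ball.1 hxr).le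
    have h3 := hBhol ⟨x₀, hx₀⟩ ⟨x, hxΩ⟩ (fun a => η a • x₀) fun a => η a • x
    have h4 : ‖x₀ - x‖ + ∑ a, ‖η a • x₀ - η a • x‖ ≤ S * r := by
      have e5 : ∑ a, ‖η a • x₀ - η a • x‖ ≤ (∑ a, (1 + |η a|)) * r := by
        rw [Finset.sum_mul]
        refine Finset.sum_le_sum fun a _ => ?_
        rw [← smul_sub, norm_smul, Real.norm_eq_abs]
        have := abs_nonneg (η a)
        nlinarith [norm_nonneg (x₀ - x)]
      rw [show S * r = r + (∑ a, (1 + |η a|)) * r by simp only [S]; ring]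
      linarith
    have h5 : ‖abar x - B ⟨x, hxΩ⟩ (fun a => η a • x)‖ ≤ L * (K * (S * r)) ^ γ * β / α +
        L * K ^ γ * β / α * (S * r) ^ γ := by
      rw [← sub_add_sub_cancel _ (B ⟨x₀, hx₀⟩ fun a => η a • x₀)]
      refine (norm_add_le _ _).trans (add_le_add h2 (h3.trans ?_))
      gcongr
    refine h5.trans (le_of_eq ?_)
    rw [← mul_assoc K, Real.mul_rpow (by positivity : 0 ≤ K * S) hr.le,
      Real.mul_rpow hS0 hr.le]
    simp only [C]
    ring
  obtain ⟨D, hDc, hDd⟩ := TopologicalSpace.exists_countable_dense (Eucl d)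
  have hae : ∀ᵐ x, ∀ x₀ ∈ D, ∀ j : ℕ, Metric.ball x₀ (1 / ((j : ℝ) + 1)) ⊆ Ω →
      x ∈ Metric.ball x₀ (1 / ((j : ℝ) + 1)) → ∀ hx : x ∈ Ω,
        ‖abar x - B ⟨x, hx⟩ (fun a => η a • x)‖ ≤ C * (1 / ((j : ℝ) + 1)) ^ γ := by
    rw [ae_ball_iff hDc]
    intro x₀ _
    rw [ae_all_iff]
    intro j
    by_cases hsub : Metric.ball x₀ (1 / ((j : ℝ) + 1)) ⊆ Ω
    · filter_upwards [hball x₀ _ (by positivity) hsub] with x hx _ using hx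
    · exact Eventually.of_forall fun x h => absurd h hsub
  filter_upwards [hae] with x hx hxΩ
  obtain ⟨r, hr, hrΩ⟩ := Metric.isOpen_iff.1 hΩ x hxΩ
  have hlim0 : Tendsto (fun j : ℕ => C * (1 / ((j : ℝ) + 1)) ^ γ) atTop (𝓝 0) := by
    have h2 := ((tendsto_one_div_add_atTop_nhds_zero_nat (𝕜 := ℝ)).rpow_const
      (Or.inr hγ.le : _ ∨ 0 ≤ γ)).const_mul C
    simpa [Real.zero_rpow hγ.ne'] using h2
  refine sub_eq_zero.1 (norm_le_zero_iff.1 (ge_of_tendsto hlim0 ?_))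
  filter_upwards [(tendsto_one_div_add_atTop_nhds_zero_nat (𝕜 := ℝ)).eventually_lt_const
    (half_pos hr)] with j hj
  obtain ⟨x₀, hx₀D, hx₀⟩ := hDd.exists_dist_lt x (ε := 1 / ((j : ℝ) + 1)) (by positivity)
  refine hx x₀ hx₀D j (fun w hw => hrΩ ?_) hx₀ hxΩ
  rw [Metric.mem_ball] at hw ⊢
  have := dist_triangle w x₀ x
  rw [dist_comm x₀ x] at this
  linarith

end IsAdmissible

end Frozen

section Matrices

variable {d : ℕ}

/-- The operator on `ℝ^d` of a matrix. -/
noncomputable abbrev matCLM (M : Matrix (Fin d) (Fin d) ℝ) : Eucl d →L[ℝ] Eucl d :=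
  Matrix.toEuclideanCLM (n := Fin d) (𝕜 := ℝ) M

theorem matCLM_apply (M : Matrix (Fin d) (Fin d) ℝ) (ξ : Eucl d) (i : Fin d) :
    matCLM M ξ i = ∑ j, M i j * ξ j := by
  change (Matrix.mulVec M ξ.ofLp) i = _
  rfl

theorem abs_entry_le (M : Matrix (Fin d) (Fin d) ℝ) (i j : Fin d) : |M i j| ≤ ‖matCLM M‖ := by
  have h1 : M i j = matCLM M (EuclideanSpace.single j 1) i := by
    rw [matCLM_apply]
    simp
  rw [h1, ← Real.norm_eq_abs]
  refine (PiLp.norm_apply_le _ i).trans (((matCLM M).le_opNorm _).trans ?_)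
  simp

theorem norm_le_sum_abs (v : Eucl d) : ‖v‖ ≤ ∑ i, |v i| := by
  have h1 : v = ∑ i, v i • EuclideanSpace.single i (1 : ℝ) := by
    ext j
    simp [Finset.sum_apply, Pi.single_apply]
  conv_lhs => rw [h1]
  refine (norm_sum_le _ _).trans (Finset.sum_le_sum fun i _ => ?_)
  rw [norm_smul]
  simp

theorem norm_matCLM_le_sum (M : Matrix (Fin d) (Fin d) ℝ) : ‖matCLM M‖ ≤ ∑ i, ∑ j, |M i j| := by
  refine ContinuousLinearMap.opNorm_le_bound _ (by positivity) fun ξ => ?_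
  refine (norm_le_sum_abs _).trans ?_
  rw [Finset.sum_mul]
  refine Finset.sum_le_sum fun i _ => ?_
  rw [matCLM_apply, Finset.sum_mul]
  refine (Finset.abs_sum_le_sum_abs _ _).trans (Finset.sum_le_sum fun j _ => ?_)
  rw [abs_mul]
  gcongr
  exact PiLp.norm_apply_le ξ j

theorem isUnit_det_of_coercive {α : ℝ} (hα : 0 < α) {M : Matrix (Fin d) (Fin d) ℝ}
    (h : ∀ ξ, α * ‖ξ‖ ^ 2 ≤ inner ℝ (matVec M ξ) ξ) : IsUnit M.det := by
  rw [isUnit_iff_ne_zero]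
  intro h0
  obtain ⟨v, hv, hMv⟩ := Matrix.exists_mulVec_eq_zero_iff.2 h0
  have h1 : matVec M (WithLp.toLp 2 v) = 0 := by
    change WithLp.toLp 2 (M.mulVec v) = 0
    rw [hMv]; rfl
  have h2 := h (WithLp.toLp 2 v)
  rw [h1, inner_zero_left] at h2
  have h3 : ‖(WithLp.toLp 2 v : Eucl d)‖ ≠ 0 := by
    rw [norm_ne_zero_iff]
    intro h4
    exact hv (congrArg WithLp.ofLp h4)
  have : 0 < α * ‖(WithLp.toLp 2 v : Eucl d)‖ ^ 2 := by positivity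
  linarith

theorem ell_iff_coercive {α β : ℝ} (hα : 0 < α) (hβ : 0 < β) {M : Matrix (Fin d) (Fin d) ℝ} :
    Ell α β (matCLM M) ↔ (∀ ξ, α * ‖ξ‖ ^ 2 ≤ inner ℝ (matVec M ξ) ξ) ∧
      ∀ ξ, β⁻¹ * ‖ξ‖ ^ 2 ≤ inner ℝ (matVec M⁻¹ ξ) ξ := by
  have key : (∀ ξ, α * ‖ξ‖ ^ 2 ≤ inner ℝ (matVec M ξ) ξ) →
      (∀ ξ, matVec M⁻¹ (matVec M ξ) = ξ) ∧ ∀ ξ, matVec M (matVec M⁻¹ ξ) = ξ := by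
    intro h
    have hu := isUnit_det_of_coercive hα h
    constructor <;> intro ξ <;> simp only [matVec] <;>
      rw [← mul_apply_eq_comp, ← map_mul]
    · rw [Matrix.nonsing_inv_mul _ hu, map_one]
      rfl
    · rw [Matrix.mul_nonsing_inv _ hu, map_one]
      rfl
  constructor
  · intro h
    have h1 : ∀ ξ, α * ‖ξ‖ ^ 2 ≤ inner ℝ (matVec M ξ) ξ := fun ξ => (h ξ).1
    refine ⟨h1, fun ξ => ?_⟩
    have h2 := (h (matVec M⁻¹ ξ)).2
    change ‖matVec M (matVec M⁻¹ ξ)‖ ^ 2 ≤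
      β * inner ℝ (matVec M (matVec M⁻¹ ξ)) (matVec M⁻¹ ξ) at h2
    rw [(key h1).2, real_inner_comm] at h2
    rwa [inv_mul_le_iff₀ hβ]
  · rintro ⟨h1, h2⟩ ξ
    refine ⟨h1 ξ, ?_⟩
    have h3 := h2 (matVec M ξ)
    rw [(key h1).1, inv_mul_le_iff₀ hβ, real_inner_comm] at h3
    exact h3

theorem inM_of_ell {α β : ℝ} (hα : 0 < α) (hβ : 0 < β) {Ω : Set (Eucl d)} (hΩ : MeasurableSet Ω)
    {A : Eucl d → Matrix (Fin d) (Fin d) ℝ} (hc : Continuous fun x => matCLM (A x))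
    (hE : ∀ x ∈ Ω, Ell α β (matCLM (A x))) : InM α β Ω A where
  memLp_top i j := by
    have h1 : Continuous fun x => A x i j := by
      have h2 : ∀ x, A x i j = matCLM (A x) (EuclideanSpace.single j 1) i := fun x => by
        rw [matCLM_apply]; simp
      simp only [h2]
      exact (EuclideanSpace.proj (𝕜 := ℝ) i).continuous.comp (hc.clm_apply continuous_const)
    refine memLp_top_of_bound h1.aestronglyMeasurable β ?_
    filter_upwards [ae_restrict_mem hΩ] with x hx
    exact (abs_entry_le _ i j).trans ((hE x hx).norm_le hβ.le)
  coercive := by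
    filter_upwards [ae_restrict_mem hΩ] with x hx using ((ell_iff_coercive hα hβ).1 (hE x hx)).1
  inv_coercive := by
    filter_upwards [ae_restrict_mem hΩ] with x hx using ((ell_iff_coercive hα hβ).1 (hE x hx)).2

theorem InM.ell {α β : ℝ} (hα : 0 < α) (hβ : 0 < β) {Ω : Set (Eucl d)} (hΩ : IsOpen Ω)
    {A : Eucl d → Matrix (Fin d) (Fin d) ℝ} (h : InM α β Ω A)
    (hc : Continuous fun x => matCLM (A x)) {x : Eucl d} (hx : x ∈ Ω) :
    Ell α β (matCLM (A x)) := by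
  by_contra hnot
  let U : Set (Eucl d) := Ω ∩ {x | Ell α β (matCLM (A x))}ᶜ
  have hU : IsOpen U := hΩ.inter ((isClosed_ell α β).preimage hc).isOpen_compl
  have h1 : ∀ᵐ x ∂(volume.restrict Ω), Ell α β (matCLM (A x)) := by
    filter_upwards [h.coercive, h.inv_coercive] with x h1 h2
    exact (ell_iff_coercive hα hβ).2 ⟨h1, h2⟩
  rw [ae_restrict_iff' hΩ.measurableSet] at h1
  have h2 : volume U = 0 := by
    rw [measure_eq_zero_iff_ae_notMem]
    filter_upwards [h1] with x h3 h4 using h4.2 (h3 h4.1)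
  exact (hU.measure_pos volume ⟨x, hx, hnot⟩).ne' h2

theorem continuous_of_isHolderCoeff {n : ℕ} {γ L : ℝ} (hγ : 0 < γ)
    {A : Eucl d → (Fin n → Eucl d) → Matrix (Fin d) (Fin d) ℝ} (h : IsHolderCoeff γ L A) :
    Continuous fun p : Eucl d × (Fin n → Eucl d) => matCLM (A p.1 p.2) :=
  continuous_of_holder (A := fun x y => matCLM (A x y)) hγ fun x x' y y' => by
    rw [← map_sub]
    exact h x x' y y'

theorem continuous_coeff_left {n : ℕ} {γ L : ℝ} (hγ : 0 < γ)
    {A : Eucl d → (Fin n → Eucl d) → Matrix (Fin d) (Fin d) ℝ} (h : IsHolderCoeff γ L A)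
    (y : Fin n → Eucl d) : Continuous fun x => matCLM (A x y) := by
  have h2 := (continuous_of_isHolderCoeff hγ h).comp (Continuous.prodMk_left y)
  simpa only [Function.comp_def] using h2

theorem ell_atScales {n : ℕ} {α β : ℝ} {Ω : Set (Eucl d)}
    {A : Eucl d → (Fin n → Eucl d) → Matrix (Fin d) (Fin d) ℝ}
    (h : ∀ x ∈ Ω, ∀ y, Ell α β (matCLM (A x y))) (ε : Fin n → ℝ) {x : Eucl d} (hx : x ∈ Ω) :
    Ell α β (matCLM (atScales A ε x)) := by
  rw [atScales]
  exact h x hx _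

theorem continuous_atScales {n : ℕ} {γ L : ℝ} (hγ : 0 < γ)
    {A : Eucl d → (Fin n → Eucl d) → Matrix (Fin d) (Fin d) ℝ} (h : IsHolderCoeff γ L A)
    (ε : Fin n → ℝ) : Continuous fun x => matCLM (atScales A ε x) := by
  have h1 : Continuous fun x : Eucl d => (x, fun i => (ε i)⁻¹ • x) := by fun_prop
  have h2 := (continuous_of_isHolderCoeff hγ h).comp h1
  simp only [Function.comp_def] at h2
  simpa only [atScales] using h2

/-- Extension of a Hölder continuous function of `x ∈ Ω` and `y` to all `x ∈ ℝ^d`. -/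
theorem exists_holder_extension_real {m : ℕ} {Ω : Set (Eucl d)} (hΩ : Ω.Nonempty) {γ L : ℝ}
    (hγ0 : 0 < γ) (hγ1 : γ ≤ 1) (hL : 0 < L) (f : Ω → (Fin m → Eucl d) → ℝ)
    (hf : ∀ p p' y y', f p y ≤ f p' y' + L * (‖(p : Eucl d) - p'‖ + ∑ a, ‖y a - y' a‖) ^ γ) :
    ∃ f' : Eucl d → (Fin m → Eucl d) → ℝ, (∀ (x : Ω) y, f' x y = f x y) ∧
      (∀ x y y', (∀ p, f p y = f p y') → f' x y = f' x y') ∧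
      ∀ x x' y y', f' x y ≤ f' x' y' + 2 * L * (‖x - x'‖ + ∑ a, ‖y a - y' a‖) ^ γ := by
  have : Nonempty Ω := hΩ.to_subtype
  let F : Eucl d → (Fin m → Eucl d) → Ω → ℝ := fun x y p => f p y + L * ‖x - p‖ ^ γ
  have htri : ∀ x x' p : Eucl d, ‖x - p‖ ^ γ ≤ ‖x - x'‖ ^ γ + ‖x' - p‖ ^ γ := by
    intro x x' p
    refine (Real.rpow_le_rpow (norm_nonneg _) (norm_sub_le_norm_sub_add_norm_sub x x' p)
      hγ0.le).trans ?_
    have := NNReal.rpow_add_le_add_rpow ‖x - x'‖₊ ‖x' - p‖₊ hγ0.le hγ1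
    exact_mod_cast this
  have hbdd : ∀ x y, BddBelow (Set.range (F x y)) := by
    intro x y
    obtain ⟨q⟩ := this
    refine ⟨f q y - L * ‖x - q‖ ^ γ, ?_⟩
    rintro _ ⟨p, rfl⟩
    have h1 := hf q p y y
    simp only [sub_self, norm_zero, Finset.sum_const_zero, add_zero] at h1
    have h2 := htri q x p
    rw [norm_sub_rev (q : Eucl d) x] at h2
    have h3 := mul_le_mul_of_nonneg_left h2 hL.le
    simp only [F]
    linarith
  refine ⟨fun x y => ⨅ p, F x y p, fun x y => ?_, fun x y y' h => ?_, fun x x' y y' => ?_⟩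
  · refine le_antisymm ((ciInf_le (hbdd x y) x).trans (le_of_eq ?_)) (le_ciInf fun p => ?_)
    · simp [F, Real.zero_rpow hγ0.ne']
    · simpa using hf x p y y
  · simp only [F, h]
  · rw [← sub_le_iff_le_add]
    refine le_ciInf fun p => ?_
    rw [sub_le_iff_le_add]
    refine (ciInf_le (hbdd x y) p).trans ?_
    have h1 := hf p p y y'
    rw [sub_self, norm_zero, zero_add] at h1
    have h2 := mul_le_mul_of_nonneg_left (htri x x' p) hL.le
    have h0 : 0 ≤ ∑ a, ‖y a - y' a‖ := by positivity
    have h3 : ‖x - x'‖ ^ γ ≤ (‖x - x'‖ + ∑ a, ‖y a - y' a‖) ^ γ :=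
      Real.rpow_le_rpow (norm_nonneg _) (by linarith) hγ0.le
    have h4 : (∑ a, ‖y a - y' a‖) ^ γ ≤ (‖x - x'‖ + ∑ a, ‖y a - y' a‖) ^ γ :=
      Real.rpow_le_rpow h0 (by linarith [norm_nonneg (x - x')]) hγ0.le
    have h5 := mul_le_mul_of_nonneg_left h3 hL.le
    have h6 := mul_le_mul_of_nonneg_left h4 hL.le
    simp only [F]
    linarith

/-- Extension of a Hölder continuous coefficient from `Ω` to `ℝ^d`. -/
theorem exists_holder_extension {m : ℕ} {Ω : Set (Eucl d)} (hΩ : Ω.Nonempty) {γ L : ℝ}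
    (hγ0 : 0 < γ) (hγ1 : γ ≤ 1) (hL : 0 < L)
    (B : Ω → (Fin m → Eucl d) → Eucl d →L[ℝ] Eucl d)
    (hper : ∀ x y (z : Fin m → Fin d → ℤ), B x (fun a => y a + intPoint (z a)) = B x y)
    (hhol : ∀ x x' y y', ‖B x y - B x' y'‖ ≤ L * (‖(x : Eucl d) - x'‖ + ∑ a, ‖y a - y' a‖) ^ γ) :
    ∃ (B' : Eucl d → (Fin m → Eucl d) → Matrix (Fin d) (Fin d) ℝ) (L' : ℝ), 0 < L' ∧
      (∀ (x : Ω) y, matCLM (B' x y) = B x y) ∧ IsPeriodicCoeff B' ∧ IsHolderCoeff γ L' B' := by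
  obtain ⟨M, hM⟩ : ∃ M : Ω → (Fin m → Eucl d) → Matrix (Fin d) (Fin d) ℝ,
      ∀ p y, matCLM (M p y) = B p y :=
    ⟨fun p y => (Matrix.toEuclideanCLM (n := Fin d) (𝕜 := ℝ)).symm (B p y),
      fun p y => StarAlgEquiv.apply_symm_apply _ _⟩
  have hMhol : ∀ i j p p' y y', M p y i j ≤
      M p' y' i j + L * (‖(p : Eucl d) - p'‖ + ∑ a, ‖y a - y' a‖) ^ γ := by
    intro i j p p' y y'
    have h1 := abs_entry_le (M p y - M p' y') i j
    rw [matCLM, map_sub] at h1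
    have h2 := (le_abs_self _).trans (h1.trans ((congrArg norm
      (congrArg₂ _ (hM p y) (hM p' y'))).trans_le (hhol p p' y y')))
    rw [Matrix.sub_apply] at h2
    linarith
  choose F hF hFper hsub using fun i j => exists_holder_extension_real hΩ hγ0 hγ1 hL
    (fun p y => M p y i j) (hMhol i j)
  refine ⟨fun x y => Matrix.of fun i j => F i j x y, (d : ℝ) * d * (2 * L) + 1, by positivity,
    fun x y => ?_, fun x y z => ?_, fun x x' y y' => ?_⟩
  · rw [← hM]
    congr 1
    ext i j
    exact hF i j x y
  · ext i j
    refine hFper i j x _ _ fun p => ?_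
    have h1 : matCLM (M p fun a => y a + intPoint (z a)) = matCLM (M p y) := by
      rw [hM, hM, hper]
    exact congrFun₂ ((Matrix.toEuclideanCLM (n := Fin d) (𝕜 := ℝ)).injective h1) i j
  · refine (norm_matCLM_le_sum _).trans ?_
    set t := (‖x - x'‖ + ∑ a, ‖y a - y' a‖) ^ γ with ht
    have ht0 : 0 ≤ t := by positivity
    have h1 : ∀ i j, |F i j x y - F i j x' y'| ≤ 2 * L * t := by
      intro i j
      have h2 := hsub i j x x' y y'
      have h3 := hsub i j x' x y' y
      simp only [norm_sub_rev x' x, fun a => norm_sub_rev (y' a) (y a)] at h3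
      rw [← ht] at h2 h3
      rw [abs_sub_le_iff]
      constructor <;> linarith
    calc _ ≤ ∑ _i : Fin d, ∑ _j : Fin d, 2 * L * t :=
          Finset.sum_le_sum fun i _ => Finset.sum_le_sum fun j _ => h1 i j
      _ = d * d * (2 * L) * t := by simp; ring
      _ ≤ (d * d * (2 * L) + 1) * t := by nlinarith

theorem exists_sign_scale (t : ℝ) : ∃ (σ : ℤ) (δ : ℝ), |(σ : ℝ)| ≤ 1 ∧ 0 < δ ∧ σ * δ⁻¹ = t := by
  rcases lt_trichotomy t 0 with h | h | h
  · exact ⟨-1, -t⁻¹, by simp, by simpa using h, by simp⟩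
  · exact ⟨0, 1, by simp, one_pos, by simp [h]⟩
  · exact ⟨1, t⁻¹, by simp, by simpa using h, by simp⟩

/-- Real frequencies can be replaced by positive scales, and dummy variables can be added. -/
theorem exists_coeff_of_frequencies {m m' : ℕ} (hm : m ≤ m') {γ L : ℝ} (hγ : 0 < γ) (hL : 0 < L)
    {B : Eucl d → (Fin m → Eucl d) → Matrix (Fin d) (Fin d) ℝ} (hper : IsPeriodicCoeff B)
    (hhol : IsHolderCoeff γ L B) (η : Fin m → ℝ) :
    ∃ (B' : Eucl d → (Fin m' → Eucl d) → Matrix (Fin d) (Fin d) ℝ) (δ : Fin m' → ℝ),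
      (∀ b, 0 < δ b) ∧ IsPeriodicCoeff B' ∧ IsHolderCoeff γ L B' ∧
      (∀ x y', ∃ y, B' x y' = B x y) ∧ ∀ x, atScales B' δ x = B x fun a => η a • x := by
  choose σ δ hσ hδ hσδ using fun a => exists_sign_scale (η a)
  refine ⟨fun x y => B x fun a => (σ a : ℝ) • y (Fin.castLE hm a),
    fun b => if h : (b : ℕ) < m then δ ⟨b, h⟩ else 1, fun b => ?_, fun x y z => ?_,
    fun x x' y y' => ?_, fun x y' => ⟨_, rfl⟩, fun x => ?_⟩
  · dsimp only
    split_ifs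
    · exact hδ _
    · exact one_pos
  · dsimp only
    rw [← hper x (fun a => (σ a : ℝ) • y (Fin.castLE hm a))
      fun a j => σ a * z (Fin.castLE hm a) j]
    congr 1
    ext a j
    simp
  · refine (hhol _ _ _ _).trans ?_
    gcongr
    calc ∑ a, ‖(σ a : ℝ) • y (Fin.castLE hm a) - (σ a : ℝ) • y' (Fin.castLE hm a)‖
        ≤ ∑ a, ‖y (Fin.castLE hm a) - y' (Fin.castLE hm a)‖ := by
          refine Finset.sum_le_sum fun a _ => ?_
          rw [← smul_sub, norm_smul, Real.norm_eq_abs]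
          exact mul_le_of_le_one_left (norm_nonneg _) (hσ a)
      _ = ∑ b ∈ Finset.univ.map (Fin.castLEEmb hm), ‖y b - y' b‖ := by
          rw [Finset.sum_map]; rfl
      _ ≤ ∑ b, ‖y b - y' b‖ := Finset.sum_le_univ_sum_of_nonneg fun _ => norm_nonneg _
  · simp only [atScales]
    congr 1
    ext1 a
    simp [smul_smul, hσδ]

end Matrices

section DirichletProblem

variable {d : ℕ} {Ω : Set (Eucl d)}

/-- Extension by zero of a pair `(u, ∇u)`. -/
noncomputable def extendPair (hΩ : MeasurableSet Ω) : L2Pair Ω →ₗᵢ[ℝ] WPair d where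
  toFun p := WithLp.toLp 2 (extend ℝ hΩ p.fst, extend (Eucl d) hΩ p.snd)
  map_add' p q := by
    rw [WithLp.add_fst, WithLp.add_snd, map_add, map_add]; rfl
  map_smul' c p := by
    rw [WithLp.smul_fst, WithLp.smul_snd, map_smul, map_smul]; rfl
  norm_map' p := by
    simp [WithLp.prod_norm_eq_of_L2]

theorem extend_ae_eq {F : Type*} [NormedAddCommGroup F] [InnerProductSpace ℝ F]
    (hΩ : MeasurableSet Ω) {g : Lp F 2 (volume.restrict Ω)} {f : Eucl d → F}
    (hf : ∀ x ∉ Ω, f x = 0) : extend F hΩ g =ᵐ[volume] f ↔ g =ᵐ[volume.restrict Ω] f := by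
  constructor
  · intro h
    filter_upwards [ae_restrict_of_ae h, coeFn_extend_restrict hΩ g] with x h1 h2
    rw [← h1, h2]
  · intro h
    filter_upwards [coeFn_extend hΩ g, (ae_restrict_iff' hΩ).1 h] with x h1 h2
    rw [h1]
    by_cases hx : x ∈ Ω
    · rw [Set.indicator_of_mem hx, h2 hx]
    · rw [Set.indicator_of_notMem hx, hf x hx]

theorem IsTest.eq_zero {φ : Eucl d → ℝ} (h : IsTest Ω φ) {x : Eucl d} (hx : x ∉ Ω) : φ x = 0 :=
  image_eq_zero_of_notMem_tsupport fun h' => hx (h.subset h')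

theorem IsTest.gradient_eq_zero {φ : Eucl d → ℝ} (h : IsTest Ω φ) {x : Eucl d} (hx : x ∉ Ω) :
    gradient φ x = 0 := by
  have h1 : fderiv ℝ φ x = 0 :=
    image_eq_zero_of_notMem_tsupport fun h' => hx (h.subset (tsupport_fderiv_subset ℝ h'))
  rw [gradient, h1, map_zero]

theorem extendPair_mem_testSub (hΩ : MeasurableSet Ω) {p : L2Pair Ω} :
    extendPair hΩ p ∈ testSub Ω ↔ p ∈ testPairs Ω := by
  constructor
  · rintro ⟨φ, hφ, h1, h2⟩
    exact ⟨φ, hφ.contDiff, hφ.compact, hφ.subset,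
      (extend_ae_eq hΩ fun x hx => hφ.eq_zero hx).1 h1,
      (extend_ae_eq hΩ fun x hx => hφ.gradient_eq_zero hx).1 h2⟩
  · rintro ⟨φ, h1, h2, h3, h4, h5⟩
    have hφ : IsTest Ω φ := ⟨h1, h2, h3⟩
    exact ⟨φ, hφ, (extend_ae_eq hΩ fun x hx => hφ.eq_zero hx).2 h4,
      (extend_ae_eq hΩ fun x hx => hφ.gradient_eq_zero hx).2 h5⟩

theorem extendPair_mem (hΩ : MeasurableSet Ω) {p : L2Pair Ω} (hp : p ∈ H10 Ω) :
    extendPair hΩ p ∈ sobZero Ω := by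
  have h1 : Submodule.span ℝ (testPairs Ω) ≤ (sobZero Ω).comap (extendPair hΩ).toLinearMap :=
    Submodule.span_le.2 fun q hq =>
      Submodule.le_topologicalClosure _ ((extendPair_mem_testSub hΩ).2 hq)
  exact Submodule.topologicalClosure_minimal _ h1
    ((isClosed_sobZero Ω).preimage (extendPair hΩ).continuous) hp

instance : CompleteSpace (H10 Ω) :=
  (Submodule.isClosed_topologicalClosure (Submodule.span ℝ (testPairs Ω))).completeSpace_coe

theorem exists_extendPair_eq (hΩ : MeasurableSet Ω) {q : WPair d} (hq : q ∈ sobZero Ω) :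
    ∃ p : H10 Ω, extendPair hΩ p = q := by
  let j : H10 Ω →ₗᵢ[ℝ] WPair d := (extendPair hΩ).comp (H10 Ω).subtypeₗᵢ
  refine sobZero_induction (P := Set.range j) j.isometry.isClosedEmbedding.isClosed_range ?_ hq
  rintro q ⟨φ, hφ, h1, h2⟩
  let p : L2Pair Ω := WithLp.toLp 2
    ((Lp.memLp q.fst).restrict Ω |>.toLp, (Lp.memLp q.snd).restrict Ω |>.toLp)
  have hp1 : p.fst =ᵐ[volume.restrict Ω] φ := by
    filter_upwards [((Lp.memLp q.fst).restrict Ω).coeFn_toLp, ae_restrict_of_ae h1] with x a b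
    rw [← b, ← a]; rfl
  have hp2 : p.snd =ᵐ[volume.restrict Ω] gradient φ := by
    filter_upwards [((Lp.memLp q.snd).restrict Ω).coeFn_toLp, ae_restrict_of_ae h2] with x a b
    rw [← b, ← a]; rfl
  have hp : p ∈ testPairs Ω := ⟨φ, hφ.contDiff, hφ.compact, hφ.subset, hp1, hp2⟩
  refine ⟨⟨p, Submodule.le_topologicalClosure _ (Submodule.subset_span hp)⟩, ?_⟩
  change extendPair hΩ p = q
  have e1 : (extendPair hΩ p).fst = q.fst := Lp.ext
    (((extend_ae_eq hΩ fun x hx => hφ.eq_zero hx).2 hp1).trans h1.symm)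
  have e2 : (extendPair hΩ p).snd = q.snd := Lp.ext
    (((extend_ae_eq hΩ fun x hx => hφ.gradient_eq_zero hx).2 hp2).trans h2.symm)
  exact WithLp.ofLp_injective 2 (Prod.ext e1 e2)

/-- The embedding of `H¹₀(Ω)` into `H¹(ℝ^d)`. -/
noncomputable def embed (hΩ : MeasurableSet Ω) : H10 Ω →ₗᵢ[ℝ] WPair d :=
  (extendPair hΩ).comp (H10 Ω).subtypeₗᵢ

theorem embed_snd (hΩ : MeasurableSet Ω) (u : H10 Ω) :
    (embed hΩ u).snd = extend (Eucl d) hΩ (H10.grad u) := rfl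

/-- The energy form of `a` on `H¹₀(Ω)`, as an operator. -/
noncomputable def energyOp (hΩ : MeasurableSet Ω) (a : BField d (Eucl d) (Eucl d)) :
    H10 Ω →L[ℝ] H10 Ω :=
  let G : H10 Ω →L[ℝ] L2Rd d (Eucl d) :=
    (WithLp.sndL 2 ℝ (L2Rd d ℝ) (L2Rd d (Eucl d))).comp (embed hΩ).toContinuousLinearMap
  G.adjoint.comp (a.op.comp G)

theorem inner_energyOp (hΩ : MeasurableSet Ω) (a : BField d (Eucl d) (Eucl d)) (u v : H10 Ω) :
    inner ℝ (energyOp hΩ a u) v = inner ℝ (a.op (embed hΩ u).snd) (embed hΩ v).snd := by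
  simp only [energyOp, ContinuousLinearMap.comp_apply, ContinuousLinearMap.adjoint_inner_left]
  rfl

theorem inner_op_extend (hΩ : MeasurableSet Ω) {a : BField d (Eucl d) (Eucl d)}
    {A : Eucl d → Matrix (Fin d) (Fin d) ℝ} (ha : ∀ᵐ x, x ∈ Ω → a x = matCLM (A x))
    (g h : Lp (Eucl d) 2 (volume.restrict Ω)) :
    inner ℝ (a.op (extend _ hΩ g)) (extend _ hΩ h) =
      ∫ x in Ω, inner ℝ (matVec (A x) (g x)) (h x) := by
  rw [BField.inner_op, ← integral_indicator hΩ]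
  refine integral_congr_ae ?_
  filter_upwards [coeFn_extend hΩ g, coeFn_extend hΩ h, ha] with x h1 h2 h3
  rw [h1, h2]
  by_cases hx : x ∈ Ω
  · simp only [Set.indicator_of_mem hx, h3 hx]; rfl
  · simp only [Set.indicator_of_notMem hx, inner_zero_right]

theorem isWeakSol_iff (hΩ : MeasurableSet Ω) {a : BField d (Eucl d) (Eucl d)}
    {A : Eucl d → Matrix (Fin d) (Fin d) ℝ} (ha : ∀ᵐ x, x ∈ Ω → a x = matCLM (A x))
    (f : StrongDual ℝ (H10 Ω)) (u : H10 Ω) :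
    IsWeakSol A f u ↔ energyOp hΩ a u = (InnerProductSpace.toDual ℝ (H10 Ω)).symm f := by
  have h1 : ∀ v, inner ℝ (energyOp hΩ a u) v =
      ∫ x in Ω, inner ℝ (matVec (A x) (H10.grad u x)) (H10.grad v x) := fun v => by
    rw [inner_energyOp, embed_snd, embed_snd, inner_op_extend hΩ ha]
  have h2 : ∀ v, inner ℝ ((InnerProductSpace.toDual ℝ (H10 Ω)).symm f) v = f v := fun v =>
    InnerProductSpace.toDual_symm_apply
  constructor
  · intro h
    exact ext_inner_right ℝ fun v => (h1 v).trans ((h v).trans (h2 v).symm)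
  · intro h v
    exact (h1 v).symm.trans ((congrArg (fun w => inner ℝ w v) h).trans (h2 v))

theorem exists_energyOp_coercive (hd : 1 ≤ d) (hΩ : MeasurableSet Ω) (hb : Bornology.IsBounded Ω)
    {α β : ℝ} (hα : 0 < α) : ∃ c, 0 < c ∧ ∀ a : BField d (Eucl d) (Eucl d),
      (∀ x, Ell α β (a x)) → ∀ u : H10 Ω, c * ‖u‖ ^ 2 ≤ inner ℝ (energyOp hΩ a u) u := by
  obtain ⟨C, hC, hP⟩ := exists_poincare hd hb
  refine ⟨α / (C ^ 2 + 1), by positivity, fun a ha u => ?_⟩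
  have h1 := hP _ (extendPair_mem hΩ u.2)
  have h2 : ‖u‖ ^ 2 = ‖(embed hΩ u).fst‖ ^ 2 + ‖(embed hΩ u).snd‖ ^ 2 := by
    rw [← (embed hΩ).norm_map u, WithLp.prod_norm_sq_eq_of_L2]
  have h3 : ‖(embed hΩ u).fst‖ ^ 2 ≤ C ^ 2 * ‖(embed hΩ u).snd‖ ^ 2 := by
    rw [← mul_pow]
    exact pow_le_pow_left₀ (norm_nonneg _) h1 2
  have h4 : α * ‖(embed hΩ u).snd‖ ^ 2 ≤ inner ℝ (energyOp hΩ a u) u := by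
    rw [inner_energyOp, BField.inner_op, ← real_inner_self_eq_norm_sq, L2.inner_def,
      ← integral_const_mul]
    refine integral_mono ((L2.integrable_inner _ _).const_mul α) ?_ fun x => ?_
    · refine (L2.integrable_inner (a.op (embed hΩ u).snd) (embed hΩ u).snd).congr ?_
      filter_upwards [a.coeFn_op (embed hΩ u).snd] with x hx
      rw [hx]
    · rw [real_inner_self_eq_norm_sq]
      exact (ha x _).1
  rw [h2, div_mul_eq_mul_div, div_le_iff₀ (by positivity)]
  nlinarith [norm_nonneg (embed hΩ u).snd]

end DirichletProblem

section Subsequences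

theorem equicontinuous_inner {X Y Z : Type*} [NormedAddCommGroup X] [NormedAddCommGroup Y]
    [InnerProductSpace ℝ Y] [NormedAddCommGroup Z] [NormedSpace ℝ Z] (J : Z →ₗᵢ[ℝ] Y)
    {S : ℕ → X → Y} {M : ℝ} (hb : ∀ k x, ‖S k x‖ ≤ M * ‖x‖)
    (hS : ∀ k x x', ‖S k x - S k x'‖ ≤ M * ‖x - x'‖) :
    Equicontinuous fun k (p : X × Z) => (inner ℝ (S k p.1) (J p.2) : ℝ) := by
  intro p₀
  refine Metric.equicontinuousAt_of_continuity_modulus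
    (fun p => M * ‖p₀.1‖ * ‖p₀.2 - p.2‖ + M * ‖p₀.1 - p.1‖ * ‖p.2‖) ?_ _
    (Eventually.of_forall fun p k => ?_)
  · have h1 : Continuous fun p : X × Z =>
        M * ‖p₀.1‖ * ‖p₀.2 - p.2‖ + M * ‖p₀.1 - p.1‖ * ‖p.2‖ := by fun_prop
    have h2 := h1.tendsto p₀
    simpa using h2
  · have h1 : (inner ℝ (S k p₀.1) (J p₀.2) : ℝ) - inner ℝ (S k p.1) (J p.2) =
        inner ℝ (S k p₀.1) (J (p₀.2 - p.2)) + inner ℝ (S k p₀.1 - S k p.1) (J p.2) := by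
      rw [map_sub, inner_sub_right, inner_sub_left]
      ring
    rw [dist_eq_norm, h1]
    refine (norm_add_le _ _).trans (add_le_add ((norm_inner_le_norm _ _).trans ?_)
      ((norm_inner_le_norm _ _).trans ?_))
    · rw [J.norm_map]
      gcongr
      exact hb k _
    · rw [J.norm_map]
      gcongr
      exact hS k _ _

/-- A common subsequence for two equicontinuous families that converge along an ultrafilter. -/
theorem exists_subseq_tendsto {X Y : Type*} [TopologicalSpace X] [TopologicalSpace.SeparableSpace X]
    [TopologicalSpace Y] [TopologicalSpace.SeparableSpace Y] {l : Ultrafilter ℕ}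
    (hl : (l : Filter ℕ) ≤ atTop) {F : ℕ → X → ℝ} {f : X → ℝ} {G : ℕ → Y → ℝ} {g : Y → ℝ}
    (hF : Equicontinuous F) (hG : Equicontinuous G)
    (hFf : ∀ x, Tendsto (fun k => F k x) l (𝓝 (f x)))
    (hGg : ∀ y, Tendsto (fun k => G k y) l (𝓝 (g y))) :
    ∃ κ : ℕ → ℕ, StrictMono κ ∧ (∀ x, Tendsto (fun j => F (κ j) x) atTop (𝓝 (f x))) ∧
      ∀ y, Tendsto (fun j => G (κ j) y) atTop (𝓝 (g y)) := by
  obtain ⟨D, hDc, hD⟩ := TopologicalSpace.exists_countable_dense X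
  obtain ⟨D', hDc', hD'⟩ := TopologicalSpace.exists_countable_dense Y
  have : Countable D := hDc.to_subtype
  have : Countable D' := hDc'.to_subtype
  let Φ : ℕ → (D → ℝ) × (D' → ℝ) := fun k => (fun x => F k x, fun y => G k y)
  have hΦ : Tendsto Φ l (𝓝 (fun x : D => f x, fun y : D' => g y)) :=
    (tendsto_pi_nhds.2 fun x : D => hFf x).prodMk_nhds (tendsto_pi_nhds.2 fun y : D' => hGg y)
  have hcl : MapClusterPt (fun x : D => f x, fun y : D' => g y) atTop Φ :=
    hΦ.mapClusterPt.mono hl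
  obtain ⟨κ, hκ, hlim⟩ := hcl.tendsto_subseq
  have hf : Continuous f :=
    Tendsto.continuous_of_equicontinuous (tendsto_pi_nhds.2 hFf) hF
  have hg : Continuous g :=
    Tendsto.continuous_of_equicontinuous (tendsto_pi_nhds.2 hGg) hG
  refine ⟨κ, hκ, fun x => ?_, fun y => ?_⟩
  · have hcl := (hF.comp κ).isClosed_setOfPred_tendsto (l := atTop) hf
    refine hcl.closure_subset_iff.2 (fun z hz => ?_) (hD x)
    exact tendsto_pi_nhds.1 ((continuous_fst.tendsto _).comp hlim) ⟨z, hz⟩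
  · have hcl := (hG.comp κ).isClosed_setOfPred_tendsto (l := atTop) hg
    refine hcl.closure_subset_iff.2 (fun z hz => ?_) (hD' y)
    exact tendsto_pi_nhds.1 ((continuous_snd.tendsto _).comp hlim) ⟨z, hz⟩

end Subsequences

section Convergence

variable {d : ℕ} {Ω : Set (Eucl d)}

theorem exists_bField_of_ell {α β : ℝ} (hα : 0 < α) (hαβ : α ≤ β) (hΩ : MeasurableSet Ω)
    {f : Eucl d → Eucl d →L[ℝ] Eucl d} (hf : Continuous f) (hE : ∀ x ∈ Ω, Ell α β (f x)) :
    ∃ a : BField d (Eucl d) (Eucl d), (∀ x, Ell α β (a x)) ∧ ∀ x ∈ Ω, a x = f x := by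
  classical
  let F : Eucl d → Eucl d →L[ℝ] Eucl d :=
    Ω.piecewise f fun _ => α • ContinuousLinearMap.id ℝ (Eucl d)
  have hF : ∀ x ∈ Ω, F x = f x := fun x hx => Set.piecewise_eq_of_mem _ _ _ hx
  have hFE : ∀ x, Ell α β (F x) := fun x => by
    by_cases hx : x ∈ Ω
    · rw [hF x hx]; exact hE x hx
    · rw [show F x = _ from Set.piecewise_eq_of_notMem _ _ _ hx]; exact ell_smul_id hα hαβ
  exact ⟨⟨F, hf.stronglyMeasurable.piecewise hΩ stronglyMeasurable_const,
    β, fun x => (hFE x).norm_le (hα.le.trans hαβ)⟩, hFE, hF⟩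

theorem norm_flux_le (hΩ : MeasurableSet Ω) {a : BField d (Eucl d) (Eucl d)} {β : ℝ}
    (hβ : 0 ≤ β) (ha : ∀ x, ‖a x‖ ≤ β) (u : H10 Ω) : ‖a.op (embed hΩ u).snd‖ ≤ β * ‖u‖ := by
  refine (a.norm_op_le ha _).trans ?_
  gcongr
  rw [← (embed hΩ).norm_map u]
  exact WithLp.norm_snd_le _ _

set_option maxHeartbeats 1000000 in
/-- `H`-convergence on `ℝ^d` implies convergence of the solutions of the Dirichlet problem, and
of their fluxes. -/
theorem IsHLim.tendsto_dirichlet (hΩ : IsOpen Ω) {l : Ultrafilter ℕ}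
    {a : ℕ → BField d (Eucl d) (Eucl d)} {abar : BField d (Eucl d) (Eucl d)} {β c : ℝ}
    (hβ : 0 ≤ β) (hc : 0 < c) (ha : ∀ k x, ‖a k x‖ ≤ β)
    (hcoer : ∀ k (v : H10 Ω), c * ‖v‖ ^ 2 ≤ inner ℝ (energyOp hΩ.measurableSet (a k) v) v)
    (hinj : Function.Injective (energyOp hΩ.measurableSet abar))
    (h : IsHLim l a abar) {g : H10 Ω} {u : ℕ → H10 Ω} {ubar : H10 Ω}
    (hu : ∀ k, energyOp hΩ.measurableSet (a k) (u k) = g)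
    (hubar : energyOp hΩ.measurableSet abar ubar = g) :
    WeakLim l u ubar ∧ ∀ w : Lp (Eucl d) 2 (volume.restrict Ω),
      Tendsto (fun k => inner ℝ ((a k).op (embed hΩ.measurableSet (u k)).snd)
        (extend _ hΩ.measurableSet w)) l
        (𝓝 (inner ℝ (abar.op (embed hΩ.measurableSet ubar).snd)
          (extend _ hΩ.measurableSet w))) := by
  set hm := hΩ.measurableSet
  have hub : ∀ k, ‖u k‖ ≤ c⁻¹ * ‖g‖ := fun k => by
    rw [← hu k]
    exact norm_le_of_coercive _ hc (hcoer k) (u k)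
  obtain ⟨v, hv⟩ := exists_weakLim l u ⟨_, hub⟩
  obtain ⟨D, hD⟩ := exists_weakLim l (fun k => (a k).op (embed hm (u k)).snd)
    ⟨β * (c⁻¹ * ‖g‖), fun k => (norm_flux_le hm hβ (ha k) (u k)).trans (by gcongr; exact hub k)⟩
  have hsol : ∀ k w, inner ℝ ((a k).op (embed hm (u k)).snd) (embed hm w).snd = inner ℝ g w :=
    fun k w => by rw [← inner_energyOp, hu]
  have hDw : ∀ w : H10 Ω, inner ℝ D (embed hm w).snd = inner ℝ g w := fun w =>
    tendsto_nhds_unique (hD.lim _) (by simp only [hsol]; exact tendsto_const_nhds)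
  have hemb : WeakLim l (fun k => embed hm (u k)) (embed hm v) :=
    hv.map (embed hm).toContinuousLinearMap
  have hmem : ∀ w : H10 Ω, embed hm w ∈ sobZero (Set.univ : Set (Eucl d)) := fun w =>
    sobZero_mono (Set.subset_univ Ω) (extendPair_mem hm w.2)
  have hgrad : GradConv l (fun k => embed hm (u k)) (embed hm v) :=
    ⟨fun k => hmem _, hmem _, hemb⟩
  have hdiv : DivConv l Ω (fun k => (a k).op (embed hm (u k)).snd) D := by
    refine ⟨hD, fun {φ} hφ {w w'} hw => ?_⟩
    have key : ∀ q ∈ sobZero (Set.univ : Set (Eucl d)), ∃ p : H10 Ω, embed hm p = hφ.mulPair q :=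
      fun q hq => exists_extendPair_eq hm (hφ.mulPair_mem hq)
    choose p hp using fun k => key (w k) (hw.mem k)
    obtain ⟨p', hp'⟩ := key w' hw.mem_lim
    have h1 : ∀ k, inner ℝ ((a k).op (embed hm (u k)).snd) (hφ.mulPair (w k)).snd =
        inner ℝ (hφ.mulPair (w k)) (embed hm g) := fun k => by
      rw [← hp, hsol, (embed hm).inner_map_map, real_inner_comm]
    have h2 : inner ℝ D (hφ.mulPair w').snd = inner ℝ (hφ.mulPair w') (embed hm g) := by
      rw [← hp', hDw, (embed hm).inner_map_map, real_inner_comm]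
    simp only [h1, h2]
    exact (hw.lim.map hφ.mulPair).lim _
  have hlim := h Ω hΩ _ _ _ hgrad hdiv
  have hDext : ∀ w : Lp (Eucl d) 2 (volume.restrict Ω),
      inner ℝ D (extend _ hm w) = inner ℝ (abar.op (embed hm v).snd) (extend _ hm w) := by
    intro w
    rw [BField.inner_op, L2.inner_def]
    refine integral_congr_ae ?_
    filter_upwards [hlim, coeFn_extend hm w] with x h1 h2
    rw [h2]
    by_cases hx : x ∈ Ω
    · rw [h1 hx]
    · rw [Set.indicator_of_notMem hx, inner_zero_right, inner_zero_right]
  have hveq : v = ubar := by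
    have h5 : energyOp hm abar v = g := ext_inner_right ℝ fun w => ?_
    · exact hinj (h5.trans hubar.symm)
    rw [inner_energyOp, embed_snd hm w, ← hDext, ← embed_snd, hDw]
  subst hveq
  exact ⟨hv, fun w => hDext w ▸ hD.lim _⟩

instance (F : Type*) [NormedAddCommGroup F] [TopologicalSpace.SeparableSpace F] :
    SecondCountableTopology (Lp F 2 (volume.restrict Ω)) := by
  have : Fact ((2 : ENNReal) ≠ ⊤) := ⟨ENNReal.ofNat_ne_top⟩
  exact Lp.SecondCountableTopology

instance : SecondCountableTopology (L2Pair Ω) :=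
  WithLp.secondCountableTopology 2 _ _

instance : SecondCountableTopology (H10 Ω) :=
  TopologicalSpace.Subtype.secondCountableTopology _

instance : TopologicalSpace.SeparableSpace (H10 Ω × H10 Ω) :=
  TopologicalSpace.SecondCountableTopology.to_separableSpace

instance : TopologicalSpace.SeparableSpace (H10 Ω × Lp (Eucl d) 2 (volume.restrict Ω)) :=
  TopologicalSpace.SecondCountableTopology.to_separableSpace

set_option maxHeartbeats 1000000 in
theorem hConverges_subseq (hd : 1 ≤ d) (hΩ : IsOpen Ω) (hb : Bornology.IsBounded Ω) {α β : ℝ}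
    (hα : 0 < α) (hαβ : α ≤ β) {l : Ultrafilter ℕ} (hl : (l : Filter ℕ) ≤ atTop)
    {a : ℕ → BField d (Eucl d) (Eucl d)} {abar : BField d (Eucl d) (Eucl d)}
    {A : ℕ → Eucl d → Matrix (Fin d) (Fin d) ℝ} {Abar : Eucl d → Matrix (Fin d) (Fin d) ℝ}
    (ha : ∀ k x, Ell α β (a k x)) (habar : ∀ x, Ell α β (abar x)) (h : IsHLim l a abar)
    (hA : ∀ k, ∀ x ∈ Ω, a k x = matCLM (A k x))
    (hAbar : ∀ᵐ x, x ∈ Ω → abar x = matCLM (Abar x))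
    (hAM : ∀ k, InM α β Ω (A k)) (hAbarM : InM α β Ω Abar) :
    ∃ κ : ℕ → ℕ, StrictMono κ ∧ HConverges α β Ω (fun j => A (κ j)) Abar := by
  have hβ : 0 < β := hα.trans_le hαβ
  have hm := hΩ.measurableSet
  obtain ⟨c, hc, hcoer⟩ := exists_energyOp_coercive (β := β) hd hm hb hα
  have hbij : ∀ k, Function.Bijective (energyOp hm (a k)) := fun k =>
    surjective_of_coercive _ hc (hcoer _ (ha k))
  have hbij' : Function.Bijective (energyOp hm abar) :=
    surjective_of_coercive _ hc (hcoer _ habar)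
  choose R hR using fun k => (hbij k).2
  choose Rbar hRbar using hbij'.2
  have haβ : ∀ k x, ‖a k x‖ ≤ β := fun k x => (ha k x).norm_le hβ.le
  have hRb : ∀ k g, ‖R k g‖ ≤ c⁻¹ * ‖g‖ := fun k g => by
    simpa only [hR] using norm_le_of_coercive _ hc (hcoer _ (ha k)) (R k g)
  have hRl : ∀ k g g', ‖R k g - R k g'‖ ≤ c⁻¹ * ‖g - g'‖ := fun k g g' => by
    simpa only [map_sub, hR] using norm_le_of_coercive _ hc (hcoer _ (ha k)) (R k g - R k g')
  have hlim : ∀ g, _ := fun g => h.tendsto_dirichlet hΩ hβ.le hc haβ (fun k => hcoer _ (ha k))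
    hbij'.1 (fun k => hR k g) (hRbar g)
  obtain ⟨κ, hκ, h1, h2⟩ := exists_subseq_tendsto hl
    (F := fun k (p : H10 Ω × H10 Ω) => inner ℝ (R k p.1) p.2)
    (f := fun p => inner ℝ (Rbar p.1) p.2)
    (G := fun k (p : H10 Ω × Lp (Eucl d) 2 (volume.restrict Ω)) =>
      inner ℝ ((a k).op (embed hm (R k p.1)).snd) (extend _ hm p.2))
    (g := fun p => inner ℝ (abar.op (embed hm (Rbar p.1)).snd) (extend _ hm p.2))
    (equicontinuous_inner LinearIsometry.id hRb hRl)
    (equicontinuous_inner (S := fun k g => (a k).op (embed hm (R k g)).snd) (M := β * c⁻¹)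
      (extend _ hm)
      (fun k g => (norm_flux_le hm hβ.le (haβ k) _).trans (by
        rw [mul_assoc]; gcongr; exact hRb k g))
      fun k g g' => by
        rw [← map_sub, ← WithLp.sub_snd, ← map_sub]
        refine (norm_flux_le hm hβ.le (haβ k) _).trans ?_
        rw [mul_assoc]; gcongr; exact hRl k g g')
    (fun p => (hlim p.1).1.lim p.2) fun p => (hlim p.1).2 p.2
  refine ⟨κ, hκ, fun j => hAM _, ⟨α, β, hα, hαβ, hAbarM⟩, fun f => ?_⟩
  set g := (InnerProductSpace.toDual ℝ (H10 Ω)).symm f with hg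
  have hAae : ∀ k, ∀ᵐ x, x ∈ Ω → a k x = matCLM (A k x) := fun k =>
    Eventually.of_forall (hA k)
  refine ⟨fun j => R (κ j) g, Rbar g, fun j v => ?_, fun v => ?_, fun w => ?_, fun w => ?_⟩
  · rw [isWeakSol_iff hm (hAae _), ← hg, ← hR (κ j) g]
    exact (hbij _).1.eq_iff.trans (by rw [hR])
  · rw [isWeakSol_iff hm hAbar, ← hg, ← hRbar g]
    exact hbij'.1.eq_iff.trans (by rw [hRbar])
  · have h3 : ∀ v, w v = inner ℝ v ((InnerProductSpace.toDual ℝ (H10 Ω)).symm w) := fun v => by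
      rw [real_inner_comm]
      exact InnerProductSpace.toDual_symm_apply.symm
    simp only [h3]
    exact h1 (g, _)
  · have h4 := h2 (g, w)
    simp only [embed_snd] at h4
    rw [inner_op_extend hm hAbar] at h4
    refine h4.congr fun j => inner_op_extend hm (hAae _) _ _

end Convergence

theorem theorem2 {d n : ℕ} (hd : 2 ≤ d) (hn : 1 ≤ n)
    (Ω : Set (Eucl d)) (hΩo : IsOpen Ω) (hΩc : IsConnected Ω) (hΩb : Bornology.IsBounded Ω)
    (α β : ℝ) (hα : 0 < α) (hαβ : α ≤ β)
    (γ L : ℝ) (hγ0 : 0 < γ) (hγ1 : γ ≤ 1) (hL : 0 < L)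
    (A : Eucl d → (Fin n → Eucl d) → Matrix (Fin d) (Fin d) ℝ)
    (hAM : ∀ y : Fin n → Eucl d, InM α β Ω (fun x => A x y))
    (hAper : IsPeriodicCoeff A) (hAhol : IsHolderCoeff γ L A)
    (ε : ℕ → Fin n → ℝ) (hεpos : ∀ k i, 0 < ε k i) (hεanti : ∀ k, Antitone (ε k))
    (hεlim : Tendsto (fun k => ε k ⟨n - 1, Nat.sub_lt hn Nat.one_pos⟩) atTop (𝓝 0)) :
    ∃ κ : ℕ → ℕ, StrictMono κ ∧
      ∃ m : ℕ, m ≤ n - 1 ∧ (2 ≤ n → 1 ≤ m) ∧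
        ∃ (B : Eucl d → (Fin m → Eucl d) → Matrix (Fin d) (Fin d) ℝ) (δ : Fin m → ℝ),
          (∀ i, 0 < δ i) ∧
          (∀ y : Fin m → Eucl d, InM α β Ω (fun x => B x y)) ∧
          IsPeriodicCoeff B ∧
          (∃ L' : ℝ, 0 < L' ∧ IsHolderCoeff γ L' B) ∧
          HConverges α β Ω (fun j => atScales A (ε (κ j))) (atScales B δ) := by
  have hβ : 0 < β := hα.trans_le hαβ
  have hm := hΩo.measurableSet
  have hA : IsAdmissible α β γ L Ω fun x y => matCLM (A x y) :=
    { ell := fun x hx y => (hAM y).ell hα hβ hΩo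
        (continuous_coeff_left hγ0 hAhol y) hx
      periodic := fun x y z => congrArg matCLM (hAper x y z)
      holder := fun x x' y y' => by rw [← map_sub]; exact hAhol x x' y y' }
  have hl : (hyperfilter ℕ : Filter ℕ) ≤ atTop := Nat.hyperfilter_le_atTop
  have hfr : Tendsto (fun k => |(ε k ⟨n - 1, Nat.sub_lt hn Nat.one_pos⟩)⁻¹|)
      (hyperfilter ℕ : Filter ℕ) atTop := by
    refine (tendsto_abs_atTop_atTop.comp (tendsto_inv_nhdsGT_zero.comp ?_)).mono_left hl
    exact tendsto_nhdsWithin_iff.2 ⟨hεlim, Eventually.of_forall fun k => hεpos k _⟩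
  obtain ⟨m, N, hmn, P, Q, μ, ν, η, hsplit, hμ, hν⟩ :=
    exists_frequency_splitting (hyperfilter ℕ) (fun k i => (ε k i)⁻¹) _ hfr
  obtain ⟨B₀, L₀, hL₀, hB₀E, hB₀per, hB₀hol, hB₀⟩ :=
    hA.exists_effective hγ0 hβ hα hαβ hL hΩo hl P Q hsplit hμ hν
  obtain ⟨B₁, L₁, hL₁, hB₁, hB₁per, hB₁hol⟩ :=
    exists_holder_extension hΩc.nonempty hγ0 hγ1 hL₀ B₀ hB₀per hB₀hol
  obtain ⟨B, δ, hδ, hBper, hBhol, hBval, hBscale⟩ :=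
    exists_coeff_of_frequencies (le_max_left m (min 1 (n - 1))) hγ0 hL₁ hB₁per hB₁hol η
  have hBE : ∀ x ∈ Ω, ∀ y, Ell α β (matCLM (B x y)) := fun x hx y => by
    obtain ⟨y', hy'⟩ := hBval x y
    rw [hy', hB₁ ⟨x, hx⟩]
    exact hB₀E _ _
  choose a haE haΩ using fun k => exists_bField_of_ell hα hαβ hm
    (continuous_atScales hγ0 hAhol (ε k)) fun x hx => ell_atScales hA.ell (ε k) hx
  obtain ⟨abar, habarE, hlim⟩ := exists_isHLim (hyperfilter ℕ) a hα hαβ haE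
  have habar : ∀ᵐ x, x ∈ Ω → abar x = matCLM (atScales B δ x) := by
    filter_upwards [hB₀ a abar haE habarE haΩ hlim] with x hx hxΩ
    rw [hx hxΩ, hBscale, hB₁ ⟨x, hxΩ⟩]
  obtain ⟨κ, hκ, hconv⟩ := hConverges_subseq (by omega) hΩo hΩb hα hαβ hl haE habarE hlim haΩ habar
    (fun k => inM_of_ell hα hβ hm (continuous_atScales hγ0 hAhol _)
      fun x hx => ell_atScales hA.ell _ hx)
    (inM_of_ell hα hβ hm (continuous_atScales hγ0 hBhol δ) fun x hx => ell_atScales hBE _ hx)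
  refine ⟨κ, hκ, max m (min 1 (n - 1)), by omega, by omega, B, δ, hδ, fun y => ?_, hBper,
    ⟨L₁, hL₁, hBhol⟩, hconv⟩
  exact inM_of_ell hα hβ hm (continuous_coeff_left hγ0 hBhol y) fun x hx => hBE x hx y
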